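/- Let $G=(V,E)$ be a directed graph with $n=|V|$ vertices and $m=|E|\ge 1$ edges (at most one edge for each ordered pair of vertices), with non-negative integer edge costs at most $c$ and non-negative real edge capacities. The distance of a path is the sum of its edge costs, and its bottleneck is the least capacity of its edges ($\infty$ for the path without edges); a path can push the flow $f$ if its bottleneck is at least $f$. The All Pairs Shortest Paths for All Flows (APSP-AF) problem is to compute, for every ordered pair $(u,v)\in V\times V$, the list $S[u][v]$, in order of strictly increasing $d$, of all pairs $(d,f)$ such that $d$ is the shortest distance of a path from $u$ to $v$ that can push $f$, and $f$ is the greatest bottleneck of a path from $u$ to $v$ of distance at most $d$. With each pair there has to be stored a predecessor of $v$ (none for the path without edges), together with the position, in the list of that predecessor, of the pair with which the path continues backwards, so that following these pointers from $(d,f)\in S[u][v]$ back to $u$ yields, in one step per edge, a path from $u$ to $v$ of distance $d$ and bottleneck $f$. The machine is a random access machine with integer words of $O(\log(n+c))$ bits and zero-initialized memory. In one step it can load a constant, copy, add, subtract (truncated at $0$) or compare integers and read or write an array cell at a computed index. Flow values (capacities and $\infty$) are kept in separate variables and arrays and can only be copied, compared and set to $\infty$. The input consists of $n$, $m$, $c$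 and the array of edges with tails, heads, costs and capacities. Then there are two algorithms (fixed programs for this machine) that solve the APSP-AF problem on all such graphs, the first one in worst case time $$O\left(m^2n+nc\right),$$ and the second one in worst case time $$O\left(m^2n+mn^2\log^+\left(\frac{c}{mn}\right)\right),\qquad \log^+ x=\max\{0,\log x\}\ \ (\log^+ 0=0),$$ where the constants in the $O$ are absolute, that is, do not depend on $n$, $m$, $c$ or the graph. -/

import Mathlib

/-! ### Directed graphs with integer edge costs and real edge capacities -/

/-- A directed graph with `n` vertices and `m` edges, given by its array of edges (at most one
edge for each ordered pair of vertices), with integer edge costs in `{0, …, c}` and non-negative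
real edge capacities. -/
structure FlowGraph (n m c : ℕ) where
  src : Fin m → Fin n
  dst : Fin m → Fin n
  edge_inj : ∀ e e' : Fin m, src e = src e' → dst e = dst e' → e = e'
  cost : Fin m → ℕ
  cost_le : ∀ e, cost e ≤ c
  cap : Fin m → ℝ
  cap_nonneg : ∀ e, 0 ≤ cap e

namespace FlowGraph

variable {n m c : ℕ}

/-- `G.IsPath u π v`: the list of edges `π` is a directed path from `u` to `v`
(vertices may be repeated, which changes no shortest distance and no greatest bottleneck). -/
def IsPath (G : FlowGraph n m c) : Fin n → List (Fin m) → Fin n → Prop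
  | u, [], v => u = v
  | u, e :: π, v => G.src e = u ∧ IsPath G (G.dst e) π v

/-- The distance along a path: the sum of its edge costs. -/
def pathCost (G : FlowGraph n m c) (π : List (Fin m)) : ℕ := (π.map G.cost).sum

/-- The bottleneck of a path: the least capacity of its edges (`∞` for the path without edges). -/
def bottleneck (G : FlowGraph n m c) (π : List (Fin m)) : WithTop ℝ :=
  π.foldr (fun e b => min (G.cap e : WithTop ℝ) b) ⊤

/-- `(d, f)` is one of the pairs that have to be found for `u` and `v`: `d` is the shortest
distance of a path from `u` to `v` that can push `f`, and no path from `u` to `v` of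
distance at most `d` can push more than `f`, while some such path can push `f`. -/
def IsUseful (G : FlowGraph n m c) (u v : Fin n) (d : ℕ) (f : WithTop ℝ) : Prop :=
  IsLeast {x | ∃ π, G.IsPath u π v ∧ f ≤ G.bottleneck π ∧ G.pathCost π = x} d ∧
  IsGreatest {x | ∃ π, G.IsPath u π v ∧ G.pathCost π ≤ d ∧ G.bottleneck π = x} f

end FlowGraph

/-! ### Solutions of the all pairs shortest paths for all flows problem -/

/-- An entry of the list `S[u][v]`: the pair `(d, f)`, the predecessor of `v` on a path from `u`
(the code is `0` if there is none, and `w + 1` for the vertex `w`), and the position in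
`S[u][w]` of the entry with which that path continues backwards. -/
structure FlowEntry where
  dist : ℕ
  flow : WithTop ℝ
  pred : ℕ
  predPos : ℕ

/-- `Retrieves G S u v r π`: following the predecessors from the entry `r` of `S[u][v]` back to
`u` takes `π.length` steps and yields the path `π`. -/
inductive Retrieves {n m c : ℕ} (G : FlowGraph n m c) (S : Fin n → Fin n → List FlowEntry)
    (u : Fin n) : Fin n → FlowEntry → List (Fin m) → Prop
  | start (r : FlowEntry) : r.pred = 0 → Retrieves G S u u r []
  | step (e : Fin m) (r q : FlowEntry) (π : List (Fin m)) :
      r.pred = (G.src e : ℕ) + 1 → (S u (G.src e))[r.predPos]? = some q →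
      Retrieves G S u (G.src e) q π → Retrieves G S u (G.dst e) r (π ++ [e])

/-- `S` solves the problem on `G`: for all `u` and `v`, the list `S[u][v]` has strictly increasing
distances, its pairs `(d, f)` are exactly the useful ones, and from each of its entries a path
from `u` to `v` with distance `d` and bottleneck `f` is retrieved. -/
def SolvesAPSPAF {n m c : ℕ} (G : FlowGraph n m c) (S : Fin n → Fin n → List FlowEntry) : Prop :=
  ∀ u v : Fin n,
    ((S u v).map FlowEntry.dist).Pairwise (· < ·) ∧
    (∀ d f, (∃ r ∈ S u v, r.dist = d ∧ r.flow = f) ↔ G.IsUseful u v d f) ∧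
    ∀ r ∈ S u v, ∃ π, Retrieves G S u v r π ∧ G.IsPath u π v ∧
      G.pathCost π = r.dist ∧ G.bottleneck π = r.flow

/-! ### The machine model: comparison-addition programs with random access -/

/-- The memory: integer variables and integer arrays, flow variables and flow arrays
(a program names finitely many of them; array cells are accessed by computed indices). -/
structure RamState where
  ivar : ℕ → ℕ
  iarr : ℕ → ℕ → ℕ
  fvar : ℕ → WithTop ℝ
  farr : ℕ → ℕ → WithTop ℝ

namespace RamState

def setI (s : RamState) (x k : ℕ) : RamState :=
  { s with ivar := Function.update s.ivar x k }

def setIA (s : RamState) (a i k : ℕ) : RamState :=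
  { s with iarr := Function.update s.iarr a (Function.update (s.iarr a) i k) }

noncomputable def setF (s : RamState) (x : ℕ) (f : WithTop ℝ) : RamState :=
  { s with fvar := Function.update s.fvar x f }

noncomputable def setFA (s : RamState) (a i : ℕ) (f : WithTop ℝ) : RamState :=
  { s with farr := Function.update s.farr a (Function.update (s.farr a) i f) }

end RamState

/-- Programs. On integers there are constants, copying, addition, subtraction (truncated at `0`),
comparison and random access to arrays; flow values can only be copied, set to `∞` and compared. -/
inductive RamProg where
  | skip : RamProg
  | const (x k : ℕ) : RamProg
  | copy (x y : ℕ) : RamProg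
  | add (x y z : ℕ) : RamProg
  | sub (x y z : ℕ) : RamProg
  | read (x a y : ℕ) : RamProg
  | write (a y x : ℕ) : RamProg
  | ftop (x : ℕ) : RamProg
  | fcopy (x y : ℕ) : RamProg
  | fread (x a y : ℕ) : RamProg
  | fwrite (a y x : ℕ) : RamProg
  | seq (P Q : RamProg) : RamProg
  | ifLt (x y : ℕ) (P Q : RamProg) : RamProg
  | fifLt (x y : ℕ) (P Q : RamProg) : RamProg
  | whileLt (x y : ℕ) (P : RamProg) : RamProg

/-- `RamExec W P s s' t`: on a machine whose integer words hold the numbers `0, …, W`, the program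
`P` started in the state `s` halts in the state `s'` after exactly `t` steps, and no operation
overflows. Each elementary operation and each evaluation of a test is one step. -/
inductive RamExec (W : ℕ) : RamProg → RamState → RamState → ℕ → Prop
  | skip (s : RamState) : RamExec W .skip s s 1
  | const (s : RamState) (x k : ℕ) : k ≤ W → RamExec W (.const x k) s (s.setI x k) 1
  | copy (s : RamState) (x y : ℕ) : RamExec W (.copy x y) s (s.setI x (s.ivar y)) 1
  | add (s : RamState) (x y z : ℕ) : s.ivar y + s.ivar z ≤ W →
      RamExec W (.add x y z) s (s.setI x (s.ivar y + s.ivar z)) 1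
  | sub (s : RamState) (x y z : ℕ) :
      RamExec W (.sub x y z) s (s.setI x (s.ivar y - s.ivar z)) 1
  | read (s : RamState) (x a y : ℕ) :
      RamExec W (.read x a y) s (s.setI x (s.iarr a (s.ivar y))) 1
  | write (s : RamState) (a y x : ℕ) :
      RamExec W (.write a y x) s (s.setIA a (s.ivar y) (s.ivar x)) 1
  | ftop (s : RamState) (x : ℕ) : RamExec W (.ftop x) s (s.setF x ⊤) 1
  | fcopy (s : RamState) (x y : ℕ) : RamExec W (.fcopy x y) s (s.setF x (s.fvar y)) 1
  | fread (s : RamState) (x a y : ℕ) :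
      RamExec W (.fread x a y) s (s.setF x (s.farr a (s.ivar y))) 1
  | fwrite (s : RamState) (a y x : ℕ) :
      RamExec W (.fwrite a y x) s (s.setFA a (s.ivar y) (s.fvar x)) 1
  | seq (P Q : RamProg) (s s₁ s₂ : RamState) (t₁ t₂ : ℕ) :
      RamExec W P s s₁ t₁ → RamExec W Q s₁ s₂ t₂ → RamExec W (.seq P Q) s s₂ (t₁ + t₂)
  | ifLt_true (x y : ℕ) (P Q : RamProg) (s s' : RamState) (t : ℕ) :
      s.ivar x < s.ivar y → RamExec W P s s' t → RamExec W (.ifLt x y P Q) s s' (t + 1)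
  | ifLt_false (x y : ℕ) (P Q : RamProg) (s s' : RamState) (t : ℕ) :
      ¬ s.ivar x < s.ivar y → RamExec W Q s s' t → RamExec W (.ifLt x y P Q) s s' (t + 1)
  | fifLt_true (x y : ℕ) (P Q : RamProg) (s s' : RamState) (t : ℕ) :
      s.fvar x < s.fvar y → RamExec W P s s' t → RamExec W (.fifLt x y P Q) s s' (t + 1)
  | fifLt_false (x y : ℕ) (P Q : RamProg) (s s' : RamState) (t : ℕ) :
      ¬ s.fvar x < s.fvar y → RamExec W Q s s' t → RamExec W (.fifLt x y P Q) s s' (t + 1)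
  | whileLt_true (x y : ℕ) (P : RamProg) (s s₁ s₂ : RamState) (t₁ t₂ : ℕ) :
      s.ivar x < s.ivar y → RamExec W P s s₁ t₁ → RamExec W (.whileLt x y P) s₁ s₂ t₂ →
      RamExec W (.whileLt x y P) s s₂ (t₁ + t₂ + 1)
  | whileLt_false (x y : ℕ) (P : RamProg) (s : RamState) :
      ¬ s.ivar x < s.ivar y → RamExec W (.whileLt x y P) s s 1

/-- The first `k` cells of an array hold the values of `g`; all other cells hold `0`. -/
def arrayOf {α : Type} [Zero α] {k : ℕ} (g : Fin k → α) (i : ℕ) : α :=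
  if h : i < k then g ⟨i, h⟩ else 0

/-- The input: `n`, `m`, `c` in the first three integer variables; tails, heads and costs
of the edges in the first three integer arrays; capacities in the first flow array.
Everything else is `0`. -/
noncomputable def inputState {n m c : ℕ} (G : FlowGraph n m c) : RamState where
  ivar x := if x = 0 then n else if x = 1 then m else if x = 2 then c else 0
  iarr a := if a = 0 then arrayOf (fun e => (G.src e : ℕ))
    else if a = 1 then arrayOf (fun e => (G.dst e : ℕ))
    else if a = 2 then arrayOf G.cost
    else fun _ => 0
  fvar _ := 0
  farr a := if a = 0 then arrayOf (fun e => (G.cap e : WithTop ℝ)) else fun _ => 0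

/-- The output: in row-major order, integer arrays `3` and `4` give the length of the list
`S[u][v]` and the index at which it begins; its entries are stored consecutively, with
distances, predecessors and predecessor positions in the integer arrays `5`, `6`, `7` and
flows in the flow array `1`. -/
def outputLists {n : ℕ} (s : RamState) (u v : Fin n) : List FlowEntry :=
  (List.range (s.iarr 3 (u * n + v))).map fun i =>
    { dist := s.iarr 5 (s.iarr 4 (u * n + v) + i)
      flow := s.farr 1 (s.iarr 4 (u * n + v) + i)
      pred := s.iarr 6 (s.iarr 4 (u * n + v) + i)
      predPos := s.iarr 7 (s.iarr 4 (u * n + v) + i) }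

/-- The program `P` solves the all pairs shortest paths for all flows problem in `O(T)` time on
directed graphs with `n` vertices, `m ≥ 1` edges and integer edge costs bounded by `c`, on a
machine with words of `O(log (n + c))` bits. -/
def SolvesAPSPAFInTime (P : RamProg) (T : ℕ → ℕ → ℕ → ℝ) : Prop :=
  ∃ C K : ℕ, ∀ n m c : ℕ, 1 ≤ m → ∀ G : FlowGraph n m c,
    ∃ (s : RamState) (t : ℕ), RamExec ((n + c + 2) ^ K) P (inputState G) s t ∧
      SolvesAPSPAF G (outputLists s) ∧ (t : ℝ) ≤ C * T n m c

/-! ### A weakest precondition calculus with running times -/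

namespace RamState

/-! A single algorithm gives both bounds. Since log⁺ x ≤ x, the second bound is at most m²n +
mn²·c/(mn) = m²n + nc, so the work lies in `apspaf_solves`.

A layer is a source u together with an edge i; in it Dijkstra's algorithm runs from u on the edges
of capacity at least that of i. The bottleneck of a nonempty path is the capacity of one of its
edges, so every path is dominated by the distance found in some layer (`DInv.exists_item`), and the
useful pairs are the Pareto optimal pairs (distance, capacity) among the items (u, i, v). There are
nm layers and each relaxes an edge at most once, which costs O(nm²). It remains to pay for the
priority queue.

All layers share one monotone queue, so that passing over empty intervals is paid only once. With q
= min(n, m + 1), a layer reaches at most q vertices, hence no distance exceeds cq. Let k be least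
with c ≤ 2^k·nm. Then the numbers of the intervals of length 2^k that matter are at most N = nmq,
which also bounds the number of reachable items; each such interval has its own bucket. Only the
current one is refined, by repeated halving: slot 0 is the current dyadic interval, and the slots up
to k are the right halves still to come (`QInv`). Keys of live items only decrease and splitting
only lowers levels, so an item descends at most k + 1 levels. The total is O(N(k + 1) + nm²); with q
≤ n, q ≤ 2m and k ≤ 1 + 2 log⁺(c/(mn)) this is the claim. The accounting uses the potential `pot`:
for every part of the search loop, elapsed time plus allocated list nodes plus potential is
controlled, and this sum never grows over a whole step (`search_spec`).

Items are settled in order of nondecreasing distance, so the output lists change only at their ends.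
A back pointer names the position recorded for the parent of an item. The entry found there may
belong to another layer, or may have been replaced later by one with the same distance and a larger
flow; following pointers can therefore change layers. It still terminates, because the pair (number
of items of larger flow, index in the order of settling) decreases lexicographically
(`Written.retrieves`). The path obtained is at least as good as the entry in both coordinates, and
optimality of the entry makes it exact (`Written.solves`). -/

@[simp] theorem ivar_setI (s : RamState) (x k y : ℕ) :
    (s.setI x k).ivar y = if y = x then k else s.ivar y := by
  simp [setI, Function.update_apply]

@[simp] theorem iarr_setI (s : RamState) (x k : ℕ) : (s.setI x k).iarr = s.iarr := rfl
@[simp] theorem fvar_setI (s : RamState) (x k : ℕ) : (s.setI x k).fvar = s.fvar := rfl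
@[simp] theorem farr_setI (s : RamState) (x k : ℕ) : (s.setI x k).farr = s.farr := rfl

@[simp] theorem iarr_setIA (s : RamState) (a i k b : ℕ) :
    (s.setIA a i k).iarr b = if b = a then Function.update (s.iarr a) i k else s.iarr b := by
  simp [setIA, Function.update_apply]

@[simp] theorem ivar_setIA (s : RamState) (a i k : ℕ) : (s.setIA a i k).ivar = s.ivar := rfl
@[simp] theorem fvar_setIA (s : RamState) (a i k : ℕ) : (s.setIA a i k).fvar = s.fvar := rfl
@[simp] theorem farr_setIA (s : RamState) (a i k : ℕ) : (s.setIA a i k).farr = s.farr := rfl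

@[simp] theorem fvar_setF (s : RamState) (x : ℕ) (f : WithTop ℝ) (y : ℕ) :
    (s.setF x f).fvar y = if y = x then f else s.fvar y := by
  simp [setF, Function.update_apply]

@[simp] theorem ivar_setF (s : RamState) (x : ℕ) (f : WithTop ℝ) : (s.setF x f).ivar = s.ivar := rfl
@[simp] theorem iarr_setF (s : RamState) (x : ℕ) (f : WithTop ℝ) : (s.setF x f).iarr = s.iarr := rfl
@[simp] theorem farr_setF (s : RamState) (x : ℕ) (f : WithTop ℝ) : (s.setF x f).farr = s.farr := rfl

@[simp] theorem farr_setFA (s : RamState) (a i : ℕ) (f : WithTop ℝ) (b : ℕ) :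
    (s.setFA a i f).farr b = if b = a then Function.update (s.farr a) i f else s.farr b := by
  simp [setFA, Function.update_apply]

@[simp] theorem ivar_setFA (s : RamState) (a i : ℕ) (f : WithTop ℝ) :
    (s.setFA a i f).ivar = s.ivar := rfl
@[simp] theorem iarr_setFA (s : RamState) (a i : ℕ) (f : WithTop ℝ) :
    (s.setFA a i f).iarr = s.iarr := rfl
end RamState

/-- From `s` the program `P` halts, and its final state and running time satisfy `Q`. -/
def WP (W : ℕ) (P : RamProg) (Q : RamState → ℕ → Prop) (s : RamState) : Prop :=
  ∃ s' t, RamExec W P s s' t ∧ Q s' t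

namespace WP

variable {W : ℕ} {s : RamState} {Q Q' : RamState → ℕ → Prop}

theorem mono {P : RamProg} (h : WP W P Q s) (hQ : ∀ s' t, Q s' t → Q' s' t) : WP W P Q' s := by
  obtain ⟨s', t, he, hq⟩ := h
  exact ⟨s', t, he, hQ _ _ hq⟩

@[simp] theorem skip_iff : WP W .skip Q s ↔ Q s 1 :=
  ⟨by rintro ⟨_, _, ⟨⟩, h⟩; exact h, fun h => ⟨_, _, .skip s, h⟩⟩

@[simp] theorem const_iff (x k : ℕ) : WP W (.const x k) Q s ↔ k ≤ W ∧ Q (s.setI x k) 1 :=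
  ⟨by rintro ⟨_, _, ⟨⟩, h⟩; exact ⟨by assumption, h⟩, fun h => ⟨_, _, .const s x k h.1, h.2⟩⟩

@[simp] theorem copy_iff (x y : ℕ) : WP W (.copy x y) Q s ↔ Q (s.setI x (s.ivar y)) 1 :=
  ⟨by rintro ⟨_, _, ⟨⟩, h⟩; exact h, fun h => ⟨_, _, .copy s x y, h⟩⟩

@[simp] theorem add_iff (x y z : ℕ) : WP W (.add x y z) Q s ↔
    s.ivar y + s.ivar z ≤ W ∧ Q (s.setI x (s.ivar y + s.ivar z)) 1 :=
  ⟨by rintro ⟨_, _, ⟨⟩, h⟩; exact ⟨by assumption, h⟩, fun h => ⟨_, _, .add s x y z h.1, h.2⟩⟩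

@[simp] theorem sub_iff (x y z : ℕ) : WP W (.sub x y z) Q s ↔
    Q (s.setI x (s.ivar y - s.ivar z)) 1 :=
  ⟨by rintro ⟨_, _, ⟨⟩, h⟩; exact h, fun h => ⟨_, _, .sub s x y z, h⟩⟩

@[simp] theorem read_iff (x a y : ℕ) : WP W (.read x a y) Q s ↔
    Q (s.setI x (s.iarr a (s.ivar y))) 1 :=
  ⟨by rintro ⟨_, _, ⟨⟩, h⟩; exact h, fun h => ⟨_, _, .read s x a y, h⟩⟩

@[simp] theorem write_iff (a y x : ℕ) : WP W (.write a y x) Q s ↔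
    Q (s.setIA a (s.ivar y) (s.ivar x)) 1 :=
  ⟨by rintro ⟨_, _, ⟨⟩, h⟩; exact h, fun h => ⟨_, _, .write s a y x, h⟩⟩

@[simp] theorem ftop_iff (x : ℕ) : WP W (.ftop x) Q s ↔ Q (s.setF x ⊤) 1 :=
  ⟨by rintro ⟨_, _, ⟨⟩, h⟩; exact h, fun h => ⟨_, _, .ftop s x, h⟩⟩

@[simp] theorem fread_iff (x a y : ℕ) : WP W (.fread x a y) Q s ↔
    Q (s.setF x (s.farr a (s.ivar y))) 1 :=
  ⟨by rintro ⟨_, _, ⟨⟩, h⟩; exact h, fun h => ⟨_, _, .fread s x a y, h⟩⟩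

@[simp] theorem fwrite_iff (a y x : ℕ) : WP W (.fwrite a y x) Q s ↔
    Q (s.setFA a (s.ivar y) (s.fvar x)) 1 :=
  ⟨by rintro ⟨_, _, ⟨⟩, h⟩; exact h, fun h => ⟨_, _, .fwrite s a y x, h⟩⟩

@[simp] theorem seq_iff (P R : RamProg) : WP W (.seq P R) Q s ↔
    WP W P (fun s₁ t₁ => WP W R (fun s₂ t₂ => Q s₂ (t₁ + t₂)) s₁) s := by
  constructor
  · rintro ⟨_, _, h, hq⟩
    cases h with
    | seq _ _ _ s₁ _ t₁ t₂ h₁ h₂ => exact ⟨s₁, t₁, h₁, _, t₂, h₂, hq⟩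
  · rintro ⟨s₁, t₁, h₁, s₂, t₂, h₂, hq⟩
    exact ⟨s₂, _, .seq _ _ _ _ _ _ _ h₁ h₂, hq⟩

@[simp] theorem ifLt_iff (x y : ℕ) (P R : RamProg) : WP W (.ifLt x y P R) Q s ↔
    (s.ivar x < s.ivar y → WP W P (fun s' t => Q s' (t + 1)) s) ∧
    (¬ s.ivar x < s.ivar y → WP W R (fun s' t => Q s' (t + 1)) s) := by
  constructor
  · rintro ⟨s', _, h, hq⟩
    cases h with
    | ifLt_true _ _ _ _ _ _ t hc h => exact ⟨fun _ => ⟨_, t, h, hq⟩, fun hn => absurd hc hn⟩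
    | ifLt_false _ _ _ _ _ _ t hc h => exact ⟨fun hp => absurd hp hc, fun _ => ⟨_, t, h, hq⟩⟩
  · rintro ⟨h₁, h₂⟩
    by_cases hc : s.ivar x < s.ivar y
    · obtain ⟨s', t, h, hq⟩ := h₁ hc
      exact ⟨s', _, .ifLt_true _ _ _ _ _ _ _ hc h, hq⟩
    · obtain ⟨s', t, h, hq⟩ := h₂ hc
      exact ⟨s', _, .ifLt_false _ _ _ _ _ _ _ hc h, hq⟩

@[simp] theorem fifLt_iff (x y : ℕ) (P R : RamProg) : WP W (.fifLt x y P R) Q s ↔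
    (s.fvar x < s.fvar y → WP W P (fun s' t => Q s' (t + 1)) s) ∧
    (¬ s.fvar x < s.fvar y → WP W R (fun s' t => Q s' (t + 1)) s) := by
  constructor
  · rintro ⟨s', _, h, hq⟩
    cases h with
    | fifLt_true _ _ _ _ _ _ t hc h => exact ⟨fun _ => ⟨_, t, h, hq⟩, fun hn => absurd hc hn⟩
    | fifLt_false _ _ _ _ _ _ t hc h => exact ⟨fun hp => absurd hp hc, fun _ => ⟨_, t, h, hq⟩⟩
  · rintro ⟨h₁, h₂⟩
    by_cases hc : s.fvar x < s.fvar y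
    · obtain ⟨s', t, h, hq⟩ := h₁ hc
      exact ⟨s', _, .fifLt_true _ _ _ _ _ _ _ hc h, hq⟩
    · obtain ⟨s', t, h, hq⟩ := h₂ hc
      exact ⟨s', _, .fifLt_false _ _ _ _ _ _ _ hc h, hq⟩

/-- The loop rule: an invariant that bounds the elapsed time forces termination. -/
theorem whileLt {x y : ℕ} {P : RamProg} (I : RamState → ℕ → Prop) (B : ℕ) (hI : I s 0)
    (hB : ∀ s t, I s t → t ≤ B)
    (hP : ∀ s t, I s t → s.ivar x < s.ivar y → WP W P (fun s' t' => I s' (t + t' + 1)) s)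
    (hQ : ∀ s t, I s t → ¬ s.ivar x < s.ivar y → Q s (t + 1)) :
    WP W (.whileLt x y P) Q s := by
  -- Every iteration takes at least one step, and the invariant caps the elapsed time by B; hence r
  -- bounds the iterations that are left.
  suffices H : ∀ r s t, I s t → B < t + r →
      ∃ s' t', RamExec W (.whileLt x y P) s s' t' ∧ Q s' (t + t') by
    obtain ⟨s', t', h, hq⟩ := H (B + 1) s 0 hI (by omega)
    exact ⟨s', t', h, by simpa using hq⟩
  intro r
  induction r with
  | zero => intro s t h hb; have := hB s t h; omega
  | succ r ih =>
    intro s t h hb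
    by_cases hc : s.ivar x < s.ivar y
    · obtain ⟨s₁, t₁, h₁, hi⟩ := hP s t h hc
      obtain ⟨s₂, t₂, h₂, hq⟩ := ih s₁ (t + t₁ + 1) hi (by omega)
      refine ⟨s₂, _, .whileLt_true _ _ _ _ _ _ _ _ hc h₁ h₂, ?_⟩
      convert hq using 1
      omega
    · exact ⟨s, 1, .whileLt_false _ _ _ _ hc, hQ s t h hc⟩

/-- The rule for loops with at most `N` iterations of bounded cost. -/
theorem countLoop {x y : ℕ} {P : RamProg} (I : ℕ → RamState → Prop) (N T : ℕ) (hI : I 0 s)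
    (hc : ∀ i s, i ≤ N → I i s → (s.ivar x < s.ivar y ↔ i < N))
    (hP : ∀ i s, i < N → I i s → WP W P (fun s' t => t ≤ T ∧ I (i + 1) s') s)
    (hQ : ∀ s t, t ≤ N * (T + 1) + 1 → I N s → Q s t) :
    WP W (.whileLt x y P) Q s := by
  refine whileLt (fun s t => ∃ i ≤ N, I i s ∧ t ≤ i * (T + 1)) (N * (T + 1))
    ⟨0, by omega, hI, by omega⟩ ?_ ?_ ?_
  · rintro s t ⟨i, hi, -, ht⟩
    exact ht.trans (Nat.mul_le_mul_right _ hi)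
  · rintro s t ⟨i, hi, h, ht⟩ hlt
    have hi' := (hc i s hi h).1 hlt
    refine (hP i s hi' h).mono ?_
    rintro s' t' ⟨ht', h'⟩
    refine ⟨i + 1, hi', h', ?_⟩
    have : (i + 1) * (T + 1) = i * (T + 1) + (T + 1) := by ring
    omega
  · rintro s t ⟨i, hi, h, ht⟩ hlt
    have : i = N := by
      have := (hc i s hi h).not.1 hlt
      omega
    subst this
    exact hQ s _ (by omega) h

end WP


/-! ### The layered search: abstract states and their invariants -/

/-- An item `(u, i, v)`: the vertex `v` in the search from `u` that uses only the edges whose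
capacity is at least the capacity of the edge `i`. -/
abbrev Item (n m : ℕ) := Fin n × Fin m × Fin n

/-- The code of an item, its index in the arrays of the program. -/
def Item.enc {n m : ℕ} (x : Item n m) : ℕ := (x.1 * n + x.2.2) * m + x.2.1

theorem Item.enc_inj {n m : ℕ} {x y : Item n m} : x.enc = y.enc ↔ x = y := by
  constructor
  · obtain ⟨u, i, v⟩ := x
    obtain ⟨u', i', v'⟩ := y
    intro h
    simp only [Item.enc] at h
    have hi : (i : ℕ) = i' := by
      have := congrArg (· % m) h
      simpa [Nat.mul_add_mod_of_lt, Nat.mod_eq_of_lt, mul_comm _ m] using this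
    have hm : 0 < m := i.pos
    have h2 : (u : ℕ) * n + v = u' * n + v' := by
      rw [hi] at h
      exact Nat.eq_of_mul_eq_mul_right hm (Nat.add_right_cancel h)
    have hv : (v : ℕ) = v' := by
      have := congrArg (· % n) h2
      simpa [Nat.mul_add_mod_of_lt, Nat.mod_eq_of_lt, mul_comm _ n] using this
    have hu : (u : ℕ) = u' := by
      rw [hv] at h2
      exact Nat.eq_of_mul_eq_mul_right u.pos (Nat.add_right_cancel h2)
    simp [Fin.ext_iff, hi, hv, hu]
  · rintro rfl; rfl

/-- The state of the search. Labels are `0` for items not yet seen, `1` for settled items, and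
`a + 2` for live items that wait in the slot `a` of the queue; `L a` is the list of this slot. -/
structure Search (n m : ℕ) where
  dist : Item n m → ℕ
  lab : Item n m → ℕ
  par : Item n m → ℕ
  ord : List (Item n m)
  live : ℕ
  cur : ℕ
  lv : ℕ
  hi : ℕ
  R : ℕ → ℕ
  L : ℕ → List (Item n m)

namespace Search

variable {n m c : ℕ}

/-- The number of settled items of a layer. -/
def settled (S : Search n m) (u : Fin n) (i : Fin m) : ℕ :=
  (Finset.univ.filter fun v => S.lab (u, i, v) = 1).card

/-- The invariant of Dijkstra's algorithm, run simultaneously on all layers; `pend y e` says that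
the settled item `y` has not yet been used to relax the edge `e`. -/
structure DInv (G : FlowGraph n m c) (S : Search n m) (pend : Item n m → Fin m → Prop) : Prop where
  src : ∀ u i, S.lab (u, i, u) ≠ 0 ∧ S.dist (u, i, u) = 0 ∧ S.par (u, i, u) = 0
  parent : ∀ u i v, u ≠ v → S.lab (u, i, v) ≠ 0 → ∃ e, G.dst e = v ∧ G.cap i ≤ G.cap e ∧
    S.lab (u, i, G.src e) = 1 ∧ S.par (u, i, v) = Item.enc (u, i, G.src e) + 1 ∧
    S.dist (u, i, v) = S.dist (u, i, G.src e) + G.cost e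
  closed : ∀ u i e, S.lab (u, i, G.src e) = 1 → G.cap i ≤ G.cap e → ¬ pend (u, i, G.src e) e →
    S.lab (u, i, G.dst e) ≠ 0 ∧ S.dist (u, i, G.dst e) ≤ S.dist (u, i, G.src e) + G.cost e
  done_le : ∀ x, S.lab x = 1 → S.dist x ≤ S.cur
  live_ge : ∀ x, 2 ≤ S.lab x → S.cur ≤ S.dist x
  -- The next two fields bound distances by counting: each settled vertex of a layer accounts for
  -- one edge cost, at most c. The summand c in `dist_lt` is the allowance for one more edge.
  dist_le : ∀ x, S.lab x ≠ 0 → S.dist x ≤ c * S.settled x.1 x.2.1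
  dist_lt : ∀ x, S.lab x = 1 → S.dist x + c ≤ c * S.settled x.1 x.2.1
  mem_ord : ∀ x, x ∈ S.ord ↔ S.lab x = 1
  -- Distances alone do not put the parent first, because edges may cost 0.
  ord_parent : ∀ (t : ℕ) (x : Item n m), S.ord[t]? = some x → x.1 ≠ x.2.2 →
    ∃ t' < t, ∃ y : Item n m, S.ord[t']? = some y ∧ S.par x = y.enc + 1
  ord_mono : S.ord.Pairwise fun x y => S.dist x ≤ S.dist y
  nodup : S.ord.Nodup
  live_card : S.live = (Finset.univ.filter fun x => 2 ≤ S.lab x).card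

namespace DInv

variable {G : FlowGraph n m c} {S : Search n m} {pend : Item n m → Fin m → Prop}

/-- The invariant depends on the labels only through the states of the items. -/
theorem relabel (h : DInv G S pend) (T : Search n m)
    (h0 : ∀ x, T.lab x = 0 ↔ S.lab x = 0) (h1 : ∀ x, T.lab x = 1 ↔ S.lab x = 1)
    (hd : T.dist = S.dist) (hp : T.par = S.par) (ho : T.ord = S.ord) (hl : T.live = S.live)
    (hc : S.cur ≤ T.cur) (hc' : ∀ x, 2 ≤ S.lab x → T.cur ≤ S.dist x) : DInv G T pend := by
  have h2 : ∀ x, 2 ≤ T.lab x ↔ 2 ≤ S.lab x := by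
    intro x; have := h0 x; have := h1 x; omega
  have hs : T.settled = S.settled := by
    funext u i; simp [settled, h1]
  constructor
  · intro u i; have := h.src u i; rw [hd, hp, Ne, h0]; exact this
  · intro u i v huv hl
    obtain ⟨e, he⟩ := h.parent u i v huv (by rwa [Ne, ← h0])
    exact ⟨e, by rw [h1, hd, hp]; exact he⟩
  · intro u i e hl
    rw [Ne, h0, hd]; exact h.closed u i e ((h1 _).1 hl)
  · intro x hx; rw [hd]; exact (h.done_le x ((h1 _).1 hx)).trans hc
  · intro x hx; rw [hd]; exact hc' x ((h2 x).1 hx)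
  · intro x hx; rw [hd, hs]; exact h.dist_le x (by rwa [Ne, ← h0])
  · intro x hx; rw [hd, hs]; exact h.dist_lt x ((h1 _).1 hx)
  · intro x; rw [ho, h1]; exact h.mem_ord x
  · rw [ho, hp]; exact h.ord_parent
  · rw [ho, hd]; exact h.ord_mono
  · rw [ho]; exact h.nodup
  · rw [hl, h.live_card]; simp [h2]

/-- An edge may leave `pend` as soon as its inequality is known, without any change of the state;
this covers relaxations that bring no improvement. -/
theorem weaken (h : DInv G S pend) (pend' : Item n m → Fin m → Prop)
    (hp : ∀ u i e, S.lab (u, i, G.src e) = 1 → G.cap i ≤ G.cap e → ¬ pend' (u, i, G.src e) e →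
      pend (u, i, G.src e) e →
      S.lab (u, i, G.dst e) ≠ 0 ∧ S.dist (u, i, G.dst e) ≤ S.dist (u, i, G.src e) + G.cost e) :
    DInv G S pend' :=
  { h with
    closed := by
      intro u i e h1 h2 h3
      by_cases hq : pend (u, i, G.src e) e
      · exact hp u i e h1 h2 h3 hq
      · exact h.closed u i e h1 h2 hq }

/-- Settling a live item of least distance. -/
theorem settle (h : DInv G S pend) (T : Search n m) (x : Item n m) (hx : 2 ≤ S.lab x)
    (hxc : S.dist x = S.cur) (hlab : T.lab = Function.update S.lab x 1) (hd : T.dist = S.dist)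
    (hp : T.par = S.par) (ho : T.ord = S.ord ++ [x]) (hl : T.live = S.live - 1)
    (hc : T.cur = S.cur) :
    DInv G T (fun y e => y = x ∨ pend y e) := by
  have hlab' : ∀ y, T.lab y = if y = x then 1 else S.lab y := by
    intro y; rw [hlab, Function.update_apply]
  have h0 : ∀ y, T.lab y ≠ 0 ↔ S.lab y ≠ 0 := by
    intro y; rw [hlab']; split_ifs with hy
    · subst hy; simp; omega
    · rfl
  have h1 : ∀ y, S.lab y = 1 → T.lab y = 1 := by
    intro y hy; rw [hlab']; split_ifs <;> simp [hy]
  have hs : ∀ u i, S.settled u i ≤ T.settled u i := by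
    intro u i
    refine Finset.card_le_card fun v hv => ?_
    simp only [Finset.mem_filter, Finset.mem_univ, true_and] at hv ⊢
    exact h1 _ hv
  -- The item x is itself a new settled vertex of its layer; this unit pays for the summand c that
  -- `dist_lt` demands of x.
  have hsx : S.settled x.1 x.2.1 + 1 ≤ T.settled x.1 x.2.1 := by
    refine Finset.card_lt_card ⟨fun v hv => ?_, fun hsub => ?_⟩
    · simp only [Finset.mem_filter, Finset.mem_univ, true_and] at hv ⊢
      exact h1 _ hv
    · have hm : x.2.2 ∈ Finset.univ.filter fun v => S.lab (x.1, x.2.1, v) = 1 := by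
        apply hsub
        simp [hlab']
      simp only [Finset.mem_filter, Finset.mem_univ, true_and, Prod.mk.eta] at hm
      omega
  have hxs : x ∉ S.ord := by rw [h.mem_ord]; omega
  constructor
  · intro u i; rw [hd, hp, h0]; exact h.src u i
  · intro u i v huv hl
    obtain ⟨e, h1', h2', h3', h4', h5'⟩ := h.parent u i v huv ((h0 _).1 hl)
    exact ⟨e, h1', h2', h1 _ h3', by rw [hp]; exact h4', by rw [hd]; exact h5'⟩
  · intro u i e hl hce hpe
    rw [not_or] at hpe
    rw [h0, hd]
    refine h.closed u i e ?_ hce hpe.2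
    rw [hlab', if_neg hpe.1] at hl; exact hl
  · intro y hy
    rw [hd, hc]
    rw [hlab'] at hy
    split_ifs at hy with hyx
    · rw [hyx, hxc]
    · exact h.done_le y hy
  · intro y hy
    rw [hd, hc]
    rw [hlab'] at hy
    split_ifs at hy with hyx
    · omega
    · exact h.live_ge y hy
  · intro y hy
    rw [hd]
    exact (h.dist_le y ((h0 y).1 hy)).trans (Nat.mul_le_mul_left _ (hs _ _))
  · intro y hy
    rw [hd]
    rw [hlab'] at hy
    split_ifs at hy with hyx
    · subst hyx
      have := h.dist_le y (by omega)
      calc S.dist y + c ≤ c * S.settled y.1 y.2.1 + c := by omega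
        _ = c * (S.settled y.1 y.2.1 + 1) := by ring
        _ ≤ _ := Nat.mul_le_mul_left _ hsx
    · exact (h.dist_lt y hy).trans (Nat.mul_le_mul_left _ (hs _ _))
  · intro y
    rw [ho, hlab', List.mem_append, h.mem_ord, List.mem_singleton]
    split_ifs with hyx <;> simp [hyx]
  · intro t y hy hyv
    rw [ho] at hy ⊢
    rw [hp]
    rcases lt_trichotomy t S.ord.length with ht | ht | ht
    · rw [List.getElem?_append_left ht] at hy
      obtain ⟨t', ht', z, hz, hpz⟩ := h.ord_parent t y hy hyv
      exact ⟨t', ht', z, by rw [List.getElem?_append_left (by omega)]; exact hz, hpz⟩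
    · subst ht
      simp only [List.getElem?_concat_length, Option.some.injEq] at hy
      subst hy
      obtain ⟨e, he⟩ := h.parent x.1 x.2.1 x.2.2 hyv (by simpa using (by omega : S.lab x ≠ 0))
      have := (h.mem_ord _).2 he.2.2.1
      obtain ⟨t', ht', hz⟩ := List.getElem_of_mem this
      refine ⟨t', ht', _, by rw [List.getElem?_append_left ht', List.getElem?_eq_getElem ht'],
        ?_⟩
      rw [hz]; exact he.2.2.2.1
    · rw [List.getElem?_eq_none (by simp; omega)] at hy
      simp at hy
  · rw [ho, hd, List.pairwise_append]
    refine ⟨h.ord_mono, by simp, ?_⟩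
    intro a ha b hb
    rw [List.mem_singleton] at hb
    rw [hb, hxc]
    exact h.done_le a ((h.mem_ord a).1 ha)
  · rw [ho]
    refine h.nodup.append (by simp) ?_
    rw [List.disjoint_singleton, h.mem_ord]
    omega
  · have : (Finset.univ.filter fun y => 2 ≤ T.lab y)
        = (Finset.univ.filter fun y => 2 ≤ S.lab y).erase x := by
      ext y
      simp only [Finset.mem_filter, Finset.mem_univ, true_and, Finset.mem_erase, hlab']
      split_ifs with hyx <;> simp [hyx]
    rw [hl, this, Finset.card_erase_of_mem (by simpa using hx), h.live_card]

/-- Relaxing an edge that leads to a new distance. -/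
theorem relax (h : DInv G S pend) (T : Search n m) (u : Fin n) (i : Fin m) (e : Fin m) (b : ℕ)
    (hx : S.lab (u, i, G.src e) = 1) (hxc : S.dist (u, i, G.src e) = S.cur)
    (hcap : G.cap i ≤ G.cap e) (hy : S.lab (u, i, G.dst e) ≠ 1)
    (hyd : S.lab (u, i, G.dst e) ≠ 0 → S.cur + G.cost e < S.dist (u, i, G.dst e))
    (hb : 2 ≤ b) (hlab : T.lab = Function.update S.lab (u, i, G.dst e) b)
    (hd : T.dist = Function.update S.dist (u, i, G.dst e) (S.cur + G.cost e))
    (hp : T.par = Function.update S.par (u, i, G.dst e) (Item.enc (u, i, G.src e) + 1))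
    (ho : T.ord = S.ord) (hc : T.cur = S.cur)
    (hl : T.live = S.live + if S.lab (u, i, G.dst e) = 0 then 1 else 0) :
    DInv G T (fun z e' => pend z e' ∧ ¬ (z = (u, i, G.src e) ∧ e' = e)) := by
  set y : Item n m := (u, i, G.dst e) with hydef
  set x : Item n m := (u, i, G.src e) with hxdef
  have hlab' : ∀ z, T.lab z = if z = y then b else S.lab z := by
    intro z; rw [hlab, Function.update_apply]
  have hd' : ∀ z, T.dist z = if z = y then S.cur + G.cost e else S.dist z := by
    intro z; rw [hd, Function.update_apply]
  have hp' : ∀ z, T.par z = if z = y then x.enc + 1 else S.par z := by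
    intro z; rw [hp, Function.update_apply]
  have h1 : ∀ z, T.lab z = 1 ↔ S.lab z = 1 := by
    intro z; rw [hlab']; split_ifs with hz
    · subst hz; omega
    · rfl
  have hne : ∀ z, S.lab z = 1 → z ≠ y := by
    rintro z hz rfl; exact hy hz
  have h0 : ∀ z, S.lab z ≠ 0 → T.lab z ≠ 0 := by
    intro z hz; rw [hlab']; split_ifs <;> omega
  have hs : T.settled = S.settled := by
    funext u i; simp [settled, h1]
  have hdle : ∀ z, S.lab z ≠ 0 → T.dist z ≤ S.dist z := by
    intro z hz; rw [hd']; split_ifs with hzy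
    · subst hzy; exact (hyd hz).le
    · rfl
  constructor
  · intro u' i'
    have := h.src u' i'
    -- A source has distance 0 and cannot be improved.
    have hne' : ((u', i', u') : Item n m) ≠ y := by
      intro hh; rw [hh] at this; have := hyd this.1; omega
    rw [hlab', hd', hp', if_neg hne', if_neg hne', if_neg hne']; exact this
  · intro u' i' v huv hl
    by_cases hz : ((u', i', v) : Item n m) = y
    · rw [hz, hd', hp', if_pos rfl, if_pos rfl]
      simp only [hydef, Prod.mk.injEq] at hz
      obtain ⟨rfl, rfl, rfl⟩ := hz
      refine ⟨e, rfl, hcap, (h1 _).2 hx, rfl, ?_⟩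
      rw [hd', if_neg (hne _ hx)]
      show _ = S.dist x + _
      rw [hxc]
    · rw [hlab', if_neg hz] at hl
      obtain ⟨e', g1, g2, g3, g4, g5⟩ := h.parent u' i' v huv hl
      refine ⟨e', g1, g2, (h1 _).2 g3, ?_, ?_⟩
      · rw [hp', if_neg hz, g4]
      · rw [hd', hd', if_neg hz, if_neg (hne _ g3), g5]
  · intro u' i' e' hl hce hpe
    rw [h1] at hl
    have hlt : T.dist (u', i', G.src e') = S.dist (u', i', G.src e') := by
      rw [hd', if_neg (hne _ hl)]
    rw [hlt]
    by_cases hz : ((u', i', G.src e') : Item n m) = x ∧ e' = e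
    · obtain ⟨hz, rfl⟩ := hz
      simp only [hxdef, Prod.mk.injEq] at hz
      obtain ⟨rfl, rfl, -⟩ := hz
      rw [hlab', hd', if_pos rfl, if_pos rfl]
      refine ⟨by omega, ?_⟩
      show _ ≤ S.dist x + _
      rw [hxc]
    · have hpe' : ¬ pend (u', i', G.src e') e' := fun hh => hpe ⟨hh, hz⟩
      obtain ⟨g1, g2⟩ := h.closed u' i' e' hl hce hpe'
      exact ⟨h0 _ g1, (hdle _ g1).trans g2⟩
  · intro z hz
    rw [h1] at hz
    rw [hd', if_neg (hne _ hz), hc]; exact h.done_le z hz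
  · intro z hz
    rw [hc, hd']
    split_ifs with hzy
    · omega
    · rw [hlab', if_neg hzy] at hz; exact h.live_ge z hz
  · intro z hz
    rw [hs, hd']
    split_ifs with hzy
    · subst hzy
      -- The settled tail leaves room for c in the bound of its layer, and the edge costs at most c.
      have := h.dist_lt x hx
      have hce := G.cost_le e
      show S.cur + G.cost e ≤ c * S.settled u i
      have hh : S.dist x + c ≤ c * S.settled u i := this
      omega
    · rw [hlab', if_neg hzy] at hz; exact h.dist_le z hz
  · intro z hz
    rw [h1] at hz
    rw [hs, hd', if_neg (hne _ hz)]; exact h.dist_lt z hz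
  · intro z; rw [ho, h1]; exact h.mem_ord z
  · intro t z hz hzv
    rw [ho] at hz ⊢
    have hz1 : S.lab z = 1 := (h.mem_ord z).1 (List.mem_of_getElem? hz)
    rw [hp', if_neg (hne _ hz1)]
    exact h.ord_parent t z hz hzv
  · rw [ho]
    refine h.ord_mono.imp_of_mem ?_
    intro a b' ha hb' hab
    rw [hd', hd', if_neg (hne _ ((h.mem_ord _).1 ha)), if_neg (hne _ ((h.mem_ord _).1 hb'))]
    exact hab
  · rw [ho]; exact h.nodup
  · rw [hl, h.live_card]
    split_ifs with hy0
    · have : (Finset.univ.filter fun z => 2 ≤ T.lab z)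
          = insert y (Finset.univ.filter fun z => 2 ≤ S.lab z) := by
        ext z
        simp only [Finset.mem_filter, Finset.mem_univ, true_and, Finset.mem_insert, hlab']
        split_ifs with hzy <;> simp [hzy, hb]
      rw [this, Finset.card_insert_of_notMem (by simp; omega)]
    · rw [Nat.add_zero]
      refine congrArg Finset.card (Finset.ext fun z => ?_)
      simp only [Finset.mem_filter, Finset.mem_univ, true_and, hlab']
      split_ifs with hzy
      · subst hzy; constructor <;> intro <;> omega
      · rfl

end DInv

end Search


/-! ### The queue: dyadic intervals around the current distance -/

namespace Search

variable {n m c : ℕ}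

/-- The least key of the slot `a`. -/
def lo (S : Search n m) (k a : ℕ) : ℕ :=
  if a = 0 then S.cur else if a ≤ k then S.R (a - 1) else (a - k - 1) * 2 ^ k

/-- The bound on the keys of the slot `a`. -/
def up (S : Search n m) (k a : ℕ) : ℕ :=
  if a = 0 then S.R S.lv else if a ≤ k then S.R a else (a - k) * 2 ^ k

/-- The invariant of the queue. The slot `0` holds the current dyadic interval, of level `lv`;
the slots `lv + 1, …, k` hold what is left of the larger dyadic intervals around it, up to
the current interval of length `2 ^ k`, the one with the number `hi`; the slot `k + 1 + h` holds
the interval of length `2 ^ k` with the number `h`. The items in `rem` are about to be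
distributed over the two halves of an interval of level `lv + 1`. -/
structure QInv (S : Search n m) (k : ℕ) (rem : List (Item n m)) : Prop where
  lv_le : S.lv ≤ k
  top : S.R k = (S.hi + 1) * 2 ^ k
  -- R j is the right end of the enclosing dyadic interval of level j. Either that interval is a
  -- right half, and nothing of the next larger one is left, or the right half of length 2 ^ j is
  -- still to come and is the slot j + 1.
  step : ∀ j, S.lv ≤ j → j < k →
    S.R (j + 1) = S.R j ∧ S.L (j + 1) = [] ∨ S.R (j + 1) = S.R j + 2 ^ j
  cur_lt : S.cur < S.R S.lv
  -- After going up from a finished interval, cur is no longer known to be the left end. Slot 0 is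
  -- then empty, so such an interval is never split.
  node : S.R S.lv = S.cur + 2 ^ S.lv ∨
    S.L 0 = [] ∧ rem = [] ∧ 1 ≤ S.lv ∧ S.R S.lv ≤ S.cur + 2 ^ S.lv
  cur_ge : S.hi * 2 ^ k ≤ S.cur
  -- Superseded entries stay in the lists. Among the entries of a live item one is valid, and the
  -- label bounds its slot from above. For slot 0 at a positive level the label has to be at least
  -- lv + 3, so that a later split does not take the item for one already moved.
  entry : ∀ x, 2 ≤ S.lab x →
    x ∈ rem ∧ S.lv + 4 ≤ S.lab x ∨
    ∃ a, x ∈ S.L a ∧ a + 2 ≤ S.lab x ∧ (a = 0 → 1 ≤ S.lv → S.lv + 3 ≤ S.lab x) ∧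
      S.lo k a ≤ S.dist x ∧ S.dist x < S.up k a
  -- Superseded entries need only the upper bound: once the slot becomes current, live keys are at
  -- least cur anyway.
  mem : ∀ a, ∀ x ∈ S.L a, S.lab x ≠ 0 ∧ (2 ≤ S.lab x → S.dist x < S.up k a)
  mem_rem : ∀ x ∈ rem, S.lv < k ∧ S.lab x ≠ 0 ∧ (2 ≤ S.lab x → S.dist x < S.R (S.lv + 1))
  empty : ∀ a, 1 ≤ a → a ≤ S.lv → S.L a = []
  empty_top : ∀ a, k + 1 ≤ a → a ≤ k + 1 + S.hi → S.L a = []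

namespace QInv

variable {S : Search n m} {k : ℕ} {rem : List (Item n m)}

theorem R_mono (h : QInv S k rem) {i j : ℕ} (hi : S.lv ≤ i) (hij : i ≤ j) (hj : j ≤ k) :
    S.R i ≤ S.R j := by
  induction j, hij using Nat.le_induction with
  | base => rfl
  | succ j hj' ih =>
    have := ih (by omega)
    rcases h.step j (by omega) (by omega) with h' | h'
    · rw [h'.1]; exact this
    · rw [h']; exact this.trans (Nat.le_add_right _ _)

/-- All keys of the slot `0` precede those of the other slots. -/
theorem R_lv_le_lo (h : QInv S k rem) {a : ℕ} (ha : S.lv < a) (ha' : a ≤ k ∨ k + 1 + S.hi < a) :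
    S.R S.lv ≤ S.lo k a := by
  unfold lo
  rw [if_neg (by omega)]
  split_ifs with hk
  · exact h.R_mono le_rfl (by omega) (by omega)
  · refine (h.R_mono le_rfl h.lv_le le_rfl).trans ?_
    rw [h.top]
    exact Nat.mul_le_mul_right _ (by omega)

/-- The right ends R grow with the level, and the buckets ahead start at R k or later. Consequently
a decreased key never needs a higher slot. -/
theorem up_le_lo (h : QInv S k rem) {a b : ℕ} (ha : a = 0 ∨ S.lv < a) (hab : a < b)
    (hlv : S.lv < b) (hb : b ≤ k ∨ k + 1 + S.hi < b) : S.up k a ≤ S.lo k b := by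
  rcases ha with rfl | ha
  · exact h.R_lv_le_lo hlv hb
  have ha0 : a ≠ 0 := by omega
  have hb0 : b ≠ 0 := by omega
  simp only [up, lo, ha0, hb0, if_false]
  split_ifs with h1 h2 h2
  · exact h.R_mono (by omega) (by omega) (by omega)
  · refine (h.R_mono (by omega) h1 le_rfl).trans ?_
    rw [h.top]
    exact Nat.mul_le_mul_right _ (by omega)
  · omega
  · exact Nat.mul_le_mul_right _ (by omega)

theorem slot_of_mem (h : QInv S k rem) {a : ℕ} {x : Item n m} (hx : x ∈ S.L a) :
    a = 0 ∨ S.lv < a ∧ (a ≤ k ∨ k + 1 + S.hi < a) := by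
  by_contra hc
  have : S.L a = [] := by
    rcases Nat.lt_or_ge S.lv a with h1 | h1
    · exact h.empty_top a (by omega) (by omega)
    · exact h.empty a (by omega) h1
  rw [this] at hx
  simp at hx

/-- Going up from a finished interval to the next larger one. -/
theorem goUp (h : QInv S k []) (h0 : S.L 0 = []) (hlv : S.lv < k)
    (hR : S.R (S.lv + 1) ≤ S.R S.lv) : QInv { S with lv := S.lv + 1 } k [] := by
  have hs := h.step S.lv le_rfl hlv
  have hp : 0 < 2 ^ S.lv := by positivity
  have hR' : S.R (S.lv + 1) = S.R S.lv ∧ S.L (S.lv + 1) = [] := by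
    rcases hs with hs | hs
    · exact hs
    · omega
  have hup : ∀ a, ({ S with lv := S.lv + 1 } : Search n m).up k a = S.up k a := by
    intro a; unfold up; split_ifs <;> simp [hR'.1]
  constructor
  · exact hlv
  · exact h.top
  · intro j hj; exact h.step j (by simp at hj; omega)
  · show S.cur < S.R (S.lv + 1)
    rw [hR'.1]; exact h.cur_lt
  -- The larger interval began before cur, so only the inequality survives.
  · right
    refine ⟨h0, rfl, by simp, ?_⟩
    show S.R (S.lv + 1) ≤ S.cur + 2 ^ (S.lv + 1)
    rw [hR'.1, pow_succ]
    rcases h.node with hn | hn <;> omega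
  · exact h.cur_ge
  · intro x hx
    rcases h.entry x hx with hh | ⟨a, ha, h1, h2, h3⟩
    · simp at hh
    · refine Or.inr ⟨a, ha, h1, ?_, ?_⟩
      · rintro rfl; rw [h0] at ha; simp at ha
      · rw [hup]; exact h3
  · intro a x hx; rw [hup]; exact h.mem a x hx
  · simp
  · intro a h1 h2
    rcases Nat.lt_or_ge S.lv a with h3 | h3
    · have : a = S.lv + 1 := by simp at h2; omega
      rw [this]; exact hR'.2
    · exact h.empty a h1 h3
  · exact h.empty_top

/-- Continuing with the other half of the surrounding interval. -/
theorem advance (h : QInv S k []) (h0 : S.L 0 = []) (hlv : S.lv < k)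
    (hR : S.R S.lv < S.R (S.lv + 1)) :
    QInv { S with
      cur := S.R S.lv
      R := Function.update S.R S.lv (S.R (S.lv + 1))
      L := Function.update (Function.update S.L 0 (S.L (S.lv + 1))) (S.lv + 1) [] } k [] := by
  have hR' : S.R (S.lv + 1) = S.R S.lv + 2 ^ S.lv := by
    rcases h.step S.lv le_rfl hlv with hs | hs
    · omega
    · exact hs
  constructor
  · exact h.lv_le
  · show Function.update S.R S.lv _ k = _
    rw [Function.update_of_ne (by omega)]; exact h.top
  · intro j hj hjk
    simp only at hj ⊢
    rcases Nat.lt_or_ge S.lv j with h1 | h1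
    · rw [Function.update_of_ne (by omega), Function.update_of_ne (by omega),
        Function.update_of_ne (by omega), Function.update_of_ne (by omega)]
      exact h.step j hj hjk
    -- The current interval is now the right half: the two right ends coincide, and the slot lv + 1
    -- has been emptied.
    · have : j = S.lv := by omega
      subst this
      left
      simp
  · simpa using hR
  · left; simp [hR']
  · exact h.cur_ge.trans h.cur_lt.le
  · intro x hx
    right
    rcases h.entry x hx with hh | ⟨a, ha, h1, h2, h3, h4⟩
    · simp at hh
    by_cases ha' : a = S.lv + 1
    · subst ha'
      refine ⟨0, by simpa using ha, by simp at hx ⊢; omega, fun _ _ => by simp; omega, ?_, ?_⟩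
      · simpa [lo, hlv] using h3
      · simpa [up, hlv] using h4
    · have hs := h.slot_of_mem ha
      have ha0 : a ≠ 0 := by rintro rfl; rw [h0] at ha; simp at ha
      refine ⟨a, by simpa [ha', ha0] using ha, h1, fun h => absurd h ha0, ?_, ?_⟩
      · simp only [lo, ha0, if_false] at h3 ⊢
        rw [Function.update_of_ne (by omega)]; exact h3
      · simp only [up, ha0, if_false] at h4 ⊢
        rw [Function.update_of_ne (by omega)]; exact h4
  · intro a x hx
    simp only at hx ⊢
    by_cases ha' : a = S.lv + 1
    · subst ha'; simp at hx
    · rw [Function.update_of_ne ha'] at hx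
      by_cases ha0 : a = 0
      · subst ha0
        rw [Function.update_self] at hx
        have := h.mem _ x hx
        simpa [up, hlv] using this
      · rw [Function.update_of_ne ha0] at hx
        have hs := h.slot_of_mem hx
        have := h.mem _ x hx
        simp only [up, ha0, if_false] at this ⊢
        rw [Function.update_of_ne (by omega)]; exact this
  · simp
  · intro a h1 h2
    simp only at h2 ⊢
    rw [Function.update_of_ne (by omega), Function.update_of_ne (by omega)]
    exact h.empty a h1 h2
  · intro a h1 h2
    simp only at h2 ⊢
    rw [Function.update_of_ne (by omega), Function.update_of_ne (by omega)]
    exact h.empty_top a h1 h2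

/-- Continuing with the next interval of length `2 ^ k`. -/
theorem next (h : QInv S k []) (h0 : S.L 0 = []) (hlv : S.lv = k) :
    QInv { S with
      hi := S.hi + 1
      cur := S.R k
      R := Function.update S.R k (S.R k + 2 ^ k)
      L := Function.update (Function.update S.L 0 (S.L (k + 1 + (S.hi + 1))))
        (k + 1 + (S.hi + 1)) [] } k [] := by
  have hp : 0 < 2 ^ k := by positivity
  constructor
  · exact h.lv_le
  · simp only [Function.update_self]; rw [h.top]; ring
  · intro j hj hjk; simp only at hj; omega
  · simp [hlv]
  · left; simp [hlv]
  · show (S.hi + 1) * 2 ^ k ≤ S.R k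
    rw [h.top]
  · intro x hx
    right
    rcases h.entry x hx with hh | ⟨a, ha, h1, h2, h3, h4⟩
    · simp at hh
    by_cases ha' : a = k + 1 + (S.hi + 1)
    · subst ha'
      refine ⟨0, by simpa using ha, by simp at hx ⊢; omega, fun _ _ => by simp; omega, ?_, ?_⟩
      · simp only [lo, if_true, h.top] at h3 ⊢
        rw [if_neg (by omega), if_neg (by omega)] at h3
        convert h3 using 2; omega
      · simp only [up, if_true, hlv, Function.update_self, h.top] at h4 ⊢
        rw [if_neg (by omega), if_neg (by omega)] at h4
        refine h4.trans_le ?_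
        rw [show k + 1 + (S.hi + 1) - k = S.hi + 1 + 1 by omega, Nat.add_mul (S.hi + 1)]
        omega
    · have hs := h.slot_of_mem ha
      have ha0 : a ≠ 0 := by rintro rfl; rw [h0] at ha; simp at ha
      have hak : ¬ a ≤ k := by omega
      refine ⟨a, by simpa [ha', ha0] using ha, h1, fun h => absurd h ha0, ?_, ?_⟩
      · simpa only [lo, ha0, hak, if_false] using h3
      · simpa only [up, ha0, hak, if_false] using h4
  · intro a x hx
    simp only at hx ⊢
    by_cases ha' : a = k + 1 + (S.hi + 1)
    · subst ha'; simp at hx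
    · rw [Function.update_of_ne ha'] at hx
      by_cases ha0 : a = 0
      · subst ha0
        rw [Function.update_self] at hx
        have := h.mem _ x hx
        simp only [up, if_true, hlv, Function.update_self, h.top] at this ⊢
        rw [if_neg (by omega), if_neg (by omega)] at this
        refine ⟨this.1, fun h2 => (this.2 h2).trans_le ?_⟩
        rw [show k + 1 + (S.hi + 1) - k = S.hi + 1 + 1 by omega, Nat.add_mul (S.hi + 1)]
        omega
      · rw [Function.update_of_ne ha0] at hx
        have hs := h.slot_of_mem hx
        have hak : ¬ a ≤ k := by omega
        have := h.mem _ x hx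
        simpa only [up, ha0, hak, if_false] using this
  · simp
  · intro a h1 h2
    simp only at h2 ⊢
    rw [Function.update_of_ne (by omega), Function.update_of_ne (by omega)]
    exact h.empty a h1 h2
  · intro a h1 h2
    simp only at h2 ⊢
    by_cases ha' : a = k + 1 + (S.hi + 1)
    · rw [ha', Function.update_self]
    · rw [Function.update_of_ne (by omega), Function.update_of_ne (by omega)]
      exact h.empty_top a h1 (by omega)

/-- Beginning to split the current interval. -/
theorem splitStart (h : QInv S k []) (h0 : S.L 0 ≠ []) {l : ℕ} (hlv : S.lv = l + 1) :
    QInv { S with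
      lv := l
      R := Function.update S.R l (S.cur + 2 ^ l)
      L := Function.update S.L 0 [] } k (S.L 0) := by
  have hp : 0 < 2 ^ l := by positivity
  have hk := h.lv_le
  -- As slot 0 is nonempty, cur is the left end, and the midpoint is cur + 2 ^ l.
  have hn : S.R (l + 1) = S.cur + 2 ^ l + 2 ^ l := by
    rcases h.node with hn | hn
    · rw [hlv, pow_succ] at hn; omega
    · exact absurd hn.1 h0
  constructor
  · simp only; omega
  · simp only; rw [Function.update_of_ne (by omega)]; exact h.top
  · intro j hj hjk
    simp only at hj ⊢
    by_cases hjl : j = l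
    · subst hjl
      right
      simp [hn]
    · rw [Function.update_of_ne (by omega), Function.update_of_ne hjl,
        Function.update_of_ne (by omega)]
      exact h.step j (by omega) hjk
  · simp
  · left; simp
  · exact h.cur_ge
  · intro x hx
    rcases h.entry x hx with hh | ⟨a, ha, h1, h2, h3, h4⟩
    · simp at hh
    by_cases ha0 : a = 0
    · subst ha0
      left
      have := h2 rfl (by omega)
      exact ⟨ha, by simp; omega⟩
    · have hs := h.slot_of_mem ha
      refine Or.inr ⟨a, by simpa [ha0] using ha, h1, fun h => absurd h ha0, ?_, ?_⟩
      · simp only [lo, ha0, if_false] at h3 ⊢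
        rw [Function.update_of_ne (by omega)]; exact h3
      · simp only [up, ha0, if_false] at h4 ⊢
        rw [Function.update_of_ne (by omega)]; exact h4
  · intro a x hx
    simp only at hx ⊢
    by_cases ha0 : a = 0
    · subst ha0; simp at hx
    · rw [Function.update_of_ne ha0] at hx
      have hs := h.slot_of_mem hx
      have := h.mem _ x hx
      simp only [up, ha0, if_false] at this ⊢
      rw [Function.update_of_ne (by omega)]; exact this
  · intro x hx
    have := h.mem 0 x hx
    simp only [up, if_true, hlv] at this ⊢
    rw [Function.update_of_ne (by omega)]
    exact ⟨by omega, this⟩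
  · intro a h1 h2
    simp only at h2 ⊢
    rw [Function.update_of_ne (by omega)]
    exact h.empty a h1 (by omega)
  · intro a h1 h2
    simp only
    rw [Function.update_of_ne (by omega)]
    exact h.empty_top a h1 h2

/-- Dropping an item that is settled or has already been moved. -/
theorem splitDrop {x : Item n m} (h : QInv S k (x :: rem)) (hx : S.lab x ≤ S.lv + 3) :
    QInv S k rem :=
  { h with
    node := by
      rcases h.node with hn | hn
      · exact Or.inl hn
      · simp at hn
    entry := by
      intro y hy
      rcases h.entry y hy with ⟨h1, h2⟩ | h1
      · rcases List.mem_cons.1 h1 with rfl | h1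
        · omega
        · exact Or.inl ⟨h1, h2⟩
      · exact Or.inr h1
    mem_rem := fun y hy => h.mem_rem y (List.mem_cons_of_mem _ hy) }

/-- Moving an item to the half of the interval it belongs to. -/
theorem splitMove {x : Item n m} {a : ℕ} (h : QInv S k (x :: rem)) (hx : S.lv + 3 < S.lab x)
    (hc : S.cur ≤ S.dist x)
    (ha : S.dist x < S.R S.lv ∧ a = 0 ∨ S.R S.lv ≤ S.dist x ∧ a = S.lv + 1) :
    QInv { S with
      lab := Function.update S.lab x (S.lv + 3)
      L := Function.update S.L a (x :: S.L a) } k rem := by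
  obtain ⟨g1, g2, g3⟩ := h.mem_rem x (by simp)
  have g3 := g3 (by omega)
  have hnode : S.R S.lv = S.cur + 2 ^ S.lv := by
    rcases h.node with hn | hn
    · exact hn
    · simp at hn
  have hlo : S.lo k a ≤ S.dist x ∧ S.dist x < S.up k a := by
    rcases ha with ⟨h1, rfl⟩ | ⟨h1, rfl⟩
    · simp [lo, up, h1, hc]
    · simp [lo, up, h1, g3, Nat.succ_le_of_lt g1]
  constructor
  · exact h.lv_le
  · exact h.top
  · intro j hj hjk
    simp only at hj ⊢
    rcases h.step j hj hjk with hs | hs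
    · left
      refine ⟨hs.1, ?_⟩
      rw [Function.update_of_ne]
      · exact hs.2
      · rcases ha with ⟨-, rfl⟩ | ⟨h1, rfl⟩
        · omega
        -- A key between R lv and R (lv + 1) excludes the degenerate alternative, in which these
        -- ends coincide.
        · intro hjj
          have : j = S.lv := by omega
          subst this
          omega
    · exact Or.inr hs
  · exact h.cur_lt
  · exact Or.inl hnode
  · exact h.cur_ge
  · intro y hy
    simp only at hy ⊢
    by_cases hyx : y = x
    · subst hyx
      refine Or.inr ⟨a, by simp, ?_, by simp, hlo⟩
      rw [Function.update_self]; omega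
    · rw [Function.update_of_ne hyx] at hy ⊢
      rcases h.entry y hy with ⟨h1, h2⟩ | ⟨b, h1, h2⟩
      · rcases List.mem_cons.1 h1 with h1 | h1
        · exact absurd h1 hyx
        · exact Or.inl ⟨h1, h2⟩
      · refine Or.inr ⟨b, ?_, h2⟩
        by_cases hb : b = a
        · subst hb; simp [h1]
        · rw [Function.update_of_ne hb]; exact h1
  · intro b y hy
    simp only at hy ⊢
    have hyb : y ∈ S.L b ∨ y = x ∧ b = a := by
      by_cases hb : b = a
      · subst hb
        rw [Function.update_self, List.mem_cons] at hy
        tauto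
      · rw [Function.update_of_ne hb] at hy; exact Or.inl hy
    by_cases hyx : y = x
    · subst hyx
      refine ⟨by simp, fun _ => ?_⟩
      rcases hyb with hyb | ⟨-, rfl⟩
      · exact (h.mem b y hyb).2 (by omega)
      · exact hlo.2
    · rw [Function.update_of_ne hyx]
      exact h.mem b y (by tauto)
  · intro y hy
    simp only
    obtain ⟨q1, q2, q3⟩ := h.mem_rem y (List.mem_cons_of_mem _ hy)
    by_cases hyx : y = x
    · subst hyx
      exact ⟨q1, by simp, fun _ => g3⟩
    · rw [Function.update_of_ne hyx]; exact ⟨q1, q2, q3⟩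
  · intro b h1 h2
    simp only at h2 ⊢
    rw [Function.update_of_ne (by omega)]
    exact h.empty b h1 h2
  · intro b h1 h2
    simp only
    rw [Function.update_of_ne (by omega)]
    exact h.empty_top b h1 h2

/-- Removing a settled item from the current slot. -/
theorem popDone (h : QInv S k []) (hlv : S.lv = 0) {x : Item n m} {r : List (Item n m)}
    (h0 : S.L 0 = x :: r) (T : Search n m) (hL : T.L = Function.update S.L 0 r)
    (hlab : T.lab x = 1) (hlab' : ∀ y, y ≠ x → T.lab y = S.lab y) (hd : T.dist = S.dist)
    (hR : T.R = S.R) (hc : T.cur = S.cur) (hl : T.lv = S.lv) (hhi : T.hi = S.hi) :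
    QInv T k [] := by
  have hlo : T.lo = S.lo := by funext k a; simp [lo, hR, hc]
  have hup : T.up = S.up := by funext k a; simp [up, hR, hl]
  have hm : ∀ a, ∀ y, y ∈ T.L a → y ∈ S.L a := by
    intro a y hy
    rw [hL] at hy
    by_cases ha : a = 0
    · subst ha; rw [Function.update_self] at hy; rw [h0]; exact List.mem_cons_of_mem _ hy
    · rw [Function.update_of_ne ha] at hy; exact hy
  have he : ∀ a, S.L a = [] → T.L a = [] := by
    intro a ha
    rw [hL]
    rw [Function.update_of_ne]
    · exact ha
    · rintro rfl; rw [h0] at ha; simp at ha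
  constructor
  · rw [hl]; exact h.lv_le
  · rw [hR, hhi]; exact h.top
  · intro j; rw [hl, hR]; intro hj hjk
    exact (h.step j hj hjk).imp (fun h => ⟨h.1, he _ h.2⟩) id
  · rw [hc, hR, hl]; exact h.cur_lt
  · rw [hR, hl, hc]
    rcases h.node with hn | hn
    · exact Or.inl hn
    · omega
  · rw [hhi, hc]; exact h.cur_ge
  · intro y hy
    have hyx : y ≠ x := by rintro rfl; omega
    rw [hlab' y hyx] at hy ⊢
    rw [hl, hlo, hup, hd]
    rcases h.entry y hy with hh | ⟨a, ha, h1⟩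
    · exact Or.inl hh
    · refine Or.inr ⟨a, ?_, h1⟩
      rw [hL]
      by_cases ha0 : a = 0
      · subst ha0
        rw [h0] at ha
        rw [Function.update_self]
        exact (List.mem_cons.1 ha).resolve_left hyx
      · rw [Function.update_of_ne ha0]; exact ha
  · intro a y hy
    rw [hup, hd]
    by_cases hyx : y = x
    · subst hyx; omega
    · rw [hlab' y hyx]; exact h.mem a y (hm a y hy)
  · simp
  · rw [hl]; intro a h1 h2; exact he a (h.empty a h1 h2)
  · rw [hhi]; intro a h1 h2; exact he a (h.empty_top a h1 h2)

/-- Giving a live or new item `y` a smaller distance `d` that belongs to the slot `a`. -/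
theorem decrease (h : QInv S k []) (hlv : S.lv = 0) {y : Item n m} {a d : ℕ}
    (hy : S.lab y ≠ 1) (hyd : S.lab y ≠ 0 → d < S.dist y) (hd : S.lo k a ≤ d ∧ d < S.up k a)
    (ha : a ≤ k ∨ k + 1 + S.hi < a) (T : Search n m)
    (hT : (S.lab y = 0 ∨ a + 2 < S.lab y) ∧ T.lab = Function.update S.lab y (a + 2) ∧
        T.L = Function.update S.L a (y :: S.L a) ∨
      (S.lab y ≠ 0 ∧ S.lab y ≤ a + 2) ∧ T.lab = S.lab ∧ T.L = S.L)
    (hdist : T.dist = Function.update S.dist y d)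
    (hR : T.R = S.R) (hc : T.cur = S.cur) (hl : T.lv = S.lv) (hhi : T.hi = S.hi) :
    QInv T k [] := by
  have hlo : T.lo = S.lo := by funext k a; simp [lo, hR, hc]
  have hup : T.up = S.up := by funext k a; simp [up, hR, hl]
  have hlab : ∀ z, z ≠ y → T.lab z = S.lab z := by
    intro z hz
    rcases hT with hT | hT
    · rw [hT.2.1, Function.update_of_ne hz]
    · rw [hT.2.1]
  have hdz : ∀ z, z ≠ y → T.dist z = S.dist z := fun z hz => by
    rw [hdist, Function.update_of_ne hz]
  have hdy : T.dist y = d := by rw [hdist, Function.update_self]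
  have hm : ∀ b, ∀ z, z ∈ T.L b → z ∈ S.L b ∨ z = y ∧ b = a := by
    intro b z hz
    rcases hT with hT | hT
    · rw [hT.2.2] at hz
      by_cases hb : b = a
      · subst hb
        rw [Function.update_self, List.mem_cons] at hz
        tauto
      · rw [Function.update_of_ne hb] at hz; exact Or.inl hz
    · rw [hT.2.2] at hz; exact Or.inl hz
  have hm' : ∀ b, ∀ z, z ∈ S.L b → z ∈ T.L b := by
    intro b z hz
    rcases hT with hT | hT
    · rw [hT.2.2]
      by_cases hb : b = a
      · subst hb; simp [hz]
      · rw [Function.update_of_ne hb]; exact hz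
    · rw [hT.2.2]; exact hz
  have he : ∀ b, b ≠ a → S.L b = [] → T.L b = [] := by
    intro b hb hb'
    rcases hT with hT | hT
    · rw [hT.2.2, Function.update_of_ne hb]; exact hb'
    · rw [hT.2.2]; exact hb'
  constructor
  · rw [hl]; exact h.lv_le
  · rw [hR, hhi]; exact h.top
  · intro j; rw [hl, hR]; intro hj hjk
    rcases h.step j hj hjk with hs | hs
    · refine Or.inl ⟨hs.1, he _ ?_ hs.2⟩
      -- A slot with coinciding ends contains no key, in particular not d.
      rintro rfl
      simp only [lo, up, Nat.add_eq_zero_iff, one_ne_zero, and_false, if_false] at hd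
      rw [if_pos (by omega), if_pos (by omega), hs.1] at hd
      simp at hd
      omega
    · exact Or.inr hs
  · rw [hc, hR, hl]; exact h.cur_lt
  · rw [hR, hl, hc]
    rcases h.node with hn | hn
    · exact Or.inl hn
    · omega
  · rw [hhi, hc]; exact h.cur_ge
  · intro z hz
    rw [hl, hlo, hup]
    right
    by_cases hzy : z = y
    · subst hzy
      rw [hdy]
      rcases hT with hT | hT
      · refine ⟨a, ?_, ?_, ?_, hd⟩
        · rw [hT.2.2]; simp
        · rw [hT.2.1]; simp
        · omega
      · rw [hT.2.1] at hz ⊢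
        rcases h.entry z hz with hh | ⟨b, hb, h1, h2, h3, h4⟩
        · simp at hh
        -- The valid entry sits in a slot b with b + 2 ≤ lab ≤ a + 2. As the key has decreased and
        -- the slots are ordered, also a ≤ b; so the old entry is already in the right slot and no
        -- push is needed.
        have hab : a ≤ b := by
          by_contra hlt
          have hs := h.slot_of_mem hb
          have := h.up_le_lo (a := b) (b := a) (by omega) (by omega) (by omega) ha
          have := hyd (by omega)
          omega
        have : a = b := by omega
        subst this
        exact ⟨a, hm' _ _ hb, h1, h2, hd⟩
    · rw [hlab z hzy] at hz ⊢
      rw [hdz z hzy]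
      rcases h.entry z hz with hh | ⟨b, hb, h1⟩
      · simp at hh
      · exact ⟨b, hm' _ _ hb, h1⟩
  · intro b z hz
    rw [hup]
    by_cases hzy : z = y
    · subst hzy
      rw [hdy]
      refine ⟨?_, fun _ => ?_⟩
      · rcases hT with hT | hT
        · rw [hT.2.1]; simp
        · rw [hT.2.1]; exact hT.1.1
      · rcases hm b z hz with hzb | ⟨-, rfl⟩
        · have := h.mem b z hzb
          exact (hyd this.1).trans (this.2 (by omega))
        · exact hd.2
    · rw [hlab z hzy, hdz z hzy]
      exact h.mem b z ((hm b z hz).resolve_right fun hh => hzy hh.1)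
  · simp
  · rw [hl]; intro b h1 h2; omega
  · rw [hhi]; intro b h1 h2; exact he b (by omega) (h.empty_top b h1 h2)

end QInv

end Search


/-! ### The program for the layered search -/

notation "rN" => (0 : ℕ)
notation "rM" => (1 : ℕ)
notation "rC" => (2 : ℕ)
notation "rZ" => (3 : ℕ)
notation "rOne" => (4 : ℕ)
notation "rTwo" => (5 : ℕ)
notation "rW" => (6 : ℕ)
notation "rK" => (7 : ℕ)
notation "rLive" => (8 : ℕ)
notation "rHi" => (9 : ℕ)
notation "rLv" => (10 : ℕ)
notation "rCur" => (11 : ℕ)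
notation "rCnt" => (12 : ℕ)
notation "rOc" => (13 : ℕ)
notation "rX" => (14 : ℕ)
notation "rD" => (15 : ℕ)
notation "rV" => (16 : ℕ)
notation "rI" => (17 : ℕ)
notation "rE" => (18 : ℕ)
notation "rVm" => (19 : ℕ)
notation "rPX" => (20 : ℕ)
notation "rPA" => (21 : ℕ)
notation "rT" => (22 : ℕ)
notation "rB" => (23 : ℕ)
notation "rDD" => (24 : ℕ)
notation "rWv" => (25 : ℕ)
notation "rLy" => (26 : ℕ)
notation "rS1" => (27 : ℕ)
notation "rS2" => (28 : ℕ)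
notation "rS3" => (29 : ℕ)
notation "rH" => (30 : ℕ)
notation "aSrc" => (0 : ℕ)
notation "aDst" => (1 : ℕ)
notation "aCost" => (2 : ℕ)
notation "aLen" => (3 : ℕ)
notation "aBeg" => (4 : ℕ)
notation "aOutD" => (5 : ℕ)
notation "aOutP" => (6 : ℕ)
notation "aOutQ" => (7 : ℕ)
notation "aPw" => (8 : ℕ)
notation "aChi" => (9 : ℕ)
notation "aClo" => (10 : ℕ)
notation "aNxt" => (11 : ℕ)
notation "aFst" => (12 : ℕ)
notation "aVm" => (13 : ℕ)
notation "aDist" => (14 : ℕ)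
notation "aLab" => (15 : ℕ)
notation "aQ" => (16 : ℕ)
notation "aI" => (17 : ℕ)
notation "aV" => (18 : ℕ)
notation "aPar" => (19 : ℕ)
notation "aOrd" => (20 : ℕ)
notation "aPos" => (21 : ℕ)
notation "aVal" => (22 : ℕ)
notation "aNx" => (23 : ℕ)
notation "aHd" => (24 : ℕ)
notation "aR" => (25 : ℕ)

infixr:60 " ;; " => RamProg.seq

namespace RamProg

/-- Put the item `rPX` into the slot `rPA`. -/
def push : RamProg :=
  .add rCnt rCnt rOne ;; .write aVal rCnt rPX ;; .read rT aHd rPA ;; .write aNx rCnt rT ;;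
  .write aHd rPA rCnt

/-- `rB` receives the lower end of the slot `rPA`. For slot 0 the value 0 makes the test `rDD < rB`
fail, which stops the scan. -/
def scanLoad : RamProg :=
  .ifLt rZ rPA (.sub rT rPA rOne ;; .read rB aR rT) (.const rB 0)

/-- Lower `rPA` to the slot of the key `rDD`. -/
def scan : RamProg :=
  scanLoad ;; .whileLt rDD rB (.sub rPA rPA rOne ;; scanLoad)

/-- The new item gets a provisional distance that is one too large and a provisional label above
that of every slot its key can fall into. Then `improve` treats it like any other item, and
certainly pushes it. -/
def discover : RamProg :=
  .add rLive rLive rOne ;; .write aV rPX rWv ;; .write aI rPX rI ;; .read rS1 aQ rX ;;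
  .add rS1 rS1 rWv ;; .sub rS1 rS1 rV ;; .write aQ rPX rS1 ;; .read rS1 aChi rE ;;
  .add rLy rS1 rHi ;; .add rLy rLy rK ;; .const rS1 6 ;; .add rLy rLy rS1 ;;
  .write aLab rPX rLy ;; .add rS1 rDD rOne ;; .write aDist rPX rS1

/-- Compute in `rS1` the number of the interval of length `rW` that contains `rDD`. -/
def interval : RamProg :=
  .read rS1 aChi rE ;; .add rS1 rHi rS1 ;; .read rS2 aClo rE ;; .read rS3 aR rK ;;
  .sub rS3 rS3 rW ;; .sub rS3 rD rS3 ;; .add rS2 rS2 rS3 ;;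
  .ifLt rS2 rW .skip (.add rS1 rS1 rOne)

/-- A key beyond the current interval of length 2 ^ k goes straight to its bucket. Otherwise the
scan starts at the slot given by the label, because keys only decrease; its length is paid by the
levels descended. -/
def slot : RamProg :=
  interval ;;
  .ifLt rHi rS1 (.add rPA rK rS1 ;; .add rPA rPA rOne)
    (.sub rPA rLy rTwo ;; .ifLt rK rPA (.copy rPA rK) .skip ;; scan)

def improve : RamProg :=
  .write aDist rPX rDD ;; .add rS1 rX rOne ;; .write aPar rPX rS1 ;; slot ;;
  .add rS1 rPA rTwo ;; .ifLt rS1 rLy (.write aLab rPX rS1 ;; push) .skip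

/-- Relax the edge `rE - 1` from the item `rX`, and go on to the next edge. -/
def relaxEdge : RamProg :=
  .sub rE rE rOne ;; .fread 1 0 rE ;;
  .fifLt 1 0 .skip
    (.read rWv aDst rE ;; .read rS1 aVm rWv ;; .add rPX rX rS1 ;; .sub rPX rPX rVm ;;
     .read rDD aCost rE ;; .add rDD rD rDD ;; .read rLy aLab rPX ;;
     .ifLt rZ rLy .skip discover ;;
     .ifLt rOne rLy (.read rS1 aDist rPX ;; .ifLt rDD rS1 improve .skip) .skip) ;;
  .read rE aNxt rE

def settle : RamProg :=
  .write aLab rX rOne ;; .sub rLive rLive rOne ;; .write aOrd rOc rX ;; .add rOc rOc rOne ;;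
  .read rD aDist rX ;; .read rV aV rX ;; .read rI aI rX ;; .fread 0 0 rI ;; .read rVm aVm rV ;;
  .read rE aFst rV ;; .whileLt rZ rE relaxEdge

/-- Lists are never searched for superseded entries, so the label has to tell whether the removed
entry still stands for a live item. -/
def leaf : RamProg :=
  .read rX aVal rH ;; .read rH aNx rH ;; .write aHd rZ rH ;; .read rLy aLab rX ;;
  .ifLt rOne rLy settle .skip

/-- `rS2` holds lv + 3. A label not above it belongs to a settled item or to one moved through
another entry, and the entry is dropped. -/
def splitStep : RamProg :=
  .read rPX aVal rH ;; .read rH aNx rH ;; .read rLy aLab rPX ;;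
  .ifLt rS2 rLy
    (.write aLab rPX rS2 ;; .read rS1 aDist rPX ;;
     .ifLt rS1 rD (.copy rPA rZ) (.copy rPA rS3) ;; push) .skip

def split : RamProg :=
  .sub rLv rLv rOne ;; .read rS1 aPw rLv ;; .add rD rCur rS1 ;; .write aR rLv rD ;;
  .write aHd rZ rZ ;; .add rS2 rLv rTwo ;; .add rS2 rS2 rOne ;; .add rS3 rLv rOne ;;
  .whileLt rZ rH splitStep

/-- Comparing R lv with R (lv + 1) tells whether a right half is still to come, so no dyadic digits
of cur have to be computed. -/
def ascend : RamProg :=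
  .read rS1 aR rLv ;; .add rS3 rLv rOne ;; .read rS2 aR rS3 ;;
  .ifLt rS1 rS2
    (.read rT aHd rS3 ;; .write aHd rZ rT ;; .write aHd rS3 rZ ;; .copy rCur rS1 ;;
     .write aR rLv rS2)
    (.copy rLv rS3)

def nextInterval : RamProg :=
  .add rHi rHi rOne ;; .add rS1 rK rHi ;; .add rS1 rS1 rOne ;; .read rT aHd rS1 ;;
  .write aHd rZ rT ;; .write aHd rS1 rZ ;; .read rCur aR rK ;; .add rS2 rCur rW ;;
  .write aR rK rS2

/-- Dijkstra's algorithm on all layers. -/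
def search : RamProg :=
  .whileLt rZ rLive
    (.read rH aHd rZ ;;
     .ifLt rZ rH (.ifLt rZ rLv split leaf) (.ifLt rLv rK ascend nextInterval))

end RamProg

/-! ### Representation of the abstract states in the memory -/

/-- The cells `val`, `nx` hold the linked list `l` with first node `h`, all nodes up to `N`. -/
def IsList (val nx : ℕ → ℕ) (N : ℕ) : ℕ → List ℕ → Prop
  | h, [] => h = 0
  | h, a :: l => 0 < h ∧ h ≤ N ∧ val h = a ∧ IsList val nx N (nx h) l

/-- Nodes are allocated at the fresh index N + 1 and never reused, so a push disturbs no other list.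
-/
theorem IsList.frame {val nx : ℕ → ℕ} {N a b h : ℕ} {l : List ℕ} (hl : IsList val nx N h l) :
    IsList (Function.update val (N + 1) a) (Function.update nx (N + 1) b) (N + 1) h l := by
  induction l generalizing h with
  | nil => exact hl
  | cons y l ih =>
    obtain ⟨h1, h2, h3, h4⟩ := hl
    refine ⟨h1, by omega, ?_, ?_⟩
    · rw [Function.update_of_ne (by omega)]; exact h3
    · rw [Function.update_of_ne (by omega)]; exact ih h4

theorem IsList.push {val nx : ℕ → ℕ} {N a h : ℕ} {l : List ℕ} (hl : IsList val nx N h l) :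
    IsList (Function.update val (N + 1) a) (Function.update nx (N + 1) h) (N + 1) (N + 1)
      (a :: l) := by
  refine ⟨by omega, le_rfl, by simp, ?_⟩
  rw [Function.update_self]
  exact hl.frame

/-- The linked list of the edges out of a vertex, with first entry `h`. -/
def IsAdj {m : ℕ} (nxt : ℕ → ℕ) : ℕ → List (Fin m) → Prop
  | h, [] => h = 0
  | h, e :: l => h = e + 1 ∧ IsAdj nxt (nxt e) l

namespace FlowGraph

variable {n m c : ℕ}

/-- The edges out of a vertex. -/
def out (G : FlowGraph n m c) (v : Fin n) : List (Fin m) :=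
  ((List.finRange m).filter fun e => G.src e = v).reverse

@[simp] theorem mem_out (G : FlowGraph n m c) (v : Fin n) (e : Fin m) :
    e ∈ G.out v ↔ G.src e = v := by
  simp [out]

end FlowGraph

/-- What stays fixed during the search. -/
structure Env {n m c : ℕ} (G : FlowGraph n m c) (k : ℕ) (s : RamState) : Prop where
  vn : s.ivar rN = n
  vmm : s.ivar rM = m
  z : s.ivar rZ = 0
  one : s.ivar rOne = 1
  two : s.ivar rTwo = 2
  w : s.ivar rW = 2 ^ k
  vk : s.ivar rK = k
  src : ∀ e : Fin m, s.iarr aSrc e = G.src e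
  dst : ∀ e : Fin m, s.iarr aDst e = G.dst e
  cost : ∀ e : Fin m, s.iarr aCost e = G.cost e
  cap : ∀ e : Fin m, s.farr 0 e = G.cap e
  pw : ∀ j ≤ k, s.iarr aPw j = 2 ^ j
  chi : ∀ e : Fin m, s.iarr aChi e = G.cost e / 2 ^ k
  clo : ∀ e : Fin m, s.iarr aClo e = G.cost e % 2 ^ k
  vm : ∀ v : Fin n, s.iarr aVm v = v * m
  adj : ∀ v : Fin n, IsAdj (s.iarr aNxt) (s.iarr aFst v) (G.out v)
  -- The search leaves the output lengths untouched; the output phase reads these zeros as empty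
  -- lists.
  len : s.iarr aLen = fun _ => 0

/-- The memory holds the abstract state `S`. -/
structure SearchRep {n m c : ℕ} (G : FlowGraph n m c) (k : ℕ) (s : RamState) (S : Search n m) :
    Prop where
  env : Env G k s
  live : s.ivar rLive = S.live
  hi : s.ivar rHi = S.hi
  lv : s.ivar rLv = S.lv
  cur : s.ivar rCur = S.cur
  oc : s.ivar rOc = S.ord.length
  dist : ∀ x : Item n m, s.iarr aDist x.enc = S.dist x
  lab : ∀ x : Item n m, s.iarr aLab x.enc = S.lab x
  par : ∀ x : Item n m, s.iarr aPar x.enc = S.par x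
  dec : ∀ x : Item n m, S.lab x ≠ 0 →
    s.iarr aQ x.enc = x.1 * n + x.2.2 ∧ s.iarr aI x.enc = x.2.1 ∧ s.iarr aV x.enc = x.2.2
  ord : ∀ (t : ℕ) (h : t < S.ord.length), s.iarr aOrd t = (S.ord[t]).enc
  R : s.iarr aR = S.R
  list : ∀ a, IsList (s.iarr aVal) (s.iarr aNx) (s.ivar rCnt) (s.iarr aHd a)
    ((S.L a).map Item.enc)

namespace Env

variable {n m c k : ℕ} {G : FlowGraph n m c} {s s' : RamState}

theorem congr (h : Env G k s) (hi : ∀ y < 8, s'.ivar y = s.ivar y)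
    (ha : ∀ a < 14, s'.iarr a = s.iarr a) (hf : s'.farr 0 = s.farr 0) : Env G k s' where
  vn := by rw [hi _ (by norm_num)]; exact h.vn
  vmm := by rw [hi _ (by norm_num)]; exact h.vmm
  z := by rw [hi _ (by norm_num)]; exact h.z
  one := by rw [hi _ (by norm_num)]; exact h.one
  two := by rw [hi _ (by norm_num)]; exact h.two
  w := by rw [hi _ (by norm_num)]; exact h.w
  vk := by rw [hi _ (by norm_num)]; exact h.vk
  src := by rw [ha _ (by norm_num)]; exact h.src
  dst := by rw [ha _ (by norm_num)]; exact h.dst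
  cost := by rw [ha _ (by norm_num)]; exact h.cost
  cap := by rw [hf]; exact h.cap
  pw := by rw [ha _ (by norm_num)]; exact h.pw
  chi := by rw [ha _ (by norm_num)]; exact h.chi
  clo := by rw [ha _ (by norm_num)]; exact h.clo
  vm := by rw [ha _ (by norm_num)]; exact h.vm
  adj := by rw [ha _ (by norm_num), ha _ (by norm_num)]; exact h.adj
  len := by rw [ha _ (by norm_num)]; exact h.len

end Env

theorem update_enc {n m : ℕ} {f : ℕ → ℕ} {g : Item n m → ℕ} (h : ∀ x, f x.enc = g x)
    (y : Item n m) (b : ℕ) (x : Item n m) :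
    Function.update f y.enc b x.enc = Function.update g y b x := by
  simp only [Function.update_apply, Item.enc_inj, h]

namespace SearchRep

variable {n m c k : ℕ} {G : FlowGraph n m c} {s s' : RamState} {S : Search n m}

/-- The persistent integer variables have numbers below 14; those from 14 on are scratch space, as
are the flow variables. -/
theorem congr (h : SearchRep G k s S) (hi : ∀ y < 14, s'.ivar y = s.ivar y)
    (ha : ∀ a < 26, a ≠ aPos → s'.iarr a = s.iarr a) (hf : s'.farr 0 = s.farr 0) :
    SearchRep G k s' S where
  env := h.env.congr (fun y hy => hi y (by omega)) (fun a h => ha a (by omega) (by omega)) hf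
  live := by rw [hi _ (by norm_num)]; exact h.live
  hi := by rw [hi _ (by norm_num)]; exact h.hi
  lv := by rw [hi _ (by norm_num)]; exact h.lv
  cur := by rw [hi _ (by norm_num)]; exact h.cur
  oc := by rw [hi _ (by norm_num)]; exact h.oc
  dist := by rw [ha _ (by norm_num) (by norm_num)]; exact h.dist
  lab := by rw [ha _ (by norm_num) (by norm_num)]; exact h.lab
  par := by rw [ha _ (by norm_num) (by norm_num)]; exact h.par
  dec := by
    rw [ha aQ (by norm_num) (by norm_num), ha aI (by norm_num) (by norm_num),
      ha aV (by norm_num) (by norm_num)]; exact h.dec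
  ord := by rw [ha _ (by norm_num) (by norm_num)]; exact h.ord
  R := by rw [ha _ (by norm_num) (by norm_num)]; exact h.R
  list := by
    rw [ha aVal (by norm_num) (by norm_num), ha aNx (by norm_num) (by norm_num),
      ha aHd (by norm_num) (by norm_num), hi _ (by norm_num)]; exact h.list

theorem setI (h : SearchRep G k s S) {x v : ℕ} (hx : 14 ≤ x) : SearchRep G k (s.setI x v) S :=
  h.congr (fun y hy => by rw [RamState.ivar_setI, if_neg (by omega)]) (fun _ _ _ => rfl) rfl

theorem setF (h : SearchRep G k s S) {x : ℕ} {v : WithTop ℝ} : SearchRep G k (s.setF x v) S :=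
  h.congr (fun _ _ => rfl) (fun _ _ _ => rfl) rfl

theorem setDist (h : SearchRep G k s S) (y : Item n m) (b : ℕ) :
    SearchRep G k (s.setIA aDist y.enc b) { S with dist := Function.update S.dist y b } :=
  { h with
    env := h.env.congr (fun _ _ => rfl) (fun a ha => by simp; omega) rfl
    dist := update_enc h.dist y b }

theorem setPar (h : SearchRep G k s S) (y : Item n m) (b : ℕ) :
    SearchRep G k (s.setIA aPar y.enc b) { S with par := Function.update S.par y b } :=
  { h with
    env := h.env.congr (fun _ _ => rfl) (fun a ha => by simp; omega) rfl
    par := update_enc h.par y b }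

theorem setLab (h : SearchRep G k s S) (y : Item n m) (b : ℕ)
    (hy : s.iarr aQ y.enc = y.1 * n + y.2.2 ∧ s.iarr aI y.enc = y.2.1 ∧
      s.iarr aV y.enc = y.2.2) :
    SearchRep G k (s.setIA aLab y.enc b) { S with lab := Function.update S.lab y b } :=
  { h with
    env := h.env.congr (fun _ _ => rfl) (fun a ha => by simp; omega) rfl
    lab := update_enc h.lab y b
    dec := by
      intro x hx
      by_cases hxy : x = y
      · subst hxy; exact hy
      · simp only [Function.update_of_ne hxy] at hx
        exact h.dec x hx }

theorem setR (h : SearchRep G k s S) (j b : ℕ) :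
    SearchRep G k (s.setIA aR j b) { S with R := Function.update S.R j b } :=
  { h with
    env := h.env.congr (fun _ _ => rfl) (fun a ha => by simp; omega) rfl
    R := by rw [← h.R]; rfl }

theorem setHd (h : SearchRep G k s S) (a b : ℕ) (l : List (Item n m))
    (hl : IsList (s.iarr aVal) (s.iarr aNx) (s.ivar rCnt) b (l.map Item.enc)) :
    SearchRep G k (s.setIA aHd a b) { S with L := Function.update S.L a l } :=
  { h with
    env := h.env.congr (fun _ _ => rfl) (fun a ha => by simp; omega) rfl
    list := by
      intro b'
      show IsList (s.iarr aVal) (s.iarr aNx) (s.ivar rCnt)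
        (Function.update (s.iarr aHd) a b b') ((Function.update S.L a l b').map Item.enc)
      by_cases hb : b' = a
      · subst hb; simpa using hl
      · rw [Function.update_of_ne hb, Function.update_of_ne hb]; exact h.list b' }

/-- Changing an array that holds the components of the items that are not yet seen. -/
theorem setUnseen (h : SearchRep G k s S) (y : Item n m) (hy : S.lab y = 0) (a b : ℕ)
    (ha : a = aQ ∨ a = aI ∨ a = aV) : SearchRep G k (s.setIA a y.enc b) S := by
  have key : ∀ a' < 26, a' ≠ a → (s.setIA a y.enc b).iarr a' = s.iarr a' := by
    intro a' _ h'; simp [h']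
  have key2 : ∀ a' x, S.lab x ≠ 0 → (s.setIA a y.enc b).iarr a' x.enc = s.iarr a' x.enc := by
    intro a' x hx
    have hxy : x ≠ y := by rintro rfl; exact hx hy
    by_cases haa : a' = a
    · subst haa; simp [Item.enc_inj, hxy]
    · simp [haa]
  exact
    { env := h.env.congr (fun _ _ => rfl) (fun a' ha' => key a' (by omega) (by omega)) rfl
      live := h.live
      hi := h.hi
      lv := h.lv
      cur := h.cur
      oc := h.oc
      dist := by rw [key _ (by norm_num) (by omega)]; exact h.dist
      lab := by rw [key _ (by norm_num) (by omega)]; exact h.lab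
      par := by rw [key _ (by norm_num) (by omega)]; exact h.par
      dec := by
        intro x hx
        rw [key2 _ x hx, key2 _ x hx, key2 _ x hx]
        exact h.dec x hx
      ord := by rw [key _ (by norm_num) (by omega)]; exact h.ord
      R := by rw [key _ (by norm_num) (by omega)]; exact h.R
      list := by
        rw [key aVal (by norm_num) (by omega), key aNx (by norm_num) (by omega),
          key aHd (by norm_num) (by omega)]; exact h.list }

theorem setLive (h : SearchRep G k s S) (v : ℕ) :
    SearchRep G k (s.setI rLive v) { S with live := v } :=
  { h with
    env := h.env.congr (fun y hy => by simp; omega) (fun _ _ => rfl) rfl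
    live := rfl }

theorem setHi (h : SearchRep G k s S) (v : ℕ) : SearchRep G k (s.setI rHi v) { S with hi := v } :=
  { h with
    env := h.env.congr (fun y hy => by simp; omega) (fun _ _ => rfl) rfl
    hi := rfl }

theorem setLv (h : SearchRep G k s S) (v : ℕ) : SearchRep G k (s.setI rLv v) { S with lv := v } :=
  { h with
    env := h.env.congr (fun y hy => by simp; omega) (fun _ _ => rfl) rfl
    lv := rfl }

theorem setCur (h : SearchRep G k s S) (v : ℕ) : SearchRep G k (s.setI rCur v) { S with cur := v } :=
  { h with
    env := h.env.congr (fun y hy => by simp; omega) (fun _ _ => rfl) rfl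
    cur := rfl }

theorem snoc (h : SearchRep G k s S) (x : Item n m) :
    SearchRep G k ((s.setIA aOrd S.ord.length x.enc).setI rOc (S.ord.length + 1))
      { S with ord := S.ord ++ [x] } :=
  { h with
    env := h.env.congr (fun y hy => by simp; omega) (fun a ha => by simp; omega) rfl
    oc := by simp
    ord := by
      intro t ht
      show Function.update (s.iarr aOrd) _ _ t = _
      simp only [List.length_append, List.length_singleton] at ht
      rcases Nat.lt_or_ge t S.ord.length with h1 | h1
      · rw [Function.update_of_ne (by omega), List.getElem_append_left h1]
        exact h.ord t h1
      · have : t = S.ord.length := by omega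
        subst this
        simp }

end SearchRep

/-- All integer variables outside `V` and all flow variables have the same values. -/
def Same (V : List ℕ) (s s' : RamState) : Prop :=
  (∀ y, y ∉ V → s'.ivar y = s.ivar y) ∧ s'.fvar = s.fvar

/-! ### Specifications of the queue operations -/

section Specs

variable {n m c k W : ℕ} {G : FlowGraph n m c} {s : RamState} {S : Search n m}

/-- The last clause is for a list that has been detached from its slot and is being traversed while
its items are pushed elsewhere, as in `split`. -/
theorem push_spec (h : SearchRep G k s S) {x : Item n m} {a : ℕ} (hx : s.ivar rPX = x.enc)
    (ha : s.ivar rPA = a) (hW : s.ivar rCnt + 1 ≤ W) :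
    WP W .push (fun s' t => t = 5 ∧ SearchRep G k s' { S with L := Function.update S.L a (x :: S.L a) } ∧
      s'.ivar rCnt = s.ivar rCnt + 1 ∧ Same [rT, rCnt] s s' ∧
      ∀ b l, IsList (s.iarr aVal) (s.iarr aNx) (s.ivar rCnt) b l →
        IsList (s'.iarr aVal) (s'.iarr aNx) (s'.ivar rCnt) b l) s := by
  simp [RamProg.push, hx, ha, h.env.one]
  refine ⟨hW, ?_, ?_, fun b l hl => hl.frame⟩
  · exact
    { h with
      env := h.env.congr (fun y hy => by simp [show y ≠ 12 by omega, show y ≠ 22 by omega])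
        (fun a ha => by simp [show a ≠ 22 by omega, show a ≠ 23 by omega, show a ≠ 24 by omega]) rfl
      list := by
        intro b
        show IsList (Function.update (s.iarr aVal) (s.ivar rCnt + 1) x.enc)
          (Function.update (s.iarr aNx) (s.ivar rCnt + 1) (s.iarr aHd a)) (s.ivar rCnt + 1)
          (Function.update (s.iarr aHd) a (s.ivar rCnt + 1) b)
          ((Function.update S.L a (x :: S.L a) b).map Item.enc)
        by_cases hb : b = a
        · subst hb
          simpa using (h.list b).push
        · rw [Function.update_of_ne hb, Function.update_of_ne hb]
          exact (h.list b).frame }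
  · refine ⟨fun y hy => ?_, rfl⟩
    simp at hy
    simp [hy]

end Specs


theorem Same.refl (V : List ℕ) (s : RamState) : Same V s s := ⟨fun _ _ => rfl, rfl⟩

theorem Same.trans {V : List ℕ} {s₁ s₂ s₃ : RamState} (h : Same V s₁ s₂) (h' : Same V s₂ s₃) :
    Same V s₁ s₃ :=
  ⟨fun y hy => (h'.1 y hy).trans (h.1 y hy), h'.2.trans h.2⟩

theorem Same.mono {V V' : List ℕ} {s₁ s₂ : RamState} (h : Same V s₁ s₂) (hV : V ⊆ V') :
    Same V' s₁ s₂ :=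
  ⟨fun y hy => h.1 y fun h' => hy (hV h'), h.2⟩

theorem Same.setI {V : List ℕ} {s s' : RamState} {x v : ℕ} (h : Same V s s') (hx : x ∈ V) :
    Same V s (s'.setI x v) :=
  ⟨fun y hy => by
    rw [RamState.ivar_setI, if_neg (by rintro rfl; exact hy hx)]; exact h.1 y hy, h.2⟩

theorem Same.setIA {V : List ℕ} {s s' : RamState} {a i v : ℕ} (h : Same V s s') :
    Same V s (s'.setIA a i v) := h

/-- Only integer variables in `V` have changed. -/
def Frame (V : List ℕ) (s s' : RamState) : Prop :=
  Same V s s' ∧ s'.iarr = s.iarr ∧ s'.farr = s.farr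

theorem Frame.refl (V : List ℕ) (s : RamState) : Frame V s s := ⟨.refl _ _, rfl, rfl⟩

theorem Frame.trans {V : List ℕ} {s₁ s₂ s₃ : RamState} (h : Frame V s₁ s₂) (h' : Frame V s₂ s₃) :
    Frame V s₁ s₃ :=
  ⟨h.1.trans h'.1, h'.2.1.trans h.2.1, h'.2.2.trans h.2.2⟩

theorem Frame.mono {V V' : List ℕ} {s₁ s₂ : RamState} (h : Frame V s₁ s₂) (hV : V ⊆ V') :
    Frame V' s₁ s₂ :=
  ⟨h.1.mono hV, h.2⟩

theorem Frame.setI {V : List ℕ} {s s' : RamState} {x v : ℕ} (h : Frame V s s') (hx : x ∈ V) :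
    Frame V s (s'.setI x v) :=
  ⟨h.1.setI hx, h.2⟩

section Specs

variable {n m c k W : ℕ} {G : FlowGraph n m c} {s : RamState} {S : Search n m}

theorem SearchRep.frame {V : List ℕ} {s' : RamState} (h : SearchRep G k s S) (hf : Frame V s s')
    (hV : ∀ y ∈ V, 14 ≤ y) : SearchRep G k s' S :=
  h.congr (fun y hy => hf.1.1 y fun hy' => by have := hV y hy'; omega)
    (fun a _ _ => by rw [hf.2.1]) (by rw [hf.2.2])

/-- Every slot passed over begins after d, and leaving it costs constant time; so the time is linear
in the number of slots descended. -/
theorem scan_spec (h : SearchRep G k s S) {σ₀ d : ℕ} (hP : s.ivar rPA = σ₀)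
    (hD : s.ivar rDD = d) :
    WP W .scan (fun s' t => ∃ σ ≤ σ₀, Frame [rPA, rT, rB] s s' ∧ s'.ivar rPA = σ ∧
      (σ ≠ 0 → S.R (σ - 1) ≤ d) ∧ (∀ j, σ < j → j ≤ σ₀ → d < S.R (j - 1)) ∧
      t ≤ 10 + 10 * (σ₀ - σ)) s := by
  have load : ∀ (s₁ : RamState) (σ : ℕ), Frame [rPA, rT, rB] s s₁ → s₁.ivar rPA = σ →
      WP W .scanLoad (fun s' t => Frame [rPA, rT, rB] s s' ∧ s'.ivar rPA = σ ∧
        s'.ivar rB = (if σ = 0 then 0 else S.R (σ - 1)) ∧ t ≤ 3) s₁ := by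
    intro s₁ σ hf hσ
    have hz : s₁.ivar rZ = 0 := by rw [hf.1.1 _ (by decide)]; exact h.env.z
    have ho : s₁.ivar rOne = 1 := by rw [hf.1.1 _ (by decide)]; exact h.env.one
    have hR : s₁.iarr aR = S.R := by rw [hf.2.1]; exact h.R
    simp only [RamProg.scanLoad, WP.ifLt_iff, WP.seq_iff, WP.sub_iff, WP.read_iff, WP.const_iff]
    constructor
    · intro hlt
      rw [hz, hσ] at hlt
      refine ⟨(hf.setI (by decide)).setI (by decide), by simpa using hσ, ?_, by norm_num⟩
      simp [hσ, ho, hR, hlt.ne']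
    · intro hlt
      rw [hz, hσ] at hlt
      refine ⟨Nat.zero_le _, hf.setI (by decide), by simpa using hσ, ?_, by norm_num⟩
      simp
      omega
  unfold RamProg.scan
  rw [WP.seq_iff]
  refine (load s σ₀ (.refl _ _) hP).mono ?_
  rintro s₁ t₁ ⟨hf, hσ, hB, ht⟩
  refine WP.whileLt (fun s' t => ∃ σ ≤ σ₀, Frame [rPA, rT, rB] s s' ∧ s'.ivar rPA = σ ∧
      s'.ivar rB = (if σ = 0 then 0 else S.R (σ - 1)) ∧
      (∀ j, σ < j → j ≤ σ₀ → d < S.R (j - 1)) ∧ t ≤ 5 * (σ₀ - σ)) (5 * σ₀)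
    ⟨σ₀, le_rfl, hf, hσ, hB, fun j h1 h2 => by omega, by omega⟩ ?_ ?_ ?_
  · rintro s t ⟨σ, _, _, _, _, _, h6⟩
    omega
  · rintro s₂ t ⟨σ, h1, h2, h3, h4, h5, h6⟩ hlt
    have hd : s₂.ivar rDD = d := by rw [h2.1.1 _ (by decide)]; exact hD
    have ho : s₂.ivar rOne = 1 := by rw [h2.1.1 _ (by decide)]; exact h.env.one
    rw [hd, h4] at hlt
    have h0 : σ ≠ 0 := by rintro rfl; simp at hlt
    rw [if_neg h0] at hlt
    rw [WP.seq_iff, WP.sub_iff, h3, ho]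
    refine (load _ (σ - 1) (h2.setI (by decide)) (by simp)).mono ?_
    rintro s₃ t₃ ⟨g1, g2, g3, g4⟩
    refine ⟨σ - 1, by omega, g1, g2, g3, ?_, by omega⟩
    intro j hj hj'
    by_cases hjσ : j = σ
    · rw [hjσ]; exact hlt
    · exact h5 j (by omega) hj'
  · rintro s₂ t ⟨σ, h1, h2, h3, h4, h5, h6⟩ hlt
    have hd : s₂.ivar rDD = d := by rw [h2.1.1 _ (by decide)]; exact hD
    refine ⟨σ, h1, h2, h3, ?_, h5, by omega⟩
    intro h0
    rw [hd, h4, if_neg h0] at hlt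
    omega

/-- The quotients of cur and of the edge cost by 2 ^ k add up, with a carry if the remainders
overflow. The quotient of cur is hi and that of the cost is tabulated, so the machine never divides
here. -/
theorem interval_spec (h : SearchRep G k s S) (htop : S.R k = (S.hi + 1) * 2 ^ k)
    (hge : S.hi * 2 ^ k ≤ S.cur) (hlt : S.cur < (S.hi + 1) * 2 ^ k) (e : Fin m)
    (hE : s.ivar rE = e) (hD : s.ivar rD = S.cur)
    (hW : S.cur + G.cost e + 2 ^ k + 2 ≤ W) :
    WP W .interval (fun s' t => Frame [rS1, rS2, rS3] s s' ∧
      s'.ivar rS1 = (S.cur + G.cost e) / 2 ^ k ∧ t ≤ 12) s := by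
  have hp : 0 < 2 ^ k := by positivity
  have hst : S.R k - 2 ^ k = S.hi * 2 ^ k := by rw [htop]; simp [Nat.add_mul]
  have hdiv : S.cur / 2 ^ k = S.hi := by
    apply Nat.div_eq_of_lt_le
    · exact hge
    · exact hlt
  have hmod : S.cur - S.hi * 2 ^ k = S.cur % 2 ^ k := by
    rw [← hdiv, Nat.mod_def, mul_comm]
  have hsum : (S.cur + G.cost e) / 2 ^ k = S.cur / 2 ^ k + G.cost e / 2 ^ k +
      if 2 ^ k ≤ S.cur % 2 ^ k + G.cost e % 2 ^ k then 1 else 0 := Nat.add_div hp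
  have hr1 := Nat.div_le_self (G.cost e) (2 ^ k)
  have hr2 := Nat.mod_le (G.cost e) (2 ^ k)
  have hr3 := Nat.mod_le S.cur (2 ^ k)
  have hr4 := Nat.div_le_self S.cur (2 ^ k)
  simp only [RamProg.interval, WP.ifLt_iff, WP.seq_iff, WP.sub_iff, WP.read_iff, WP.add_iff,
    WP.skip_iff]
  simp [hE, h.env.chi, h.env.clo, h.hi, h.R, h.env.vk, h.env.w, hD, hst, hmod, h.env.one]
  have hfr : ∀ a b d, Frame [rS1, rS2, rS3] s
      (((((((s.setI 27 a).setI 27 b).setI 28 d).setI 29 (S.R k)).setI 29 (S.hi * 2 ^ k)).setI 29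
        (S.cur % 2 ^ k)).setI 28 (d + S.cur % 2 ^ k)) := fun a b d =>
    (((((((Frame.refl _ s).setI (by decide)).setI (by decide)).setI (by decide)).setI
      (by decide)).setI (by decide)).setI (by decide)).setI (by decide)
  refine ⟨by omega, by omega, fun hc => ⟨hfr _ _ _, ?_⟩, fun hc => ⟨by omega, (hfr _ _ _).setI (by decide), ?_⟩⟩
  · rw [hsum, if_neg (by omega)]; omega
  · rw [hsum, if_pos (by omega)]; omega

/-- The key must lie before the right end of the slot found. If the scan does not move, this comes
from `hlR` or, at the slot k, from the interval number; otherwise from the slot left last. -/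
theorem slot_spec (h : SearchRep G k s S) (htop : S.R k = (S.hi + 1) * 2 ^ k)
    (hge : S.hi * 2 ^ k ≤ S.cur) (hlt : S.cur < (S.hi + 1) * 2 ^ k) (e : Fin m) {l : ℕ}
    (hE : s.ivar rE = e) (hD : s.ivar rD = S.cur) (hDD : s.ivar rDD = S.cur + G.cost e)
    (hL : s.ivar rLy = l) (hlv : S.lv = 0)
    (hlR : l - 2 < k → S.cur + G.cost e < S.R (l - 2))
    (hW : S.cur + G.cost e + 2 ^ k + k + 2 ≤ W) :
    WP W .slot (fun s' t => Frame [rS1, rS2, rS3, rPA, rT, rB] s s' ∧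
      S.lo k (s'.ivar rPA) ≤ S.cur + G.cost e ∧ S.cur + G.cost e < S.up k (s'.ivar rPA) ∧
      (s'.ivar rPA ≤ k ∨
        s'.ivar rPA = k + 1 + (S.cur + G.cost e) / 2 ^ k ∧ k + 1 + S.hi < s'.ivar rPA) ∧
      t ≤ 32 + 10 * (min (l - 2) k - s'.ivar rPA)) s := by
  have hp : 0 < 2 ^ k := by positivity
  have hdle := Nat.div_le_self (S.cur + G.cost e) (2 ^ k)
  unfold RamProg.slot
  rw [WP.seq_iff]
  refine (interval_spec h htop hge hlt e hE hD (by omega)).mono ?_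
  rintro s₁ t₁ ⟨hf, hS1, ht₁⟩
  have h₁ : SearchRep G k s₁ S := h.frame hf (by simp)
  have hL₁ : s₁.ivar rLy = l := by rw [hf.1.1 _ (by decide)]; exact hL
  have hDD₁ : s₁.ivar rDD = S.cur + G.cost e := by rw [hf.1.1 _ (by decide)]; exact hDD
  have hf' : Frame [rS1, rS2, rS3, rPA, rT, rB] s s₁ := hf.mono (by simp)
  rw [WP.ifLt_iff, h₁.hi, hS1]
  set q := (S.cur + G.cost e) / 2 ^ k with hq
  have hq1 : q * 2 ^ k ≤ S.cur + G.cost e := Nat.div_mul_le_self _ _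
  have hq2 : S.cur + G.cost e < (q + 1) * 2 ^ k := by
    rw [mul_comm]; exact Nat.lt_mul_div_succ _ hp
  constructor
  · intro hlt
    simp only [WP.seq_iff, WP.add_iff]
    simp [h₁.env.vk, h₁.env.one, hS1]
    refine ⟨by omega, by omega, (hf'.setI (x := rPA) ?_).setI ?_,
      ?_, ?_, ⟨by omega, by omega⟩, by omega⟩
    · decide
    · decide
    · unfold Search.lo
      rw [if_neg (by omega), if_neg (by omega), show k + q + 1 - k - 1 = q by omega]
      exact hq1
    · unfold Search.up
      rw [if_neg (by omega), if_neg (by omega), show k + q + 1 - k = q + 1 by omega]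
      exact hq2
  · intro hlt
    have hRk : S.cur + G.cost e < S.R k := by
      rw [htop]
      exact hq2.trans_le (Nat.mul_le_mul_right _ (by omega))
    have key : ∀ s₂ t₂, Frame [rS1, rS2, rS3, rPA, rT, rB] s s₂ → s₂.ivar rPA = min (l - 2) k →
        t₂ ≤ 8 → WP W .scan (fun s' t => Frame [rS1, rS2, rS3, rPA, rT, rB] s s' ∧
          S.lo k (s'.ivar rPA) ≤ S.cur + G.cost e ∧
          S.cur + G.cost e < S.up k (s'.ivar rPA) ∧
          (s'.ivar rPA ≤ k ∨ s'.ivar rPA = k + 1 + q ∧ k + 1 + S.hi < s'.ivar rPA) ∧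
          t₁ + (t₂ + t + 1) ≤ 32 + 10 * (min (l - 2) k - s'.ivar rPA)) s₂ := by
      intro s₂ t₂ hf₂ hp₂ ht₂
      refine (scan_spec (d := S.cur + G.cost e) (h.frame hf₂ (by simp)) hp₂
        (by rw [hf₂.1.1 _ (by decide)]; exact hDD)).mono ?_
      rintro s₃ t₃ ⟨σ, g1, g2, g3, g4, g5, g6⟩
      rw [g3]
      refine ⟨hf₂.trans (g2.mono (by simp)), ?_, ?_, Or.inl (by omega), by omega⟩
      · unfold Search.lo
        split_ifs with h0 h1
        · omega
        · exact g4 h0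
        · omega
      · have hσR : S.cur + G.cost e < S.R σ := by
          by_cases hσ : σ = min (l - 2) k
          · rcases Nat.lt_or_ge (l - 2) k with hlk | hlk
            · rw [hσ, min_eq_left hlk.le]; exact hlR hlk
            · rw [hσ, min_eq_right hlk]; exact hRk
          · exact g5 (σ + 1) (by omega) (by omega)
        unfold Search.up
        split_ifs with h0 h1
        · rw [h0] at hσR; rw [hlv]; exact hσR
        · exact hσR
        · omega
    simp only [WP.seq_iff, WP.sub_iff, WP.ifLt_iff, WP.copy_iff, WP.skip_iff]
    constructor
    · intro hkl
      refine (key _ 3 ((hf'.setI (x := rPA) ?_).setI (x := rPA) ?_) ?_ (by norm_num)).mono ?_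
      · decide
      · decide
      · simp [h₁.env.vk, h₁.env.two, hL₁] at hkl ⊢; omega
      · rintro s' t ⟨g1, g2, g3, g4, g5⟩
        exact ⟨g1, g2, g3, g4, by omega⟩
    · intro hkl
      refine (key _ 3 (hf'.setI (x := rPA) ?_) ?_ (by norm_num)).mono ?_
      · decide
      · simp [h₁.env.vk, h₁.env.two, hL₁] at hkl ⊢; omega
      · rintro s' t ⟨g1, g2, g3, g4, g5⟩
        exact ⟨g1, g2, g3, g4, by omega⟩

end Specs


/-! ### Credits -/

namespace FlowGraph

variable {n m c : ℕ}

/-- The items that can be reached. -/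
def items (G : FlowGraph n m c) : Finset (Item n m) :=
  Finset.univ.filter fun x => x.2.2 = x.1 ∨ ∃ e, G.dst e = x.2.2

end FlowGraph

theorem sum_add_of_eq_off {ι : Type*} [DecidableEq ι] {s : Finset ι} {f g : ι → ℕ} {y : ι}
    (hy : y ∈ s) (h : ∀ x, x ≠ y → g x = f x) : ∑ x ∈ s, g x + f y = ∑ x ∈ s, f x + g y := by
  rw [← Finset.add_sum_erase s g hy, ← Finset.add_sum_erase s f hy,
    Finset.sum_congr rfl fun x hx => h x (Finset.ne_of_mem_erase hx)]
  ring

namespace Search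

variable {n m c : ℕ}

/-- The number of levels that an item can still go down. -/
def levels (k l : ℕ) : ℕ := if l = 0 then k + 1 else min (l - 2) (k + 1)

/-- An unsettled item has paid in advance for every level it can still descend, for being settled
and for relaxing each of its outgoing edges. -/
def itemPot (G : FlowGraph n m c) (k : ℕ) (lab : Item n m → ℕ) (x : Item n m) : ℕ :=
  if lab x = 1 then 0 else 200 * levels k (lab x) + 600 * (1 + (G.out x.2.2).length)

def itemsPot (G : FlowGraph n m c) (k : ℕ) (lab : Item n m → ℕ) : ℕ :=
  ∑ x ∈ G.items, itemPot G k lab x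

def entries (A : ℕ) (L : ℕ → List (Item n m)) : ℕ := ∑ a ∈ Finset.range A, (L a).length

/-- The extra unit stands for a right half still to come. Advancing into it loses this unit, and
going up loses 2 and gains at most 1; so every `ascend` lowers the value. -/
def levelPot (S : Search n m) (k : ℕ) : ℕ :=
  2 * (k - S.lv) + if S.lv < k ∧ S.R S.lv < S.R (S.lv + 1) then 1 else 0

/-- The credits of a state, a bound on the time that the search still takes. -/
def pot (G : FlowGraph n m c) (k A H : ℕ) (S : Search n m) : ℕ :=
  -- Each list entry pays for its own removal, superseded or not, and H − hi for the intervals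
  -- ahead. The last summand grows during the search: it reserves time for the output and bounds the
  -- number of settled items.
  itemsPot G k S.lab + 200 * entries A S.L + 20 * S.levelPot k + 20 * (H - S.hi) +
    100 * S.ord.length

theorem entries_update {A : ℕ} {L : ℕ → List (Item n m)} {a : ℕ} (ha : a < A)
    (l : List (Item n m)) :
    entries A (Function.update L a l) + (L a).length = entries A L + l.length := by
  unfold entries
  have := sum_add_of_eq_off (s := Finset.range A) (f := fun a => (L a).length)
    (g := fun b => (Function.update L a l b).length) (y := a) (by simpa using ha)
    (fun b hb => by simp [hb])
  simpa using this

theorem itemsPot_update {G : FlowGraph n m c} {k : ℕ} {lab : Item n m → ℕ} {y : Item n m}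
    (hy : y ∈ G.items) (b : ℕ) :
    itemsPot G k (Function.update lab y b) + itemPot G k lab y =
      itemsPot G k lab + itemPot G k (Function.update lab y b) y :=
  sum_add_of_eq_off hy fun x hx => by simp [itemPot, hx]

theorem DInv.mem_items {G : FlowGraph n m c} {S : Search n m} {pend : Item n m → Fin m → Prop}
    (h : DInv G S pend) {x : Item n m} (hx : S.lab x ≠ 0) : x ∈ G.items := by
  simp only [FlowGraph.items, Finset.mem_filter, Finset.mem_univ, true_and]
  by_cases hv : x.1 = x.2.2
  · exact Or.inl hv.symm
  · obtain ⟨e, he, -⟩ := h.parent x.1 x.2.1 x.2.2 hv (by simpa using hx)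
    exact Or.inr ⟨e, he⟩

theorem settled_le (S : Search n m) (u : Fin n) (i : Fin m) : S.settled u i ≤ n := by
  exact (Finset.card_filter_le _ _).trans (by simp)

end Search

/-- The words can hold all numbers that occur. -/
def wordBound (n m c k T : ℕ) : ℕ :=
  n * n * m + n * m + n * n + n + m + 2 * (c * n) + 2 * c + 2 * 2 ^ k + 2 * k + T + 20

theorem Item.enc_add_lt {n m : ℕ} (x : Item n m) : x.enc + 1 ≤ n * n * m := by
  obtain ⟨u, i, v⟩ := x
  simp only [Item.enc]
  have h1 : (u : ℕ) * n + v + 1 ≤ n * n := by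
    have := Nat.mul_le_mul_right n u.2
    have := v.2
    rw [Nat.succ_mul] at *
    omega
  have h2 := Nat.mul_le_mul_right m h1
  have := i.2
  rw [Nat.succ_mul] at h2
  omega

theorem Item.quot_lt {n m : ℕ} (x : Item n m) : x.1 * n + x.2.2 < n * n := by
  have := Nat.mul_le_mul_right n x.1.2
  have := x.2.2.2
  rw [Nat.succ_mul] at *
  omega

section Specs

open Search

variable {n m c k W T A H : ℕ} {G : FlowGraph n m c} {s : RamState} {S : Search n m}

theorem improve_spec (h : SearchRep G k s S) (htop : S.R k = (S.hi + 1) * 2 ^ k)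
    (hge : S.hi * 2 ^ k ≤ S.cur) (hlt : S.cur < (S.hi + 1) * 2 ^ k) (hlv : S.lv = 0)
    (x y : Item n m) (e : Fin m) (hX : s.ivar rX = x.enc) (hP : s.ivar rPX = y.enc)
    (hE : s.ivar rE = e) (hD : s.ivar rD = S.cur) (hDD : s.ivar rDD = S.cur + G.cost e)
    (hL : s.ivar rLy = S.lab y) (hy : 2 ≤ S.lab y)
    (hlR : S.lab y - 2 < k → S.cur + G.cost e < S.R (S.lab y - 2))
    (hcur : S.cur ≤ c * n) (hW : wordBound n m c k T ≤ W) (hcnt : s.ivar rCnt ≤ T) :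
    WP W .improve (fun s' t => ∃ a, S.lo k a ≤ S.cur + G.cost e ∧
      S.cur + G.cost e < S.up k a ∧
      (a ≤ k ∨ a = k + 1 + (S.cur + G.cost e) / 2 ^ k ∧ k + 1 + S.hi < a) ∧
      t ≤ 45 + 10 * (min (S.lab y - 2) k - a) ∧
      Same [rS1, rS2, rS3, rPA, rT, rB, rCnt] s s' ∧
      (a + 2 < S.lab y ∧ s'.ivar rCnt = s.ivar rCnt + 1 ∧
        SearchRep G k s' { S with
          dist := Function.update S.dist y (S.cur + G.cost e)
          par := Function.update S.par y (x.enc + 1)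
          lab := Function.update S.lab y (a + 2)
          L := Function.update S.L a (y :: S.L a) } ∨
       S.lab y ≤ a + 2 ∧ s'.ivar rCnt = s.ivar rCnt ∧
        SearchRep G k s' { S with
          dist := Function.update S.dist y (S.cur + G.cost e)
          par := Function.update S.par y (x.enc + 1) })) s := by
  have hxe := x.enc_add_lt
  have hce := G.cost_le e
  unfold wordBound at hW
  unfold RamProg.improve
  simp only [WP.seq_iff, WP.write_iff, WP.add_iff]
  simp only [hP, hDD, RamState.ivar_setIA, hX, h.env.one, RamState.ivar_setI]
  norm_num
  refine ⟨by omega, ?_⟩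
  have h₁ := ((h.setDist y (S.cur + G.cost e)).setI (x := rS1) (v := x.enc + 1)
    (by norm_num)).setPar y (x.enc + 1)
  dsimp only at h₁
  set s₁ := ((s.setIA aDist y.enc (S.cur + G.cost e)).setI rS1 (x.enc + 1)).setIA aPar y.enc
    (x.enc + 1) with hs₁
  have hsame₁ : Same [rS1, rS2, rS3, rPA, rT, rB, rCnt] s s₁ :=
    ((((Same.refl _ s).setIA (a := aDist) (i := y.enc) (v := S.cur + G.cost e)).setI
      (x := rS1) (v := x.enc + 1) (by decide))).setIA
  have q1 : ∀ r, r ∉ [rS1, rS2, rS3, rPA, rT, rB, rCnt] → s₁.ivar r = s.ivar r := hsame₁.1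
  refine (slot_spec (l := S.lab y) h₁ htop hge hlt e (by rw [q1 _ (by decide), hE])
    (by rw [q1 _ (by decide), hD]) (by rw [q1 _ (by decide), hDD])
    (by rw [q1 _ (by decide), hL]) hlv hlR (by simp only; omega)).mono ?_
  rintro s₂ t₂ ⟨hf, g1, g2, g3, g4⟩
  have h₂ := h₁.frame hf (by simp)
  have hsame₂ : Same [rS1, rS2, rS3, rPA, rT, rB, rCnt] s s₂ :=
    hsame₁.trans (hf.1.mono (by simp))
  have q2 : ∀ r, r ∉ [rS1, rS2, rS3, rPA, rT, rB, rCnt] → s₂.ivar r = s.ivar r := hsame₂.1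
  have hc₂ : s₂.ivar rCnt = s.ivar rCnt := by
    rw [hf.1.1 _ (by decide)]; rfl
  have hdiv := Nat.div_le_self (S.cur + G.cost e) (2 ^ k)
  simp only at g1 g2 g3 g4
  set a := s₂.ivar rPA with ha
  have htwo : s₂.ivar rTwo = 2 := by rw [q2 _ (by decide)]; exact h.env.two
  have hLy : s₂.ivar rLy = S.lab y := by rw [q2 _ (by decide)]; exact hL
  have hPX : s₂.ivar rPX = y.enc := by rw [q2 _ (by decide)]; exact hP
  rw [htwo]
  refine ⟨by omega, ?_⟩
  simp only [hLy]
  constructor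
  · intro hlt'
    rw [hPX]
    have hd := h₂.dec y (by simp only; omega)
    have h₃ := (h₂.setI (x := rS1) (v := a + 2) (by norm_num)).setLab y (a + 2) hd
    refine (push_spec (a := a) h₃ (x := y) (by simp [hPX]) (by simp [ha]) ?_).mono ?_
    · simp only [RamState.ivar_setIA, RamState.ivar_setI]
      norm_num
      omega
    · rintro s₄ t₄ ⟨rfl, h₄, hc₄, hs₄, -⟩
      refine ⟨a, g1, g2, g3, by omega, ?_, Or.inl ⟨hlt', ?_, h₄⟩⟩
      · refine (hsame₂.setI (x := rS1) (v := a + 2) (by decide)).trans ?_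
        exact Same.mono (V := [rT, rCnt]) hs₄ (by simp)
      · rw [hc₄]; simpa using hc₂
  · intro hlt'
    refine ⟨a, g1, g2, g3, by omega, hsame₂.setI (by decide), Or.inr ⟨by omega, ?_, ?_⟩⟩
    · simpa using hc₂
    · exact h₂.setI (by norm_num)

end Specs


/-! ### Relaxing an edge: invariants and credits -/

namespace Search

variable {n m c k A H : ℕ} {G : FlowGraph n m c} {S : Search n m}
  {pend : Item n m → Fin m → Prop}

/-- Only the source and heads of edges are ever seen. The minimum is what later yields both mn² and
m²n as bounds for the number of items. -/
theorem DInv.settled_le_min (h : DInv G S pend) (u : Fin n) (i : Fin m) :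
    S.settled u i ≤ min n (m + 1) := by
  refine le_min (S.settled_le u i) ?_
  have hsub : (Finset.univ.filter fun v => S.lab (u, i, v) = 1) ⊆
      insert u (Finset.univ.image G.dst) := by
    intro v hv
    simp only [Finset.mem_filter, Finset.mem_univ, true_and] at hv
    have := h.mem_items (x := (u, i, v)) (by omega)
    simpa [FlowGraph.items] using this
  refine (Finset.card_le_card hsub).trans ((Finset.card_insert_le _ _).trans ?_)
  have := Finset.card_image_le (s := (Finset.univ : Finset (Fin m))) (f := G.dst)
  simp at this
  omega

theorem DInv.dist_le_min (h : DInv G S pend) {x : Item n m} (hx : S.lab x ≠ 0) :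
    S.dist x ≤ c * min n (m + 1) :=
  (h.dist_le x hx).trans (Nat.mul_le_mul_left _ (h.settled_le_min _ _))

/-- The effect of an improvement on the invariants and the credits. -/
theorem relax_step (hD : DInv G S pend) (hQ : S.QInv k []) (hlv : S.lv = 0) {u : Fin n}
    {i e : Fin m} (hx : S.lab (u, i, G.src e) = 1) (hxc : S.dist (u, i, G.src e) = S.cur)
    (hcap : G.cap i ≤ G.cap e) {y : Item n m} (hy : y = (u, i, G.dst e)) (hy1 : S.lab y ≠ 1)
    (hyd : S.lab y ≠ 0 → S.cur + G.cost e < S.dist y) {a : ℕ}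
    (ha1 : S.lo k a ≤ S.cur + G.cost e) (ha2 : S.cur + G.cost e < S.up k a)
    (ha : a ≤ k ∨ a = k + 1 + (S.cur + G.cost e) / 2 ^ k ∧ k + 1 + S.hi < a)
    (hH : c * min n (m + 1) / 2 ^ k ≤ H) (T : Search n m)
    (hT : (S.lab y = 0 ∨ a + 2 < S.lab y) ∧ T.lab = Function.update S.lab y (a + 2) ∧
        T.L = Function.update S.L a (y :: S.L a) ∨
      (S.lab y ≠ 0 ∧ S.lab y ≤ a + 2) ∧ T.lab = S.lab ∧ T.L = S.L)
    (hd : T.dist = Function.update S.dist y (S.cur + G.cost e))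
    (hp : T.par = Function.update S.par y (Item.enc (u, i, G.src e) + 1))
    (hR : T.R = S.R) (ho : T.ord = S.ord) (hc : T.cur = S.cur) (hl : T.lv = S.lv)
    (hhi : T.hi = S.hi) (hlive : T.live = S.live + if S.lab y = 0 then 1 else 0) :
    DInv G T (fun z e' => pend z e' ∧ ¬ (z = (u, i, G.src e) ∧ e' = e)) ∧ T.QInv k [] ∧
      (T.lab = S.lab → pot G k (k + 2 + H) H T = pot G k (k + 2 + H) H S) ∧
      (S.lab y = 0 ∨ a + 2 < S.lab y → pot G k (k + 2 + H) H T + 200 * levels k (S.lab y) ≤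
        pot G k (k + 2 + H) H S + 200 + 200 * levels k (a + 2)) := by
  subst hy
  have hQT : T.QInv k [] :=
    hQ.decrease hlv hy1 hyd ⟨ha1, ha2⟩ (ha.imp id And.right) T hT hd hR hc hl hhi
  have hDT : DInv G T (fun z e' => pend z e' ∧ ¬ (z = (u, i, G.src e) ∧ e' = e)) := by
    rcases hT with ⟨h1, h2, h3⟩ | ⟨h1, h2, h3⟩
    · exact hD.relax T u i e (a + 2) hx hxc hcap hy1 hyd (by omega) h2 hd hp ho hc hlive
    · refine hD.relax T u i e (S.lab (u, i, G.dst e)) hx hxc hcap hy1 hyd (by omega) ?_ hd hp ho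
        hc hlive
      rw [h2, Function.update_eq_self]
  have hlp : T.levelPot k = S.levelPot k := by simp [levelPot, hl, hR]
  have hyT : T.lab (u, i, G.dst e) ≠ 0 := by
    rcases hT with ⟨-, h2, -⟩ | ⟨h1, h2, -⟩
    · rw [h2]; simp
    · rw [h2]; exact h1.1
  -- The new distance again satisfies `dist_le_min`, so the number of its interval is at most H, and
  -- the slot is among those counted by `entries`.
  have hA : a < k + 2 + H := by
    rcases ha with ha | ⟨ha, -⟩
    · omega
    · have h1 := hDT.dist_le_min hyT
      rw [hd, Function.update_self] at h1
      have := (Nat.div_le_div_right (c := 2 ^ k) h1).trans hH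
      omega
  refine ⟨hDT, hQT, ?_, ?_⟩
  · intro hlab
    have hL : T.L = S.L := by
      rcases hT with ⟨h1, h2, -⟩ | ⟨-, -, h3⟩
      · have := congrFun (h2.symm.trans hlab) (u, i, G.dst e)
        simp at this
        omega
      · exact h3
    simp only [pot, hlab, hL, hlp, hhi, ho]
  · intro hpush
    rcases hT with ⟨-, h2, h3⟩ | ⟨h1, -, -⟩
    swap
    · omega
    have e1 := entries_update (L := S.L) hA ((u, i, G.dst e) :: S.L a)
    have e2 := itemsPot_update (G := G) (k := k) (lab := S.lab) (hDT.mem_items hyT) (a + 2)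
    simp only [itemPot, hy1, if_false, Function.update_self, show a + 2 ≠ 1 by omega] at e2
    simp only [pot, h2, h3, hlp, hhi, ho]
    simp only [List.length_cons] at e1
    omega

/-- The case of an edge that is not in the layer or brings no improvement: the state stays, and the
edge leaves `pend`. -/
theorem DInv.relaxed (hD : DInv G S pend) {u : Fin n} {i e : Fin m}
    (h : G.cap i ≤ G.cap e → S.lab (u, i, G.dst e) ≠ 0 ∧
      S.dist (u, i, G.dst e) ≤ S.dist (u, i, G.src e) + G.cost e) :
    DInv G S (fun z e' => pend z e' ∧ ¬ (z = (u, i, G.src e) ∧ e' = e)) := by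
  refine hD.weaken _ ?_
  intro u' i' e' h1 h2 h3 h4
  have : (u', i', G.src e') = ((u, i, G.src e) : Item n m) ∧ e' = e := by
    by_contra hc
    exact h3 ⟨h4, hc⟩
  obtain ⟨h5, rfl⟩ := this
  simp only [Prod.mk.injEq, and_true] at h5
  obtain ⟨rfl, rfl⟩ := h5
  exact h h2

end Search

section Specs

open Search

variable {n m c k W T H : ℕ} {G : FlowGraph n m c} {s : RamState} {S : Search n m}
  {pend : Item n m → Fin m → Prop}

/-- The variables that hold the item `(u, i, v)` during the relaxation of its edges. -/
structure RelaxVars (G : FlowGraph n m c) (s : RamState) (d : ℕ) (x : Item n m) : Prop where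
  vx : s.ivar rX = x.enc
  vd : s.ivar rD = d
  vv : s.ivar rV = x.2.2
  vi : s.ivar rI = x.2.1
  vvm : s.ivar rVm = x.2.2 * m
  vf : s.fvar 0 = G.cap x.2.1

theorem discover_spec (h : SearchRep G k s S) (x y : Item n m) (e : Fin m)
    (hV : RelaxVars G s S.cur x) (hxu : x.1 = y.1) (hxi : x.2.1 = y.2.1)
    (hwv : s.ivar rWv = y.2.2) (hP : s.ivar rPX = y.enc) (hE : s.ivar rE = e)
    (hDD : s.ivar rDD = S.cur + G.cost e) (hx : S.lab x ≠ 0) (hy : S.lab y = 0)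
    (hcur : S.cur ≤ c * n) (hhi : S.hi ≤ S.cur) (hlive : S.live ≤ n * n * m)
    (hm : 1 ≤ m) (hW : wordBound n m c k T ≤ W) :
    WP W .discover (fun s' t => t ≤ 15 ∧ Same [rLive, rS1, rLy] s s' ∧
      s'.ivar rLy = G.cost e / 2 ^ k + S.hi + k + 6 ∧
      SearchRep G k s' { S with
        live := S.live + 1
        lab := Function.update S.lab y (G.cost e / 2 ^ k + S.hi + k + 6)
        dist := Function.update S.dist y (S.cur + G.cost e + 1) }) s := by
  unfold wordBound at hW
  have hq := x.quot_lt
  have hw := y.2.2.2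
  have hce := G.cost_le e
  have hdv := Nat.div_le_self (G.cost e) (2 ^ k)
  have hcm : s.iarr aQ x.enc = x.1 * n + x.2.2 := (h.dec x hx).1
  have hxy : x.enc ≠ y.enc := by
    rw [Ne, Item.enc_inj]; rintro rfl; exact hx hy
  have hmm : m ≤ n * n * m := by
    have : 1 ≤ n * n := Nat.mul_pos x.1.pos x.1.pos
    exact Nat.le_mul_of_pos_left m this
  simp only [RamProg.discover, WP.seq_iff, WP.add_iff, WP.sub_iff, WP.write_iff, WP.read_iff,
    WP.const_iff]
  simp [h.live, h.env.one, hP, hwv, hV.vi, hV.vx, hV.vv, hcm, hE, h.env.chi, h.hi, h.env.vk,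
    hDD]
  have e1 : (x.1 : ℕ) * n + x.2.2 + y.2.2 - x.2.2 = y.1 * n + y.2.2 := by rw [hxu]; omega
  refine ⟨by omega, by omega, by omega, by omega, by omega, by omega, by omega, ?_, ?_⟩
  · refine Same.setIA (Same.setI (Same.setIA (Same.setI (Same.setI (Same.setI (Same.setI (Same.setI
      (Same.setIA (Same.setI (Same.setI (Same.setI (Same.setIA (Same.setIA (Same.setI
      (Same.refl _ s) ?_))) ?_) ?_) ?_)) ?_) ?_) ?_) ?_) ?_)) ?_) <;> decide
  · rw [e1, hxi]
    have q1 := (((h.setLive (S.live + 1)).setUnseen y hy aV (y.2.2 : ℕ) (by simp)).setUnseen y hy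
      aI (y.2.1 : ℕ) (by simp))
    have q2 := ((q1.setI (x := rS1) (v := (x.1 : ℕ) * n + x.2.2) (by norm_num)).setI (x := rS1)
      (v := (x.1 : ℕ) * n + x.2.2 + y.2.2) (by norm_num)).setI (x := rS1)
      (v := (y.1 : ℕ) * n + y.2.2) (by norm_num)
    have q3 := q2.setUnseen y hy aQ ((y.1 : ℕ) * n + y.2.2) (by simp)
    have q4 := ((((q3.setI (x := rS1) (v := G.cost e / 2 ^ k) (by norm_num)).setI (x := rLy)
      (v := G.cost e / 2 ^ k + S.hi) (by norm_num)).setI (x := rLy)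
      (v := G.cost e / 2 ^ k + S.hi + k) (by norm_num)).setI (x := rS1) (v := 6)
      (by norm_num)).setI (x := rLy) (v := G.cost e / 2 ^ k + S.hi + k + 6) (by norm_num)
    have q5 := q4.setLab y (G.cost e / 2 ^ k + S.hi + k + 6) (by simp)
    have q6 := (q5.setI (x := rS1) (v := S.cur + G.cost e + 1) (by norm_num)).setDist y
      (S.cur + G.cost e + 1)
    exact q6

end Specs


namespace Search

variable {n m c k : ℕ} {G : FlowGraph n m c} {S : Search n m}
  {pend : Item n m → Fin m → Prop}

/-- The label bounds the slot of the valid entry from above, and R is monotone. This legitimates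
starting the scan at the label. -/
theorem QInv.dist_lt_R (h : S.QInv k []) (hlv : S.lv = 0) {y : Item n m} (hy : 2 ≤ S.lab y)
    (hk : S.lab y - 2 < k) : S.dist y < S.R (S.lab y - 2) := by
  rcases h.entry y hy with hh | ⟨b, _, h1, _, _, h4⟩
  · simp at hh
  · refine h4.trans_le ?_
    unfold up
    split_ifs with h5 h6
    · exact h.R_mono le_rfl (by omega) hk.le
    · exact h.R_mono (by omega) (by omega) hk.le
    · omega

theorem QInv.cur_lt_top (h : S.QInv k []) : S.cur < (S.hi + 1) * 2 ^ k := by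
  rw [← h.top]
  exact h.cur_lt.trans_le (h.R_mono le_rfl h.lv_le le_rfl)

theorem QInv.hi_le_cur {rem : List (Item n m)} (h : S.QInv k rem) : S.hi ≤ S.cur :=
  (Nat.le_mul_of_pos_right _ (by positivity)).trans h.cur_ge

theorem DInv.live_le (h : DInv G S pend) : S.live ≤ n * n * m := by
  rw [h.live_card]
  refine (Finset.card_filter_le _ _).trans ?_
  simp
  exact le_of_eq (by ring)

theorem DInv.dist_le_mul (h : DInv G S pend) {x : Item n m} (hx : S.lab x ≠ 0) :
    S.dist x ≤ c * n :=
  (h.dist_le x hx).trans (Nat.mul_le_mul_left _ (S.settled_le _ _))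

end Search

section Specs

open Search

variable {n m c k W T H : ℕ} {G : FlowGraph n m c} {s : RamState} {S : Search n m}
  {pend : Item n m → Fin m → Prop}

theorem RelaxVars.same {V : List ℕ} {s' : RamState} {d : ℕ} {x : Item n m}
    (h : RelaxVars G s d x) (hs : Same V s s') (hV : ∀ r ∈ V, r ∉ [rX, rD, rV, rI, rVm]) :
    RelaxVars G s' d x := by
  have key : ∀ r ∈ [rX, rD, rV, rI, rVm], s'.ivar r = s.ivar r :=
    fun r hr => hs.1 r fun hr' => hV r hr' hr
  exact ⟨by rw [key _ (by decide)]; exact h.vx, by rw [key _ (by decide)]; exact h.vd,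
    by rw [key _ (by decide)]; exact h.vv, by rw [key _ (by decide)]; exact h.vi,
    by rw [key _ (by decide)]; exact h.vvm, by rw [hs.2]; exact h.vf⟩

/-- The outcome of relaxing an edge from the item `x`. -/
structure Relaxed (G : FlowGraph n m c) (k H : ℕ) (pend : Item n m → Fin m → Prop)
    (x : Item n m) (S : Search n m) (s s' : RamState) (t C : ℕ) (S' : Search n m) : Prop where
  rep : SearchRep G k s' S'
  dinv : DInv G S' pend
  qinv : S'.QInv k []
  cur : S'.cur = S.cur
  lv : S'.lv = 0
  lab : S'.lab x = 1
  dist : S'.dist x = S'.cur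
  vars : RelaxVars G s' S.cur x
  time : t + s'.ivar rCnt + pot G k (k + 2 + H) H S' ≤
    s.ivar rCnt + pot G k (k + 2 + H) H S + C

theorem relaxEdge_spec (h : SearchRep G k s S) (hD : DInv G S pend) (hQ : S.QInv k [])
    (hlv : S.lv = 0) {u : Fin n} {i e : Fin m} (hx : S.lab (u, i, G.src e) = 1)
    (hxc : S.dist (u, i, G.src e) = S.cur) (hV : RelaxVars G s S.cur (u, i, G.src e))
    (hE : s.ivar rE = e + 1) (hm : 1 ≤ m) (hW : wordBound n m c k T ≤ W)
    (hH : c * min n (m + 1) / 2 ^ k ≤ H) (hcnt : s.ivar rCnt ≤ T)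
    (pend' : Item n m → Fin m → Prop)
    (hpend : pend' = fun z e' => pend z e' ∧ ¬ (z = (u, i, G.src e) ∧ e' = e)) :
    WP W .relaxEdge (fun s' t => s'.ivar rE = s'.iarr aNxt e ∧ ∃ S',
      Relaxed G k H pend' (u, i, G.src e) S s s' t 400 S') s := by
  have hcur : S.cur ≤ c * n := by rw [← hxc]; exact hD.dist_le_mul (by omega)
  have hhi := hQ.hi_le_cur
  have hlive := hD.live_le
  have hp : 0 < 2 ^ k := by positivity
  have hDR : (G.cap i ≤ G.cap e → S.lab (u, i, G.dst e) ≠ 0 ∧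
      S.dist (u, i, G.dst e) ≤ S.dist (u, i, G.src e) + G.cost e) → DInv G S pend' := by
    rw [hpend]; exact hD.relaxed
  set x : Item n m := (u, i, G.src e) with hxdef
  set y : Item n m := (u, i, G.dst e) with hydef
  suffices key : WP W
      (.fifLt 1 0 .skip
        (.read rWv aDst rE ;; .read rS1 aVm rWv ;; .add rPX rX rS1 ;; .sub rPX rPX rVm ;;
         .read rDD aCost rE ;; .add rDD rD rDD ;; .read rLy aLab rPX ;;
         .ifLt rZ rLy .skip .discover ;;
         .ifLt rOne rLy (.read rS1 aDist rPX ;; .ifLt rDD rS1 .improve .skip) .skip))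
      (fun s' t => s'.ivar rE = e ∧ ∃ S',
        Relaxed G k H pend' x S s s' t 390 S')
      ((s.setI rE e).setF 1 (G.cap e)) by
    simp only [RamProg.relaxEdge, WP.seq_iff, WP.sub_iff, WP.fread_iff, WP.read_iff]
    simp only [hE, h.env.one, RamState.farr_setI, RamState.ivar_setI, if_true,
      Nat.add_sub_cancel, h.env.cap]
    refine key.mono ?_
    rintro s' t ⟨he, S', hS'⟩
    refine ⟨by simp [he], S', ?_⟩
    exact
      { hS' with
        rep := hS'.rep.setI (by norm_num)
        vars := hS'.vars.same ((Same.refl [rE] s').setI (by simp)) (by simp)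
        time := by have := hS'.time; simp; omega }
  set s₁ := (s.setI rE e).setF 1 (G.cap e) with hs₁
  have h₁ : SearchRep G k s₁ S := (h.setI (by norm_num)).setF
  have hV₁ : RelaxVars G s₁ S.cur x :=
    ⟨by simpa [hs₁] using hV.vx, by simpa [hs₁] using hV.vd, by simpa [hs₁] using hV.vv,
      by simpa [hs₁] using hV.vi, by simpa [hs₁] using hV.vvm, by simpa [hs₁] using hV.vf⟩
  have hc₁ : s₁.ivar rCnt = s.ivar rCnt := by simp [hs₁]
  have hE₁ : s₁.ivar rE = e := by simp [hs₁]
  rw [WP.fifLt_iff]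
  constructor
  · intro hlt
    rw [WP.skip_iff]
    refine ⟨hE₁, S, h₁, ?_, hQ, rfl, hlv, hx, hxc, hV₁, by rw [hc₁]; omega⟩
    refine hDR fun hle => ?_
    rw [hV₁.vf] at hlt
    simp only [hs₁, RamState.fvar_setF, if_true] at hlt
    exact absurd (WithTop.coe_lt_coe.1 hlt) (not_lt.2 hle)
  intro hcap
  rw [hV₁.vf] at hcap
  simp only [hs₁, RamState.fvar_setF, if_true] at hcap
  have hcap : G.cap i ≤ G.cap e := not_lt.1 fun hlt => hcap (WithTop.coe_lt_coe.2 hlt)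
  -- In the code (u n + v) m + i the vertex is exchanged by means of the tabulated multiples of m,
  -- because the machine cannot multiply.
  have hye : x.enc + G.dst e * m - G.src e * m = y.enc := by
    simp only [hxdef, hydef, Item.enc, Nat.add_mul]
    omega
  have hxe := x.enc_add_lt
  have hce := G.cost_le e
  have hdm : (G.dst e : ℕ) * m ≤ n * m := Nat.mul_le_mul_right _ (G.dst e).2.le
  have hWB := hW
  unfold wordBound at hWB
  simp only [WP.seq_iff, WP.read_iff, WP.add_iff, WP.sub_iff]
  simp only [hE₁, h₁.env.dst, hV₁.vx, hV₁.vvm, hV₁.vd,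
    RamState.ivar_setI, RamState.iarr_setI]
  norm_num
  have hvm := h₁.env.vm (G.dst e)
  have hco := h₁.env.cost e
  simp only [hvm, hco, show (x.2.2 : ℕ) = G.src e from rfl, hye, h₁.lab]
  refine ⟨by omega, by omega, ?_⟩
  set s₂ := ((((((s₁.setI rWv (G.dst e)).setI rS1 (G.dst e * m)).setI rPX
    (x.enc + G.dst e * m)).setI rPX y.enc).setI rDD (G.cost e)).setI rDD
    (S.cur + G.cost e)).setI rLy (S.lab y) with hs₂
  have h₂ : SearchRep G k s₂ S := ((((((h₁.setI (by norm_num)).setI (by norm_num)).setI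
    (by norm_num)).setI (by norm_num)).setI (by norm_num)).setI (by norm_num)).setI (by norm_num)
  have hV₂ : RelaxVars G s₂ S.cur x :=
    ⟨by simpa [hs₂] using hV₁.vx, by simpa [hs₂] using hV₁.vd, by simpa [hs₂] using hV₁.vv,
      by simpa [hs₂] using hV₁.vi, by simpa [hs₂] using hV₁.vvm, by simpa [hs₂] using hV₁.vf⟩
  have hc₂ : s₂.ivar rCnt = s.ivar rCnt := by simp [hs₂, hc₁]
  have hE₂ : s₂.ivar rE = e := by simp [hs₂, hE₁]
  have hz₂ := h₂.env.z
  have hWv₂ : s₂.ivar rWv = G.dst e := by simp [hs₂]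
  have hPX₂ : s₂.ivar rPX = y.enc := by simp [hs₂]
  have hDD₂ : s₂.ivar rDD = S.cur + G.cost e := by simp [hs₂]
  have hLy₂ : s₂.ivar rLy = S.lab y := by simp [hs₂]
  clear_value s₂ s₁
  have hcurd : S.cur / 2 ^ k = S.hi := Nat.div_eq_of_lt_le hQ.cur_ge hQ.cur_lt_top
  -- The 1 is the carry; the provisional label of a new item has to clear this bound.
  have hdiv : (S.cur + G.cost e) / 2 ^ k ≤ S.hi + G.cost e / 2 ^ k + 1 := by
    rw [Nat.add_div hp, hcurd]; split_ifs <;> omega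
  constructor
  · intro hlab
    rw [h₁.env.z] at hlab
    simp only [h₁.env.one, h₁.dist, hE₁]
    constructor
    · intro hlab2
      constructor
      · intro hlt
        refine (improve_spec (T := T) (h₂.setI (x := rS1) (v := S.dist y) (by norm_num)) hQ.top hQ.cur_ge
          hQ.cur_lt_top hlv x y e (by simpa using hV₂.vx) (by simpa using hPX₂)
          (by simpa using hE₂) (by simpa using hV₂.vd) (by simpa using hDD₂)
          (by simpa using hLy₂) hlab2 ?_ hcur hW (by simpa [hc₂] using hcnt)).mono ?_
        · intro hk
          exact hlt.trans (hQ.dist_lt_R hlv hlab2 hk)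
        · rintro s₃ t₃ ⟨a, a1, a2, a3, a4, a5, a6⟩
          have a5' : Same [rS1, rS2, rS3, rPA, rT, rB, rCnt] s₂ s₃ :=
            ((Same.refl _ s₂).setI (by decide)).trans a5
          refine ⟨by rw [a5'.1 _ (by decide), hE₂], ?_⟩
          have hlev : levels k (S.lab y) = min (S.lab y - 2) (k + 1) := by
            simp [levels, hlab.ne']
          have hleva : levels k (a + 2) = min a (k + 1) := by simp [levels]
          have hxy : x ≠ y := by rintro hh; rw [hh] at hx; omega
          rcases a6 with ⟨b1, b2, b3⟩ | ⟨b1, b2, b3⟩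
          · obtain ⟨g1, g2, -, g4⟩ := relax_step hD hQ hlv hx hxc hcap hydef (by omega)
              (fun _ => hlt) a1 a2 a3 hH { S with
                dist := Function.update S.dist y (S.cur + G.cost e)
                par := Function.update S.par y (x.enc + 1)
                lab := Function.update S.lab y (a + 2)
                L := Function.update S.L a (y :: S.L a) } (Or.inl ⟨Or.inr b1, rfl, rfl⟩) rfl rfl rfl rfl rfl rfl rfl
              (by simp [hlab.ne'])
            refine ⟨_, b3, by rw [hpend]; exact g1, g2, rfl, hlv, ?_, ?_, hV₂.same a5' (by decide), ?_⟩
            · simp [Function.update_of_ne hxy, hx]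
            · simp [Function.update_of_ne hxy, hxc]
            · have := g4 (Or.inr b1)
              simp only [RamState.ivar_setI] at b2
              norm_num at b2
              rw [b2, hc₂]
              omega
          · obtain ⟨g1, g2, g3, -⟩ := relax_step hD hQ hlv hx hxc hcap hydef (by omega)
              (fun _ => hlt) a1 a2 a3 hH { S with
                dist := Function.update S.dist y (S.cur + G.cost e)
                par := Function.update S.par y (x.enc + 1) } (Or.inr ⟨⟨hlab.ne', b1⟩, rfl, rfl⟩) rfl rfl rfl rfl rfl rfl rfl
              (by simp [hlab.ne'])
            refine ⟨_, b3, by rw [hpend]; exact g1, g2, rfl, hlv, ?_, ?_, hV₂.same a5' (by decide), ?_⟩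
            · simp [hx]
            · simp [Function.update_of_ne hxy, hxc]
            · have := g3 rfl
              simp only [RamState.ivar_setI] at b2
              norm_num at b2
              rw [b2, hc₂, this]
              omega
      · intro hlt
        refine ⟨trivial, S, h₂.setI (by norm_num), hDR fun _ => ⟨hlab.ne', ?_⟩, hQ, rfl, hlv, hx, hxc,
          hV₂.same ((Same.refl [rS1] s₂).setI (by simp)) (by simp), ?_⟩
        · rw [hxc]; exact hlt
        · simp [hc₂]; omega
    · intro hlab2
      have hy1 : S.lab y = 1 := by omega
      refine ⟨trivial, S, h₂, hDR fun _ => ⟨hlab.ne', ?_⟩, hQ, rfl, hlv, hx, hxc, hV₂, ?_⟩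
      · rw [hxc]; exact (hD.done_le y hy1).trans (Nat.le_add_right _ _)
      · rw [hc₂]; omega
  · intro hlab
    rw [h₁.env.z] at hlab
    have hlab0 : S.lab y = 0 := by omega
    refine (discover_spec (T := T) h₂ x y e hV₂ rfl rfl hWv₂ hPX₂ hE₂ hDD₂ (by omega) hlab0 hcur hhi
      hlive hm hW).mono ?_
    rintro s₃ t₃ ⟨ht₃, hs₃, hLy₃, h₃⟩
    generalize hqe : G.cost e / 2 ^ k = qe at hdiv hLy₃ h₃
    set l := qe + S.hi + k + 6 with hl
    have hcnt₃ : s₃.ivar rCnt = s.ivar rCnt := by rw [hs₃.1 _ (by decide), hc₂]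
    simp only [h₃.env.one, hLy₃]
    have hPX₃ : s₃.ivar rPX = y.enc := by rw [hs₃.1 _ (by decide), hPX₂]
    have hDD₃ : s₃.ivar rDD = S.cur + G.cost e := by rw [hs₃.1 _ (by decide), hDD₂]
    have hV₃ : RelaxVars G s₃ S.cur x := hV₂.same hs₃ (by decide)
    have hE₃ : s₃.ivar rE = e := by rw [hs₃.1 _ (by decide), hE₂]
    simp only [hPX₃, h₃.dist]
    norm_num
    refine ⟨fun _ => ⟨fun _ => ?_, fun hh => ?_⟩, fun hh => by omega⟩
    swap
    · rw [hDD₃] at hh; omega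
    refine (improve_spec (T := T) (h₃.setI (x := rS1) (v := S.cur + G.cost e + 1) (by norm_num)) hQ.top
      hQ.cur_ge hQ.cur_lt_top hlv x y e (by simpa using hV₃.vx) (by simpa using hPX₃)
      (by simpa using hE₃) (by simpa using hV₃.vd) (by simpa using hDD₃)
      (by simpa using hLy₃) (by simp; omega) ?_ hcur hW (by simpa [hcnt₃] using hcnt)).mono ?_
    · simp only [Function.update_self]
      intro hk
      omega
    · rintro s₄ t₄ ⟨a, a1, a2, a3, a4, a5, a6⟩
      simp only [Function.update_self, Function.update_idem] at a4 a6
      have a5' : Same [rS1, rS2, rS3, rPA, rT, rB, rCnt] s₃ s₄ :=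
        ((Same.refl _ s₃).setI (by decide)).trans a5
      refine ⟨by rw [a5'.1 _ (by decide), hE₃], ?_⟩
      have hlev : levels k (S.lab y) = k + 1 := by simp [levels, hlab0]
      have hleva : levels k (a + 2) = min a (k + 1) := by simp [levels]
      have hxy : x ≠ y := by rintro hh; rw [hh] at hx; omega
      rcases a6 with ⟨b1, b2, b3⟩ | ⟨b1, b2, b3⟩
      · obtain ⟨g1, g2, -, g4⟩ := relax_step hD hQ hlv hx hxc hcap hydef (by omega)
          (fun hh => absurd hlab0 hh) a1 a2 a3 hH { S with
            live := S.live + 1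
            dist := Function.update S.dist y (S.cur + G.cost e)
            par := Function.update S.par y (x.enc + 1)
            lab := Function.update S.lab y (a + 2)
            L := Function.update S.L a (y :: S.L a) } (Or.inl ⟨Or.inl hlab0, rfl, rfl⟩) rfl rfl rfl rfl rfl
          rfl rfl (by simp [hlab0])
        refine ⟨_, b3, by rw [hpend]; exact g1, g2, rfl, hlv, ?_, ?_, hV₃.same a5' (by decide), ?_⟩
        · simp [Function.update_of_ne hxy, hx]
        · simp [Function.update_of_ne hxy, hxc]
        · have := g4 (Or.inl hlab0)
          simp only [RamState.ivar_setI] at b2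
          norm_num at b2
          rw [b2, hcnt₃]
          omega
      -- The slot a is at most k + 1 + (hi + qe + 1), so a + 2 stays below the provisional label qe
      -- + hi + k + 6, and a push is certain.
      · exfalso
        rcases a3 with a3 | ⟨a3, -⟩
        · omega
        · change a = k + 1 + (S.cur + G.cost e) / 2 ^ k at a3
          generalize (S.cur + G.cost e) / 2 ^ k = qd at a3 hdiv
          omega

end Specs


theorem IsAdj.next {m : ℕ} {nxt : ℕ → ℕ} {h : ℕ} {l r : List (Fin m)} {e : Fin m}
    (ha : IsAdj nxt h (l ++ e :: r)) : IsAdj nxt (nxt e) r := by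
  induction l generalizing h with
  | nil => exact ha.2
  | cons b l ih => exact ih ha.2

/-! ### Settling an item -/

section Specs

open Search

variable {n m c k W T H : ℕ} {G : FlowGraph n m c} {s : RamState} {S : Search n m}

/-- The state of the search between two steps. -/
structure Ready (G : FlowGraph n m c) (k : ℕ) (s : RamState) (S : Search n m) : Prop where
  rep : SearchRep G k s S
  dinv : DInv G S fun _ _ => False
  qinv : S.QInv k []

/-- Settling releases at least 600 · (1 + outdegree) credits: 401 for each pass of the edge loop,
and the remaining 600 for the fixed overhead and the 100 credits attached to the new element of
`ord`. -/
theorem settle_spec (h : SearchRep G k s S) (hD : DInv G S fun _ _ => False)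
    {x : Item n m} (hX : s.ivar rX = x.enc) (hx : 2 ≤ S.lab x) (hxc : S.dist x = S.cur)
    (hQ : QInv { S with
      lab := Function.update S.lab x 1
      live := S.live - 1
      ord := S.ord ++ [x] } k [])
    (hlv : S.lv = 0) (hm : 1 ≤ m) (hW : wordBound n m c k T ≤ W)
    (hH : c * min n (m + 1) / 2 ^ k ≤ H)
    (hT : s.ivar rCnt + pot G k (k + 2 + H) H S ≤ T) :
    WP W .settle (fun s' t => ∃ S', Ready G k s' S' ∧
      t + s'.ivar rCnt + pot G k (k + 2 + H) H S' ≤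
        s.ivar rCnt + pot G k (k + 2 + H) H S) s := by
  set S₁ : Search n m := { S with
      lab := Function.update S.lab x 1
      live := S.live - 1
      ord := S.ord ++ [x] } with hS₁
  have hd := h.dec x (by omega)
  have hpot : pot G k (k + 2 + H) H S₁ + 600 * (1 + (G.out x.2.2).length) ≤
      pot G k (k + 2 + H) H S + 100 := by
    have := itemsPot_update (G := G) (k := k) (lab := S.lab) (hD.mem_items (x := x) (by omega)) 1
    simp only [itemPot, Function.update_self, if_true, show S.lab x ≠ 1 by omega, if_false] at this
    have hlp : S₁.levelPot k = S.levelPot k := rfl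
    simp only [pot, hlp]
    simp only [hS₁, List.length_append, List.length_singleton]
    omega
  have hord : S.ord.length + 1 ≤ T := by
    have : 100 * (S.ord.length + 1) ≤ pot G k (k + 2 + H) H S₁ := by
      simp only [pot, hS₁, List.length_append, List.length_singleton]; omega
    omega
  have hDS : DInv G S₁ (fun y e => y = x ∧ e ∈ G.out x.2.2) := by
    refine (hD.settle S₁ x hx hxc rfl rfl rfl rfl rfl rfl).weaken _ ?_
    intro u i e h1 h2 h3 h4
    rcases h4 with h4 | h4
    · exact absurd ⟨h4, by rw [← h4]; simp⟩ h3
    · exact h4.elim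
  have hWB := hW
  unfold wordBound at hWB
  unfold RamProg.settle
  simp only [WP.seq_iff, WP.write_iff, WP.sub_iff, WP.add_iff, WP.read_iff, WP.fread_iff]
  simp only [RamState.ivar_setIA, RamState.ivar_setI, hX, h.env.one, h.live, h.oc]
  norm_num
  refine ⟨by omega, ?_⟩
  simp only [h.dist, hd.2.2, hd.2.1, h.env.cap, h.env.vm]
  have h₁ : SearchRep G k (((((((((s.setIA aLab x.enc 1).setI rLive (S.live - 1)).setIA aOrd
      S.ord.length x.enc).setI rOc (S.ord.length + 1)).setI rD (S.dist x)).setI rV x.2.2).setI rI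
      x.2.1).setF 0 (G.cap x.2.1)).setI rVm (x.2.2 * m)) S₁ :=
    (((((((h.setLab x 1 hd).setLive (S.live - 1)).snoc x).setI (by norm_num)).setI
      (by norm_num)).setI (by norm_num)).setF).setI (by norm_num)
  have h₂ := h₁.setI (x := rE) (v := s.iarr aFst x.2.2) (by norm_num)
  refine WP.whileLt (fun s' t => ∃ S' pre rest, G.out x.2.2 = pre ++ rest ∧
      IsAdj (s'.iarr aNxt) (s'.ivar rE) rest ∧ SearchRep G k s' S' ∧
      DInv G S' (fun y e => y = x ∧ e ∈ rest) ∧ S'.QInv k [] ∧ S'.lv = 0 ∧ S'.lab x = 1 ∧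
      S'.dist x = S'.cur ∧ RelaxVars G s' S'.cur x ∧
      t + s'.ivar rCnt + pot G k (k + 2 + H) H S' + 401 * rest.length ≤
        s.ivar rCnt + pot G k (k + 2 + H) H S₁ + 401 * (G.out x.2.2).length)
    (s.ivar rCnt + pot G k (k + 2 + H) H S₁ + 401 * (G.out x.2.2).length) ?_ ?_ ?_ ?_
  · refine ⟨S₁, [], G.out x.2.2, rfl, ?_, h₂, hDS, hQ, hlv, by simp [hS₁], hxc, ?_, ?_⟩
    · simpa using h.env.adj x.2.2
    · constructor <;> simp [hX, hS₁, hxc]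
    · simp
  · rintro s' t ⟨S', pre, rest, -, -, -, -, -, -, -, -, -, ht⟩
    omega
  · rintro s' t ⟨S', pre, rest, hout, hadj, hr, hD', hQ', hlv', hl', hd', hV', ht⟩ hlt
    rw [hr.env.z] at hlt
    cases rest with
    | nil => exact absurd hadj (by simp only [IsAdj]; omega)
    | cons e rest =>
      have hev : G.src e = x.2.2 := by
        rw [← FlowGraph.mem_out, hout]; simp
      obtain ⟨u, i, v⟩ := x
      simp only at hev hout hpot ht
      subst hev
      simp only [List.length_cons] at ht
      refine (relaxEdge_spec (T := T) hr hD' hQ' hlv' hl' hd' hV' hadj.1 hm hW hH (by omega) _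
        rfl).mono ?_
      rintro s₃ t₃ ⟨he, S₃, hS₃⟩
      have h3t := hS₃.time
      refine ⟨S₃, pre ++ [e], rest, by simpa using hout, ?_, hS₃.rep, hS₃.dinv.weaken _ ?_,
        hS₃.qinv, hS₃.lv, hS₃.lab, hS₃.dist, by rw [hS₃.cur]; exact hS₃.vars, by simp only; omega⟩
      · rw [he]
        have := hS₃.rep.env.adj (G.src e)
        rw [hout] at this
        exact this.next
      · intro u' i' e' h1 h2 h3 h4
        obtain ⟨⟨h5, h6⟩, h7⟩ := h4
        refine absurd ⟨h5, ?_⟩ h3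
        exact (List.mem_cons.1 h6).resolve_left fun hh => h7 ⟨h5, hh⟩
  · rintro s' t ⟨S', pre, rest, hout, hadj, hr, hD', hQ', hlv', hl', hd', hV', ht⟩ hlt
    rw [hr.env.z] at hlt
    cases rest with
    | cons e rest => exact absurd hadj.1 (by omega)
    | nil =>
      refine ⟨S', ⟨hr, hD'.weaken _ ?_, hQ'⟩, ?_⟩
      · intro u' i' e' h1 h2 h3 h4
        simp at h4
      · simp only [List.length_nil] at ht
        omega

theorem leaf_spec (h : Ready G k s S) (hlv : S.lv = 0) (h0 : S.L 0 ≠ [])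
    (hh : s.ivar rH = s.iarr aHd 0)
    (hm : 1 ≤ m) (hW : wordBound n m c k T ≤ W)
    (hH : c * min n (m + 1) / 2 ^ k ≤ H)
    (hT : s.ivar rCnt + pot G k (k + 2 + H) H S ≤ T) :
    WP W .leaf (fun s' t => ∃ S', Ready G k s' S' ∧
      t + 100 + s'.ivar rCnt + pot G k (k + 2 + H) H S' ≤
        s.ivar rCnt + pot G k (k + 2 + H) H S) s := by
  obtain ⟨hr, hD, hQ⟩ := h
  obtain ⟨x, r, hxr⟩ := List.exists_cons_of_ne_nil h0
  have hl := hr.list 0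
  rw [hxr, List.map_cons] at hl
  obtain ⟨l1, l2, l3, l4⟩ := hl
  set S₁ : Search n m := { S with L := Function.update S.L 0 r } with hS₁
  have hpot : pot G k (k + 2 + H) H S₁ + 200 = pot G k (k + 2 + H) H S := by
    have := entries_update (A := k + 2 + H) (L := S.L) (a := 0) (by omega) r
    rw [hxr, List.length_cons] at this
    have hlp : S₁.levelPot k = S.levelPot k := rfl
    simp only [pot, hlp]
    simp only [hS₁]
    omega
  have hlx := (hQ.mem 0 x (by rw [hxr]; simp)).1
  have hD₁ : DInv G S₁ fun _ _ => False :=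
    hD.relabel S₁ (fun _ => Iff.rfl) (fun _ => Iff.rfl) rfl rfl rfl rfl le_rfl hD.live_ge
  unfold RamProg.leaf
  simp only [WP.seq_iff, WP.write_iff, WP.read_iff, WP.ifLt_iff, WP.skip_iff]
  simp [hh, l3, hr.env.one, hr.env.z, hr.lab]
  have h₁ : SearchRep G k (((s.setI rX x.enc).setI rH (s.iarr aNx (s.iarr aHd 0))).setIA aHd 0
      (s.iarr aNx (s.iarr aHd 0))) S₁ :=
    ((hr.setI (by norm_num)).setI (by norm_num)).setHd 0 _ r (by simpa using l4)
  have h₂ := h₁.setI (x := rLy) (v := S.lab x) (by norm_num)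
  constructor
  · intro hlt
    have hup := (hQ.mem 0 x (by rw [hxr]; simp)).2 hlt
    -- At level 0 the interval contains the single key cur, so a live item found in slot 0 has the
    -- least distance of all live items.
    have hnode : S.R 0 = S.cur + 1 := by
      rcases hQ.node with hn | hn
      · simpa [hlv] using hn
      · exact absurd hn.1 h0
    simp only [up, if_true, hlv, hnode] at hup
    refine (settle_spec (T := T) h₂ hD₁ (x := x) (by simp) hlt
      (le_antisymm (by show S.dist x ≤ S.cur; omega) (hD.live_ge x hlt))
      (hQ.popDone hlv hxr _ rfl (by simp) (fun y hy => by simp [hy, hS₁]) rfl rfl rfl rfl rfl)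
      hlv hm hW hH ?_).mono ?_
    · simp; omega
    · rintro s' t ⟨S', hS', ht⟩
      simp at ht
      exact ⟨S', hS', by omega⟩
  · intro hle
    refine ⟨S₁, ⟨h₂, hD₁, hQ.popDone hlv hxr S₁ rfl (by show S.lab x = 1; omega)
      (fun _ _ => rfl) rfl rfl rfl rfl rfl⟩, by omega⟩

end Specs


/-! ### Splitting, ascending and passing to the next interval -/

section Specs

open Search

variable {n m c k W T H : ℕ} {G : FlowGraph n m c} {s : RamState} {S : Search n m}

theorem splitStep_spec {rem : List (Item n m)} {x : Item n m} (hr : SearchRep G k s S)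
    (hD : DInv G S fun _ _ => False) (hQ : S.QInv k (x :: rem))
    (hl : IsList (s.iarr aVal) (s.iarr aNx) (s.ivar rCnt) (s.ivar rH)
      ((x :: rem).map Item.enc))
    (h2 : s.ivar rS2 = S.lv + 3) (h3 : s.ivar rS3 = S.lv + 1) (hd : s.ivar rD = S.R S.lv)
    (hW : wordBound n m c k T ≤ W) (hcnt : s.ivar rCnt ≤ T) :
    WP W .splitStep (fun s' t => ∃ S', SearchRep G k s' S' ∧
      DInv G S' (fun _ _ => False) ∧ S'.QInv k rem ∧
      IsList (s'.iarr aVal) (s'.iarr aNx) (s'.ivar rCnt) (s'.ivar rH) (rem.map Item.enc) ∧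
      s'.ivar rS2 = S'.lv + 3 ∧ s'.ivar rS3 = S'.lv + 1 ∧ s'.ivar rD = S'.R S'.lv ∧
      t + s'.ivar rCnt + pot G k (k + 2 + H) H S' ≤
        s.ivar rCnt + pot G k (k + 2 + H) H S + 15) s := by
  rw [List.map_cons] at hl
  obtain ⟨l1, l2, l3, l4⟩ := hl
  obtain ⟨g1, g2, g3⟩ := hQ.mem_rem x (by simp)
  unfold wordBound at hW
  simp only [RamProg.splitStep, WP.seq_iff, WP.write_iff, WP.read_iff, WP.ifLt_iff, WP.skip_iff,
    WP.copy_iff]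
  simp [l3, hr.lab, h2, hr.dist, hd, hr.env.z, h3]
  have h₁ := ((hr.setI (x := rPX) (v := x.enc) (by norm_num)).setI (x := rH)
    (v := s.iarr aNx (s.ivar rH)) (by norm_num)).setI (x := rLy) (v := S.lab x) (by norm_num)
  constructor
  · intro hlt
    have h₂ := (h₁.setLab x (S.lv + 3) (hr.dec x g2)).setI (x := rS1) (v := S.dist x) (by norm_num)
    have hcx := hD.live_ge x (by omega)
    have key : ∀ a, (S.dist x < S.R S.lv ∧ a = 0 ∨ S.R S.lv ≤ S.dist x ∧ a = S.lv + 1) →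
        ∀ s₁ : RamState, s₁ = ((((((s.setI 20 x.enc).setI 30 (s.iarr 23 (s.ivar 30))).setI 26
          (S.lab x)).setIA 15 x.enc (S.lv + 3)).setI 27 (S.dist x)).setI 21 a) →
        WP W RamProg.push (fun s' t => ∃ S', SearchRep G k s' S' ∧
          DInv G S' (fun _ _ => False) ∧ S'.QInv k rem ∧
          IsList (s'.iarr aVal) (s'.iarr aNx) (s'.ivar rCnt) (s'.ivar rH) (rem.map Item.enc) ∧
          s'.ivar rS2 = S'.lv + 3 ∧ s'.ivar rS3 = S'.lv + 1 ∧ s'.ivar rD = S'.R S'.lv ∧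
          t + 8 + s'.ivar rCnt + pot G k (k + 2 + H) H S' ≤
            s.ivar rCnt + pot G k (k + 2 + H) H S + 15) s₁ := by
      rintro a ha s₁ rfl
      have h₃ := h₂.setI (x := rPA) (v := a) (by norm_num)
      refine (push_spec h₃ (x := x) (a := a) (by simp) (by simp) (by simp; omega)).mono ?_
      rintro s' t ⟨rfl, hr', hc', hs', hls'⟩
      refine ⟨_, hr', ?_, hQ.splitMove hlt hcx ha, ?_, ?_, ?_, ?_, ?_⟩
      · refine hD.relabel _ ?_ ?_ rfl rfl rfl rfl le_rfl hD.live_ge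
        · intro y
          by_cases hy : y = x
          · subst hy; simp; omega
          · simp [hy]
        · intro y
          by_cases hy : y = x
          · subst hy; simp; omega
          · simp [hy]
      · rw [hs'.1 rH (by decide)]
        exact hls' _ _ (by simpa using l4)
      · rw [hs'.1 _ (by decide)]; simpa using h2
      · rw [hs'.1 _ (by decide)]; simpa using h3
      · rw [hs'.1 _ (by decide)]; simpa using hd
      · have e1 := entries_update (A := k + 2 + H) (L := S.L) (a := a) (by omega) (x :: S.L a)
        have e2 := itemsPot_update (G := G) (k := k) (lab := S.lab) (hD.mem_items g2) (S.lv + 3)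
        simp only [itemPot, Function.update_self, show S.lab x ≠ 1 by omega, if_false,
          show S.lv + 3 ≠ 1 by omega] at e2
        -- The item descends at least one level, because lv < k and its label was at least lv + 4.
        -- The 200 credits of that level pay for the new entry.
        have e3 : levels k (S.lv + 3) + 1 ≤ levels k (S.lab x) := by
          unfold levels; rw [if_neg (by omega), if_neg (by omega)]; omega
        simp only [List.length_cons] at e1
        rw [hc']
        simp only [pot, levelPot, RamState.ivar_setI, RamState.ivar_setIA]
        norm_num
        omega
    constructor
    · intro hlt2
      refine (key 0 (Or.inl ⟨hlt2, rfl⟩) _ rfl).mono ?_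
      rintro s' t ⟨S', a1, a2, a3, a4, a5, a6, a7, a8⟩
      exact ⟨S', a1, a2, a3, a4, a5, a6, a7, by omega⟩
    · intro hlt2
      refine (key (S.lv + 1) (Or.inr ⟨hlt2, rfl⟩) _ rfl).mono ?_
      rintro s' t ⟨S', a1, a2, a3, a4, a5, a6, a7, a8⟩
      exact ⟨S', a1, a2, a3, a4, a5, a6, a7, by omega⟩
  · intro hle
    exact ⟨S, h₁, hD, hQ.splitDrop hle, by simpa using l4, rfl, rfl, by omega⟩

theorem split_spec (h : Ready G k s S) (hlv : 0 < S.lv) (h0 : S.L 0 ≠ [])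
    (hh : s.ivar rH = s.iarr aHd 0) (hcur : S.cur ≤ c * n)
    (hW : wordBound n m c k T ≤ W)
    (hT : s.ivar rCnt + pot G k (k + 2 + H) H S ≤ T) :
    WP W .split (fun s' t => ∃ S', Ready G k s' S' ∧
      t + 10 + s'.ivar rCnt + pot G k (k + 2 + H) H S' ≤
        s.ivar rCnt + pot G k (k + 2 + H) H S) s := by
  obtain ⟨hr, hD, hQ⟩ := h
  obtain ⟨l, hl⟩ : ∃ l, S.lv = l + 1 := ⟨S.lv - 1, by omega⟩
  have hQ₁ := hQ.splitStart h0 hl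
  set S₁ : Search n m := { S with
      lv := l
      R := Function.update S.R l (S.cur + 2 ^ l)
      L := Function.update S.L 0 [] } with hS₁
  have hD₁ : DInv G S₁ fun _ _ => False :=
    hD.relabel S₁ (fun _ => Iff.rfl) (fun _ => Iff.rfl) rfl rfl rfl rfl le_rfl hD.live_ge
  have hlen : 0 < (S.L 0).length := List.length_pos_of_ne_nil h0
  have hlk := hQ.lv_le
  have hpot : pot G k (k + 2 + H) H S₁ + 200 * (S.L 0).length ≤
      pot G k (k + 2 + H) H S + 60 := by
    have := entries_update (A := k + 2 + H) (L := S.L) (a := 0) (by omega) []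
    -- Two units for the lower level and one for the new right half: 60 credits, which one removed
    -- entry of the nonempty slot 0 covers.
    have hlp : S₁.levelPot k ≤ S.levelPot k + 3 := by
      unfold levelPot
      simp only [hS₁, hl]
      split_ifs <;> omega
    simp only [List.length_nil] at this
    simp only [pot]
    simp only [hS₁] at hlp ⊢
    omega
  have hpw : (2 : ℕ) ^ l ≤ 2 ^ k := Nat.pow_le_pow_right (by norm_num) (by omega)
  have hWB := hW
  unfold wordBound at hWB
  simp only [RamProg.split, WP.seq_iff, WP.write_iff, WP.read_iff, WP.sub_iff, WP.add_iff]
  simp [hr.lv, hl, hr.env.one, hr.env.two, hr.cur, hr.env.z, hr.env.pw l (by omega)]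
  refine ⟨by omega, by omega, by omega, by omega, ?_⟩
  have h₁ := ((((((((hr.setLv l).setI (x := rS1) (v := 2 ^ l) (by norm_num)).setI (x := rD)
    (v := S.cur + 2 ^ l) (by norm_num)).setR l (S.cur + 2 ^ l)).setHd 0 0 [] rfl).setI (x := rS2)
    (v := l + 2) (by norm_num)).setI (x := rS2) (v := l + 3) (by norm_num)).setI (x := rS3)
    (v := l + 1) (by norm_num))
  refine WP.whileLt (fun s' t => ∃ S' rem, SearchRep G k s' S' ∧
      DInv G S' (fun _ _ => False) ∧ S'.QInv k rem ∧
      IsList (s'.iarr aVal) (s'.iarr aNx) (s'.ivar rCnt) (s'.ivar rH) (rem.map Item.enc) ∧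
      s'.ivar rS2 = S'.lv + 3 ∧ s'.ivar rS3 = S'.lv + 1 ∧ s'.ivar rD = S'.R S'.lv ∧
      t + s'.ivar rCnt + pot G k (k + 2 + H) H S' + 20 * rem.length ≤
        s.ivar rCnt + pot G k (k + 2 + H) H S₁ + 20 * (S.L 0).length)
    (s.ivar rCnt + pot G k (k + 2 + H) H S₁ + 20 * (S.L 0).length) ?_ ?_ ?_ ?_
  · refine ⟨S₁, S.L 0, h₁, hD₁, hQ₁, ?_, ?_⟩
    · simpa [hh] using hr.list 0
    · simp [hS₁]
  · rintro s' t ⟨S', rem, -, -, -, -, -, -, -, ht⟩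
    omega
  · rintro s' t ⟨S', rem, a1, a2, a3, a4, a5, a6, a7, ht⟩ hlt
    rw [a1.env.z] at hlt
    cases rem with
    | nil => exact absurd a4 (by simp only [List.map_nil, IsList]; omega)
    | cons x rem =>
      simp only [List.length_cons] at ht
      refine (splitStep_spec (T := T) (H := H) a1 a2 a3 a4 a5 a6 a7 hW (by omega)).mono ?_
      rintro s₃ t₃ ⟨S₃, b1, b2, b3, b4, b5, b6, b7, b8⟩
      exact ⟨S₃, rem, b1, b2, b3, b4, b5, b6, b7, by omega⟩
  · rintro s' t ⟨S', rem, a1, a2, a3, a4, a5, a6, a7, ht⟩ hlt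
    rw [a1.env.z] at hlt
    cases rem with
    | cons x rem => exact absurd a4.1 (by omega)
    | nil =>
      simp only [List.length_nil] at ht
      exact ⟨S', ⟨a1, a2, a3⟩, by omega⟩

theorem ascend_spec (h : Ready G k s S) (hlv : S.lv < k) (h0 : S.L 0 = [])
    (hW : wordBound n m c k T ≤ W) :
    WP W .ascend (fun s' t => ∃ S', Ready G k s' S' ∧
      t + 10 + s'.ivar rCnt + pot G k (k + 2 + H) H S' ≤
        s.ivar rCnt + pot G k (k + 2 + H) H S) s := by
  obtain ⟨hr, hD, hQ⟩ := h
  unfold wordBound at hW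
  simp only [RamProg.ascend, WP.seq_iff, WP.write_iff, WP.read_iff, WP.add_iff, WP.ifLt_iff,
    WP.copy_iff]
  simp [hr.lv, hr.R, hr.env.one, hr.env.z]
  have h₁ := ((hr.setI (x := rS1) (v := S.R S.lv) (by norm_num)).setI (x := rS3)
    (v := S.lv + 1) (by norm_num)).setI (x := rS2) (v := S.R (S.lv + 1)) (by norm_num)
  refine ⟨by omega, ?_, ?_⟩
  · intro hlt
    have h₂ := h₁.setI (x := rT) (v := s.iarr aHd (S.lv + 1)) (by norm_num)
    have h₃ := ((((h₂.setHd 0 (s.iarr aHd (S.lv + 1)) (S.L (S.lv + 1))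
      (by simpa using hr.list (S.lv + 1))).setHd (S.lv + 1) 0 [] rfl).setCur (S.R S.lv)).setR S.lv
      (S.R (S.lv + 1)))
    refine ⟨_, ⟨h₃, ?_, hQ.advance h0 hlv hlt⟩, ?_⟩
    · refine hD.relabel _ (fun _ => Iff.rfl) (fun _ => Iff.rfl) rfl rfl rfl rfl hQ.cur_lt.le ?_
      intro x hx
      rcases hQ.entry x hx with hh | ⟨a, ha, -, -, h3, -⟩
      · simp at hh
      · have hs := hQ.slot_of_mem ha
        have ha0 : a ≠ 0 := by rintro rfl; rw [h0] at ha; simp at ha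
        exact (hQ.R_lv_le_lo (by omega) (by omega)).trans h3
    · have e1 := entries_update (A := k + 2 + H) (L := S.L) (a := 0) (by omega) (S.L (S.lv + 1))
      have e2 := entries_update (A := k + 2 + H) (L := Function.update S.L 0 (S.L (S.lv + 1)))
        (a := S.lv + 1) (by omega) []
      rw [Function.update_of_ne (by omega)] at e2
      simp only [h0, List.length_nil] at e1 e2
      simp only [pot, levelPot]
      simp [hlv, hlt]
      omega
  · intro hle
    refine ⟨_, ⟨h₁.setLv (S.lv + 1), hD.relabel _ (fun _ => Iff.rfl) (fun _ => Iff.rfl) rfl rfl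
      rfl rfl le_rfl hD.live_ge, hQ.goUp h0 hlv hle⟩, ?_⟩
    simp only [pot, levelPot]
    split_ifs <;> omega

theorem nextInterval_spec (h : Ready G k s S) (hlv : S.lv = k) (h0 : S.L 0 = [])
    (hlive : 0 < S.live)
    (hW : wordBound n m c k T ≤ W) (hH : c * min n (m + 1) / 2 ^ k ≤ H) :
    WP W .nextInterval (fun s' t => ∃ S', Ready G k s' S' ∧
      t + 10 + s'.ivar rCnt + pot G k (k + 2 + H) H S' ≤
        s.ivar rCnt + pot G k (k + 2 + H) H S) s := by
  obtain ⟨hr, hD, hQ⟩ := h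
  have hge : ∀ x, 2 ≤ S.lab x → S.R k ≤ S.dist x := by
    intro x hx
    rcases hQ.entry x hx with hh | ⟨a, ha, -, -, h3, -⟩
    · simp at hh
    · have hs := hQ.slot_of_mem ha
      have ha0 : a ≠ 0 := by rintro rfl; rw [h0] at ha; simp at ha
      rw [← hlv] at h3 ⊢
      have := (hQ.R_lv_le_lo (a := a) (by omega) (by omega))
      rw [hlv] at this h3 ⊢
      exact this.trans h3
  have hp : 0 < 2 ^ k := by positivity
  obtain ⟨x, hx⟩ : ∃ x, 2 ≤ S.lab x := by
    rw [hD.live_card, Finset.card_pos] at hlive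
    obtain ⟨x, hx⟩ := hlive
    exact ⟨x, by simpa using hx⟩
  have hRn : S.R k ≤ c * n := (hge x hx).trans (hD.dist_le_mul (by omega))
  -- Some item is still live, and its distance is at least R k = (hi + 1) 2 ^ k. Hence hi stays
  -- below H, and the truncated difference H − hi really drops.
  have hiH : S.hi + 1 ≤ H := by
    refine le_trans ?_ hH
    rw [Nat.le_div_iff_mul_le hp, ← hQ.top]
    exact (hge x hx).trans (hD.dist_le_min (by omega))
  have hhi : S.hi + 1 ≤ S.R k := by
    rw [hQ.top]; exact Nat.le_mul_of_pos_right _ hp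
  unfold wordBound at hW
  simp only [RamProg.nextInterval, WP.seq_iff, WP.write_iff, WP.read_iff, WP.add_iff]
  simp [hr.hi, hr.R, hr.env.one, hr.env.z, hr.env.vk, hr.env.w]
  refine ⟨by omega, by omega, by omega, by omega, ?_⟩
  have e : k + (S.hi + 1) + 1 = k + 1 + (S.hi + 1) := by ring
  rw [e]
  have h₁ := (((hr.setHi (S.hi + 1)).setI (x := rS1) (v := k + (S.hi + 1)) (by norm_num)).setI
    (x := rS1) (v := k + 1 + (S.hi + 1)) (by norm_num)).setI (x := rT)
    (v := s.iarr aHd (k + 1 + (S.hi + 1))) (by norm_num)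
  have h₂ := (((h₁.setHd 0 _ (S.L (k + 1 + (S.hi + 1)))
      (by simpa using hr.list (k + 1 + (S.hi + 1)))).setHd (k + 1 + (S.hi + 1)) 0 [] rfl).setCur
      (S.R k)).setI (x := rS2) (v := S.R k + 2 ^ k) (by norm_num)
  have h₃ := h₂.setR k (S.R k + 2 ^ k)
  refine ⟨_, ⟨h₃, ?_, hQ.next h0 hlv⟩, ?_⟩
  · refine hD.relabel _ (fun _ => Iff.rfl) (fun _ => Iff.rfl) rfl rfl rfl rfl ?_ hge
    rw [← hlv]; exact hQ.cur_lt.le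
  · have e1 := entries_update (A := k + 2 + H) (L := S.L) (a := 0) (by omega)
      (S.L (k + 1 + (S.hi + 1)))
    have e2 := entries_update (A := k + 2 + H)
      (L := Function.update S.L 0 (S.L (k + 1 + (S.hi + 1)))) (a := k + 1 + (S.hi + 1))
      (by omega) []
    rw [Function.update_of_ne (by omega)] at e2
    simp only [h0, List.length_nil] at e1 e2
    simp only [pot, levelPot]
    simp [hlv]
    omega

/-- Time, allocated nodes and credits together never exceed T. This one invariant gives termination,
the running time and the word length for the node indices. -/
theorem search_spec (h : Ready G k s S) (hm : 1 ≤ m) (hW : wordBound n m c k T ≤ W)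
    (hH : c * min n (m + 1) / 2 ^ k ≤ H)
    (hT : s.ivar rCnt + pot G k (k + 2 + H) H S ≤ T) :
    WP W .search (fun s' t => t ≤ T + 1 ∧ ∃ S', Ready G k s' S' ∧ S'.live = 0 ∧
      100 * S'.ord.length ≤ T) s := by
  refine WP.whileLt (fun s' t => ∃ S', Ready G k s' S' ∧
      t + s'.ivar rCnt + pot G k (k + 2 + H) H S' ≤ T) T ⟨S, h, by omega⟩ ?_ ?_ ?_
  · rintro s' t ⟨S', -, ht⟩
    omega
  · rintro s' t ⟨S', h', ht⟩ hlt
    have hr := h'.rep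
    rw [hr.env.z, hr.live] at hlt
    have hlist := hr.list 0
    have h₁ : Ready G k (s'.setI rH (s'.iarr aHd 0)) S' :=
      ⟨hr.setI (by norm_num), h'.dinv, h'.qinv⟩
    have hcur : S'.cur ≤ c * n := by
      have hh := hlt
      rw [h'.dinv.live_card, Finset.card_pos] at hh
      obtain ⟨x, hx⟩ := hh
      have hx : 2 ≤ S'.lab x := by simpa using hx
      exact (h'.dinv.live_ge x hx).trans (h'.dinv.dist_le_mul (by omega))
    have hc₁ : (s'.setI rH (s'.iarr aHd 0)).ivar rCnt = s'.ivar rCnt := by simp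
    simp only [WP.seq_iff, WP.read_iff, WP.ifLt_iff, hr.env.z]
    constructor
    · intro hpos
      have h0 : S'.L 0 ≠ [] := by
        intro hnil
        rw [hnil, List.map_nil] at hlist
        simp only [IsList] at hlist
        simp [hlist, hr.env.z] at hpos
      constructor
      · intro hlv
        refine (split_spec (T := T) (H := H) h₁ (by simpa [hr.env.z, hr.lv] using hlv) h0
          (by simp) hcur hW (by rw [hc₁]; omega)).mono ?_
        rintro s₂ t₂ ⟨S₂, a1, a2⟩
        rw [hc₁] at a2
        exact ⟨S₂, a1, by omega⟩
      · intro hlv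
        refine (leaf_spec (T := T) (H := H) h₁ (by simpa [hr.env.z, hr.lv] using hlv) h0
          (by simp) hm hW hH (by rw [hc₁]; omega)).mono ?_
        rintro s₂ t₂ ⟨S₂, a1, a2⟩
        rw [hc₁] at a2
        exact ⟨S₂, a1, by omega⟩
    · intro hpos
      have h0 : S'.L 0 = [] := by
        by_contra hne
        obtain ⟨x, r, hxr⟩ := List.exists_cons_of_ne_nil hne
        rw [hxr, List.map_cons] at hlist
        simp [hr.env.z] at hpos
        exact absurd hlist.1 (by omega)
      constructor
      · intro hlv
        refine (ascend_spec (T := T) (H := H) h₁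
          (by simpa [hr.env.vk, hr.lv] using hlv) h0 hW).mono ?_
        rintro s₂ t₂ ⟨S₂, a1, a2⟩
        rw [hc₁] at a2
        exact ⟨S₂, a1, by omega⟩
      · intro hlv
        have hlk := h'.qinv.lv_le
        refine (nextInterval_spec (T := T) (H := H) h₁
          (by simp [hr.env.vk, hr.lv] at hlv; omega) h0 hlt hW hH).mono ?_
        rintro s₂ t₂ ⟨S₂, a1, a2⟩
        rw [hc₁] at a2
        exact ⟨S₂, a1, by omega⟩
  · rintro s' t ⟨S', h', ht⟩ hlt
    have hr := h'.rep
    rw [hr.env.z, hr.live] at hlt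
    refine ⟨by omega, S', h', by omega, ?_⟩
    have : 100 * S'.ord.length ≤ pot G k (k + 2 + H) H S' := by simp only [pot]; omega
    omega

end Specs


/-! ### The program for the setup -/

namespace RamProg

/-- Multiply `n` and `m`. -/
def product : RamProg :=
  .const rI 0 ;; .const rVm 0 ;; .whileLt rI rN (.add rVm rVm rM ;; .add rI rI rOne)

/-- Find the least power of `2` whose product with `rVm` is at least `c`. -/
def width : RamProg :=
  .const rW 1 ;; .const rK 0 ;; .copy rB rVm ;; .write aPw rK rW ;;
  .whileLt rB rC (.add rB rB rB ;; .add rW rW rW ;; .add rK rK rOne ;; .write aPw rK rW)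

def multiples : RamProg :=
  .const rV 0 ;; .const rD 0 ;;
  .whileLt rV rN (.write aVm rV rD ;; .add rD rD rM ;; .add rV rV rOne)

/-- Divide the cost of the edge `rE` by `rW`. -/
def divide : RamProg :=
  .read rS3 aCost rE ;; .const rS2 0 ;; .add rS3 rS3 rOne ;;
  .whileLt rW rS3 (.sub rS3 rS3 rW ;; .add rS2 rS2 rOne) ;;
  .write aChi rE rS2 ;; .sub rS3 rS3 rOne ;; .write aClo rE rS3

/-- Divide all costs by `rW`, and build the adjacency lists. -/
def edges : RamProg :=
  .const rE 0 ;;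
  .whileLt rE rM (divide ;; .read rV aSrc rE ;; .read rT aFst rV ;; .write aNxt rE rT ;;
    .add rE rE rOne ;; .write aFst rV rE)

def source : RamProg :=
  .write aQ rPX rD ;; .write aI rPX rI ;; .write aV rPX rV ;; .write aLab rPX rLy ;; push ;;
  .add rLive rLive rOne ;; .add rPX rPX rOne ;; .add rI rI rOne

/-- Start the search on all layers. -/
def sources : RamProg :=
  .const rLy 3 ;; .add rLy rLy rK ;; .const rPA 0 ;; .const rPX 0 ;; .const rD 0 ;;
  .const rV 0 ;;
  .whileLt rV rN (.const rI 0 ;; .whileLt rI rM source ;;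
    .add rPX rPX rVm ;; .add rD rD rN ;; .add rD rD rOne ;; .add rV rV rOne) ;;
  .write aR rK rW ;; .copy rLv rK

def setup : RamProg :=
  .const rOne 1 ;; .const rTwo 2 ;; product ;; width ;; multiples ;; edges ;; sources

end RamProg

/-- The memory during the setup. -/
structure Input {n m c : ℕ} (G : FlowGraph n m c) (s : RamState) : Prop where
  vn : s.ivar rN = n
  vmm : s.ivar rM = m
  vc : s.ivar rC = c
  z : s.ivar rZ = 0
  one : s.ivar rOne = 1
  two : s.ivar rTwo = 2
  src : ∀ e : Fin m, s.iarr aSrc e = G.src e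
  dst : ∀ e : Fin m, s.iarr aDst e = G.dst e
  cost : ∀ e : Fin m, s.iarr aCost e = G.cost e
  cap : ∀ e : Fin m, s.farr 0 e = G.cap e
  zi : ∀ y, 8 ≤ y → y < 14 → s.ivar y = 0
  za : ∀ a, a = 3 ∨ 14 ≤ a → s.iarr a = fun _ => 0

/-- The memory during the setup, when the length of the intervals has been found. -/
structure Input₂ {n m c : ℕ} (G : FlowGraph n m c) (k : ℕ) (s : RamState) : Prop
    extends Input G s where
  nm : s.ivar rVm = n * m
  w : s.ivar rW = 2 ^ k
  vk : s.ivar rK = k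
  pw : ∀ j ≤ k, s.iarr aPw j = 2 ^ j

/-! ### Specifications of the setup -/

section Specs

variable {n m c k W T : ℕ} {G : FlowGraph n m c} {s : RamState}

theorem Input.setI (h : Input G s) {x v : ℕ} (hx : x = 6 ∨ x = 7 ∨ 14 ≤ x) :
    Input G (s.setI x v) := by
  have key : ∀ y, y ≠ x → (s.setI x v).ivar y = s.ivar y := fun y hy => by simp [hy]
  constructor
  · rw [key _ (by omega)]; exact h.vn
  · rw [key _ (by omega)]; exact h.vmm
  · rw [key _ (by omega)]; exact h.vc
  · rw [key _ (by omega)]; exact h.z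
  · rw [key _ (by omega)]; exact h.one
  · rw [key _ (by omega)]; exact h.two
  · exact h.src
  · exact h.dst
  · exact h.cost
  · exact h.cap
  · intro y h1 h2; rw [key _ (by omega)]; exact h.zi y h1 h2
  · exact h.za

theorem Input.setIA (h : Input G s) {a i v : ℕ} (ha : 8 ≤ a) (ha' : a < 14) :
    Input G (s.setIA a i v) := by
  have key : ∀ b, b ≠ a → (s.setIA a i v).iarr b = s.iarr b := fun y hy => by simp [hy]
  constructor
  · exact h.vn
  · exact h.vmm
  · exact h.vc
  · exact h.z
  · exact h.one
  · exact h.two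
  · rw [key _ (by omega)]; exact h.src
  · rw [key _ (by omega)]; exact h.dst
  · rw [key _ (by omega)]; exact h.cost
  · exact h.cap
  · exact h.zi
  · intro b hb; rw [key _ (by omega)]; exact h.za b hb

theorem Input₂.setI (h : Input₂ G k s) {x v : ℕ} (hx : 14 ≤ x) (hx' : x ≠ 19) :
    Input₂ G k (s.setI x v) := by
  have key : ∀ y, y ≠ x → (s.setI x v).ivar y = s.ivar y := fun y hy => by simp [hy]
  refine ⟨h.toInput.setI (by omega), ?_, ?_, ?_, h.pw⟩
  · rw [key _ (by omega)]; exact h.nm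
  · rw [key _ (by omega)]; exact h.w
  · rw [key _ (by omega)]; exact h.vk

theorem Input₂.setIA (h : Input₂ G k s) {a i v : ℕ} (ha : 9 ≤ a) (ha' : a < 14) :
    Input₂ G k (s.setIA a i v) := by
  refine ⟨h.toInput.setIA (by omega) ha', h.nm, h.w, h.vk, ?_⟩
  rw [RamState.iarr_setIA, if_neg (by omega)]; exact h.pw

theorem product_spec (h : Input G s) (hW : n * m + n + 1 ≤ W) :
    WP W .product (fun s' t => Input G s' ∧ s'.ivar rVm = n * m ∧
      s'.iarr aFst = s.iarr aFst ∧ t ≤ 3 * n + 5) s := by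
  simp only [RamProg.product, WP.seq_iff, WP.const_iff]
  refine ⟨by omega, by omega, ?_⟩
  refine WP.countLoop (fun i s' => Input G s' ∧ s'.ivar rI = i ∧ s'.ivar rVm = i * m ∧
    s'.iarr aFst = s.iarr aFst) n 2 ?_ ?_ ?_ ?_
  · exact ⟨(h.setI (by omega)).setI (by omega), by simp, by simp, rfl⟩
  · rintro i s' hi ⟨h', h1, -⟩
    rw [h1, h'.vn]
  · rintro i s' hi ⟨h', h1, h2, h3⟩
    have := Nat.mul_le_mul_right m (Nat.succ_le_of_lt hi)
    rw [Nat.succ_mul] at this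
    simp [h1, h2, h'.vmm, h'.one]
    exact ⟨by omega, by omega, (h'.setI (by omega)).setI (by omega), by ring, h3⟩
  · rintro s' t ht ⟨h', h1, h2, h3⟩
    exact ⟨h', h2, h3, by omega⟩

theorem width_spec (h : Input G s) (hnm : s.ivar rVm = n * m) (hp : 1 ≤ n * m)
    (hW : 2 * c + n * m + 2 ≤ W) :
    WP W .width (fun s' t => ∃ k, Input₂ G k s' ∧ c ≤ 2 ^ k * (n * m) ∧
      (k = 0 ∨ 2 ^ (k - 1) * (n * m) < c) ∧
      s'.iarr aFst = s.iarr aFst ∧ t ≤ 5 * k + 6) s := by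
  simp only [RamProg.width, WP.seq_iff, WP.const_iff, WP.copy_iff, WP.write_iff]
  refine ⟨by omega, by omega, ?_⟩
  refine WP.whileLt (fun s' t => ∃ k, Input₂ G k s' ∧ s'.ivar rB = 2 ^ k * (n * m) ∧
      (k = 0 ∨ 2 ^ (k - 1) * (n * m) < c) ∧
      s'.iarr aFst = s.iarr aFst ∧ t ≤ 5 * k) (5 * c) ?_ ?_ ?_ ?_
  · refine ⟨0, ⟨?_, ?_, ?_, ?_, ?_⟩, ?_, Or.inl rfl, by simp, by omega⟩
    · exact (((h.setI (by omega)).setI (by omega)).setI (by omega)).setIA (by omega) (by omega)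
    · simpa using hnm
    · simp
    · simp
    · simp
    · simp [hnm]
  · rintro s' t ⟨k, -, -, h3, -, h4⟩
    rcases h3 with h3 | h3
    · omega
    -- The crude consequence k ≤ c suffices for termination; the minimality of k is kept for the
    -- logarithmic bound.
    · have h7 : k - 1 < 2 ^ (k - 1) := Nat.lt_two_pow_self
      have h6 : 2 ^ (k - 1) ≤ 2 ^ (k - 1) * (n * m) := Nat.le_mul_of_pos_right _ hp
      omega
  · rintro s' t ⟨k, h1, h2, h3, h5, h4⟩ hlt
    rw [h2, h1.vc] at hlt
    have h6 : 2 ^ k ≤ 2 ^ k * (n * m) := Nat.le_mul_of_pos_right _ hp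
    have h7 : k < 2 ^ k := Nat.lt_two_pow_self
    simp [h2, h1.w, h1.vk, h1.one]
    refine ⟨by omega, by omega, by omega, k + 1, ⟨?_, ?_, ?_, ?_, ?_⟩, ?_, ?_, by simpa using h5, by omega⟩
    · exact (((h1.toInput.setI (by omega)).setI (by omega)).setI (by omega)).setIA (by omega)
        (by omega)
    · simpa using h1.nm
    · simp [pow_succ]; omega
    · simp
    · intro j hj
      simp only [RamState.iarr_setIA, if_true]
      by_cases hjk : j = k + 1
      · subst hjk; simp [pow_succ]; omega
      · rw [Function.update_of_ne hjk]
        exact h1.pw j (by omega)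
    · rw [pow_succ]; ring
    · right; simpa using hlt
  · rintro s' t ⟨k, h1, h2, h3, h5, h4⟩ hlt
    rw [h2, h1.vc] at hlt
    exact ⟨k, h1, by omega, h3, h5, by omega⟩

theorem multiples_spec (h : Input₂ G k s) (hW : n * m + n + 1 ≤ W) :
    WP W .multiples (fun s' t => Input₂ G k s' ∧ (∀ v : Fin n, s'.iarr aVm v = v * m) ∧
      s'.iarr aFst = s.iarr aFst ∧ t ≤ 4 * n + 5) s := by
  simp only [RamProg.multiples, WP.seq_iff, WP.const_iff]
  refine ⟨by omega, by omega, ?_⟩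
  refine WP.countLoop (fun i s' => Input₂ G k s' ∧ s'.ivar rV = i ∧ s'.ivar rD = i * m ∧
    (∀ v < i, s'.iarr aVm v = v * m) ∧ s'.iarr aFst = s.iarr aFst) n 3 ?_ ?_ ?_ ?_
  · exact ⟨(h.setI (by omega) (by omega)).setI (by omega) (by omega), by simp, by simp, by simp, by simp⟩
  · rintro i s' hi ⟨h', h1, -⟩
    rw [h1, h'.vn]
  · rintro i s' hi ⟨h', h1, h2, h3, h4⟩
    have := Nat.mul_le_mul_right m (Nat.succ_le_of_lt hi)
    rw [Nat.succ_mul] at this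
    simp [h1, h2, h'.vmm, h'.one]
    refine ⟨by omega, by omega, ((h'.setIA (by omega) (by omega)).setI (by omega)
      (by omega)).setI (by omega) (by omega), by ring, ?_, h4⟩
    intro v hv
    by_cases hvi : v = i
    · subst hvi; simp
    · rw [Function.update_of_ne hvi]; exact h3 v (by omega)
  · rintro s' t ht ⟨h', h1, h2, h3, h4⟩
    exact ⟨h', fun v => h3 v v.2, h4, by omega⟩

/-- Division is by repeated subtraction. The rest is stored increased by 1, which turns the strict
test of the loop into 2 ^ k ≤ rest. -/
theorem divide_spec (h : Input₂ G k s) (e : Fin m) (hE : s.ivar rE = e) (hW : c + 1 ≤ W) :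
    WP W .divide (fun s' t => Input₂ G k s' ∧ s'.ivar rE = e ∧
      s'.iarr = Function.update (Function.update s.iarr aChi
        (Function.update (s.iarr aChi) e (G.cost e / 2 ^ k))) aClo
        (Function.update (s.iarr aClo) e (G.cost e % 2 ^ k)) ∧
      t ≤ 3 * (G.cost e / 2 ^ k) + 7) s := by
  have hce := G.cost_le e
  have hp : 0 < 2 ^ k := by positivity
  simp only [RamProg.divide, WP.seq_iff, WP.const_iff, WP.read_iff, WP.add_iff, WP.write_iff,
    WP.sub_iff]
  simp only [hE, h.cost, h.one, RamState.ivar_setI]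
  norm_num
  refine ⟨by omega, ?_⟩
  refine WP.whileLt (fun s' t => ∃ q, Input₂ G k s' ∧ s'.ivar rE = e ∧ s'.iarr = s.iarr ∧
    s'.ivar rS2 = q ∧ q * 2 ^ k ≤ G.cost e ∧ s'.ivar rS3 = G.cost e + 1 - q * 2 ^ k ∧ t = 3 * q)
    (3 * G.cost e) ?_ ?_ ?_ ?_
  · exact ⟨0, ((h.setI (by omega) (by omega)).setI (by omega) (by omega)).setI (by omega)
      (by omega), by simpa using hE, rfl, by simp, by simp, by simp, rfl⟩
  · rintro s' t ⟨q, -, -, -, -, h1, -, rfl⟩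
    have : q ≤ q * 2 ^ k := Nat.le_mul_of_pos_right _ hp
    omega
  · rintro s' t ⟨q, h', h1, h2, h3, h4, h5, rfl⟩ hlt
    rw [h5, h'.w] at hlt
    have : q ≤ q * 2 ^ k := Nat.le_mul_of_pos_right _ hp
    have e1 : (q + 1) * 2 ^ k = q * 2 ^ k + 2 ^ k := by ring
    simp [h3, h5, h'.w, h'.one]
    refine ⟨by omega, (h'.setI (by omega) (by omega)).setI (by omega) (by omega),
      h1, h2, by omega, by omega, by omega⟩
  · rintro s' t ⟨q, h', h1, h2, h3, h4, h5, rfl⟩ hlt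
    rw [h5, h'.w] at hlt
    have e1 : (q + 1) * 2 ^ k = q * 2 ^ k + 2 ^ k := by ring
    have hq : G.cost e / 2 ^ k = q := Nat.div_eq_of_lt_le h4 (by omega)
    have hr : G.cost e % 2 ^ k = G.cost e - q * 2 ^ k := by
      rw [Nat.mod_def, hq, mul_comm]
    simp only [h1, h3, h5, h'.one]
    norm_num
    refine ⟨((h'.setIA (by omega) (by omega)).setI (by omega) (by omega)).setIA (by omega)
      (by omega), ?_, by omega⟩
    rw [hq, hr]
    have e2 : G.cost e + 1 - q * 2 ^ k - 1 = G.cost e - q * 2 ^ k := by omega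
    simp [RamState.setIA, RamState.setI, h2, e2]

theorem IsAdj.congr {nxt nxt' : ℕ → ℕ} {b : ℕ} {l : List (Fin m)} (h : IsAdj nxt b l)
    (hl : ∀ e ∈ l, nxt' e = nxt e) : IsAdj nxt' b l := by
  induction l generalizing b with
  | nil => exact h
  | cons e l ih =>
    refine ⟨h.1, ?_⟩
    rw [hl e (by simp)]
    exact ih h.2 fun e' he' => hl e' (List.mem_cons_of_mem _ he')

theorem Input₂.env (h : Input₂ G k s) (hvm : ∀ v : Fin n, s.iarr aVm v = v * m)
    (hchi : ∀ e : Fin m, s.iarr aChi e = G.cost e / 2 ^ k)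
    (hclo : ∀ e : Fin m, s.iarr aClo e = G.cost e % 2 ^ k)
    (hadj : ∀ v : Fin n, IsAdj (s.iarr aNxt) (s.iarr aFst v) (G.out v)) : Env G k s :=
  { h with
    chi := hchi, clo := hclo, vm := hvm, adj := hadj, len := h.za _ (Or.inl rfl) }

/-- By the choice of k all quotients are at most nm, so even this slow division costs O(nm) for each
edge and O(nm²) altogether. Edges are prepended to the adjacency lists, whence the reversal in
`out`. -/
theorem edges_spec (h : Input₂ G k s) (hvm : ∀ v : Fin n, s.iarr aVm v = v * m)
    (hz : ∀ v, s.iarr aFst v = 0) (hc : c ≤ 2 ^ k * (n * m))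
    (hW : c + m + 1 ≤ W) :
    WP W .edges (fun s' t => Input₂ G k s' ∧ Env G k s' ∧ t ≤ m * (3 * (n * m) + 13) + 2) s := by
  simp only [RamProg.edges, WP.seq_iff, WP.const_iff]
  refine ⟨by omega, ?_⟩
  refine WP.countLoop (fun p s' => Input₂ G k s' ∧ s'.ivar rE = p ∧
    (∀ v : Fin n, s'.iarr aVm v = v * m) ∧
    (∀ e : Fin m, e < p → s'.iarr aChi e = G.cost e / 2 ^ k ∧ s'.iarr aClo e = G.cost e % 2 ^ k) ∧
    (∀ v : Fin n, IsAdj (s'.iarr aNxt) (s'.iarr aFst v)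
      (((List.finRange m).take p).filter fun e => G.src e = v).reverse)) m
    (3 * (n * m) + 12) ?_ ?_ ?_ ?_
  · exact ⟨h.setI (by omega) (by omega), by simp, hvm, by simp, by simp [IsAdj, hz]⟩
  · rintro i s' hi ⟨h', h1, -⟩
    rw [h1, h'.vmm]
  · rintro p s' hp ⟨h', h1, h2, h3, h4⟩
    have hdiv : G.cost ⟨p, hp⟩ / 2 ^ k ≤ n * m :=
      Nat.div_le_of_le_mul ((G.cost_le _).trans hc)
    rw [WP.seq_iff]
    refine (divide_spec (W := W) h' ⟨p, hp⟩ h1 (by omega)).mono ?_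
    rintro s₁ t₁ ⟨g1, g2, g3, g4⟩
    have hsrc := g1.src ⟨p, hp⟩
    simp only at g2 hsrc
    simp only [WP.read_iff, WP.write_iff, WP.seq_iff, WP.add_iff]
    simp [g2, g1.one, hsrc]
    refine ⟨by omega, by omega, ((((g1.setI (by omega) (by omega)).setI (by omega)
      (by omega)).setIA (by omega) (by omega)).setI (by omega) (by omega)).setIA (by omega)
      (by omega), by simp [g3, h2], ?_, ?_⟩
    · intro e he
      rw [g3]
      by_cases hep : (e : ℕ) = p
      · have : e = ⟨p, hp⟩ := Fin.ext hep
        subst this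
        simp
      · have := h3 e (by omega)
        simp [hep, this]
    · intro v
      have e1 : (List.finRange m).take (p + 1) = (List.finRange m).take p ++ [⟨p, hp⟩] := by
        rw [List.take_add_one]
        simp [hp]
      have e2 : s₁.iarr aNxt = s'.iarr aNxt := by rw [g3]; simp
      have e3 : s₁.iarr aFst = s'.iarr aFst := by rw [g3]; simp
      have hmem : ∀ e ∈ (List.finRange m).take p, (e : ℕ) ≠ p := by
        intro e he
        rw [List.mem_take_iff_getElem] at he
        obtain ⟨j, hj, rfl⟩ := he
        simp at hj ⊢
        omega
      have hold : IsAdj (Function.update (s₁.iarr aNxt) p (s₁.iarr aFst (G.src ⟨p, hp⟩)))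
          (s'.iarr aFst v)
          (((List.finRange m).take p).filter fun e => G.src e = v).reverse := by
        refine (h4 v).congr ?_
        intro e he
        rw [List.mem_reverse] at he
        rw [Function.update_of_ne (hmem e (List.mem_of_mem_filter he)), e2]
      rw [e1, List.filter_append, List.reverse_append]
      by_cases hv : G.src ⟨p, hp⟩ = v
      · subst hv
        simp only [List.filter_singleton, decide_true, Function.update_self]
        refine ⟨rfl, ?_⟩
        simp only [Function.update_self, e3]
        rw [e3] at hold
        exact hold
      · have hv' : (v : ℕ) ≠ G.src ⟨p, hp⟩ := fun hh => hv (Fin.ext hh.symm)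
        simp only [List.filter_singleton, hv, decide_false, Function.update_of_ne hv', e3]
        rw [e3] at hold
        exact hold
  · rintro s' t ht ⟨h', h1, h2, h3, h4⟩
    refine ⟨h', h'.env h2 (fun e => (h3 e e.2).1) (fun e => (h3 e e.2).2) ?_, ?_⟩
    swap
    · have e5 : m * (3 * (n * m) + 12 + 1) = m * (3 * (n * m) + 13) := rfl
      omega
    intro v
    have := h4 v
    rwa [List.take_of_length_le (by simp)] at this

end Specs


/-! ### Starting the search from all sources -/

section Specs

open Search

variable {n m c k W T : ℕ} {G : FlowGraph n m c} {s : RamState} {S : Search n m}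

/-- The state of the search after the insertion of the sources of the first `p` layers. -/
structure Initial (k p : ℕ) (S : Search n m) : Prop where
  dist : ∀ x, S.dist x = 0
  lab : ∀ x, S.lab x = if x.1 = x.2.2 ∧ x.1 * m + x.2.1 < p then k + 3 else 0
  par : ∀ x, S.par x = 0
  ord : S.ord = []
  live : S.live = p
  cur : S.cur = 0
  lv : S.lv = 0
  hi : S.hi = 0
  R : S.R = fun _ => 0
  L : ∀ a, a ≠ 0 → S.L a = []
  mem : ∀ x, x ∈ S.L 0 ↔ x.1 = x.2.2 ∧ x.1 * m + x.2.1 < p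
  len : (S.L 0).length = p

theorem layer_eq {x : Item n m} {u i : ℕ} (hi : i < m) (h : (x.1 : ℕ) * m + x.2.1 = u * m + i) :
    (x.1 : ℕ) = u ∧ (x.2.1 : ℕ) = i := by
  have h1 : ((x.1 : ℕ) * m + x.2.1) % m = (u * m + i) % m := by rw [h]
  rw [Nat.mul_add_mod_of_lt x.2.1.2, Nat.mul_add_mod_of_lt hi] at h1
  rw [h1] at h
  exact ⟨Nat.eq_of_mul_eq_mul_right (by omega) (Nat.add_right_cancel h), h1⟩

theorem source_spec {u i : ℕ} (hu : u < n) (hi : i < m) (h : SearchRep G k s S)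
    (hS : Initial k (u * m + i) S) (hI : s.ivar rI = i) (hV : s.ivar rV = u)
    (hX : s.ivar rPX = (u * n + u) * m + i) (hD : s.ivar rD = u * n + u)
    (hL : s.ivar rLy = k + 3) (hA : s.ivar rPA = 0) (hc : s.ivar rCnt = u * m + i)
    (hW : n * n * m + n * m + n + m + 20 ≤ W) :
    WP W .source (fun s' t => t ≤ 12 ∧ (∃ S', SearchRep G k s' S' ∧
      Initial k (u * m + i + 1) S') ∧ s'.ivar rI = i + 1 ∧ s'.ivar rV = u ∧
      s'.ivar rPX = (u * n + u) * m + (i + 1) ∧ s'.ivar rD = u * n + u ∧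
      s'.ivar rLy = k + 3 ∧ s'.ivar rPA = 0 ∧ s'.ivar rCnt = u * m + i + 1 ∧
      s'.ivar rVm = s.ivar rVm) s := by
  set x : Item n m := (⟨u, hu⟩, ⟨i, hi⟩, ⟨u, hu⟩) with hx
  have hxe : (u * n + u) * m + i = x.enc := rfl
  have hxb := x.enc_add_lt
  rw [hxe] at hX
  have hum : u * m + m ≤ n * m := by
    have := Nat.mul_le_mul_right m (Nat.succ_le_of_lt hu)
    rw [Nat.succ_mul] at this
    exact this
  have hlx : S.lab x = 0 := by
    rw [hS.lab]; simp [hx]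
  have h₁ := ((h.setUnseen x hlx aQ (u * n + u) (by simp)).setUnseen x hlx aI i
    (by simp)).setUnseen x hlx aV u (by simp)
  have h₂ := h₁.setLab x (k + 3) (by simp [hx])
  simp only [RamProg.source, WP.seq_iff, WP.write_iff]
  simp only [hX, hD, hI, hV, hL, RamState.ivar_setIA]
  refine (push_spec h₂ (x := x) (a := 0) hX hA (by simp [hc]; omega)).mono ?_
  rintro s₁ t₁ ⟨rfl, hr, hc₁, hs₁, -⟩
  have q : ∀ r, r ∉ [rT, rCnt] → s₁.ivar r = s.ivar r := hs₁.1
  have hlive : s₁.ivar rLive = u * m + i := by rw [q _ (by decide), h.live, hS.live]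
  simp only [WP.add_iff]
  have h1 := hr.env.one
  have hX₁ : s₁.ivar rPX = x.enc := by rw [q _ (by decide), hX]
  have hI₁ : s₁.ivar rI = i := by rw [q _ (by decide), hI]
  simp [hlive, h1, hX₁, hI₁]
  refine ⟨by omega, by omega, by omega, ⟨_, ((hr.setLive (u * m + i + 1)).setI (by norm_num)).setI
    (by norm_num), ?_⟩, ?_, ?_, ?_, ?_, ?_, ?_, ?_⟩
  · have hne : ∀ y : Item n m, y ≠ x → y.1 = y.2.2 → (y.1 : ℕ) * m + y.2.1 ≠ u * m + i := by
      intro y hy hyv hh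
      obtain ⟨g1, g2⟩ := layer_eq hi hh
      refine hy ?_
      obtain ⟨a, b, d⟩ := y
      simp only at g1 g2 hyv
      subst hyv
      simp only [hx, Prod.mk.injEq]
      exact ⟨Fin.ext g1, Fin.ext g2, Fin.ext g1⟩
    have hiff : ∀ y : Item n m, (y.1 = y.2.2 ∧ (y.1 : ℕ) * m + y.2.1 < u * m + i + 1) ↔
        y = x ∨ (y.1 = y.2.2 ∧ (y.1 : ℕ) * m + y.2.1 < u * m + i) := by
      intro y
      by_cases hy : y = x
      · subst hy; simp [hx]
      · constructor
        · rintro ⟨g1, g2⟩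
          have := hne y hy g1
          exact Or.inr ⟨g1, by omega⟩
        · rintro (g | ⟨g1, g2⟩)
          · exact absurd g hy
          · exact ⟨g1, by omega⟩
    constructor
    · exact hS.dist
    · intro y
      simp only [hiff]
      by_cases hy : y = x
      · subst hy; simp
      · rw [Function.update_of_ne hy, hS.lab]; simp [hy]
    · exact hS.par
    · exact hS.ord
    · rfl
    · exact hS.cur
    · exact hS.lv
    · exact hS.hi
    · exact hS.R
    · intro a ha; simp [ha, hS.L a ha]
    · intro y
      simp only [hiff, Function.update_self, List.mem_cons, hS.mem]
    · simp [hS.len]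
  · rw [q _ (by decide), hV]
  · rw [← hxe]; ring
  · rw [q _ (by decide), hD]
  · rw [q _ (by decide), hL]
  · rw [q _ (by decide), hA]
  · rw [hc₁]; simp [hc]
  · exact q _ (by decide)

/-- All sources have distance 0 and lie in slot 0, which is the first interval of length 2 ^ k.
Their label k + 3 is the least that `entry` allows for slot 0 at the level k, if k is positive. -/
theorem Initial.ready (hS : Initial k (n * m) S) (hr : SearchRep G k s S) :
    Ready G k ((s.setIA aR k (2 ^ k)).setI rLv k)
      { S with R := Function.update S.R k (2 ^ k), lv := k } := by
  have hlt : ∀ x : Item n m, (x.1 : ℕ) * m + x.2.1 < n * m := by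
    intro x
    have := Nat.mul_le_mul_right m (Nat.succ_le_of_lt x.1.2)
    rw [Nat.succ_mul] at this
    have := x.2.1.2
    omega
  have hlab : ∀ x, S.lab x = if x.1 = x.2.2 then k + 3 else 0 := by
    intro x; rw [hS.lab]; simp [hlt]
  have hmem : ∀ x, x ∈ S.L 0 ↔ x.1 = x.2.2 := by
    intro x; rw [hS.mem]; simp [hlt]
  have hne : ∀ x, S.lab x ≠ 1 := by
    intro x; rw [hlab]; split_ifs <;> omega
  refine ⟨(hr.setR k (2 ^ k)).setLv k, ?_, ?_⟩
  · constructor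
    · intro u i; simp [hlab, hS.dist, hS.par]
    · intro u i v huv hl; simp [hlab, huv] at hl
    · intro u i e h1; exact absurd h1 (hne _)
    · intro x h1; exact absurd h1 (hne _)
    · intro x _; simp [hS.cur]
    · intro x _; simp [hS.dist]
    · intro x h1; exact absurd h1 (hne _)
    · intro x; simp [hS.ord, hne]
    · simp [hS.ord]
    · simp [hS.ord]
    · simp [hS.ord]
    · have : (Finset.univ.filter fun x => 2 ≤ S.lab x) =
          (Finset.univ : Finset (Fin n × Fin m)).image fun p => (p.1, p.2, p.1) := by
        ext ⟨u, i, v⟩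
        simp only [hlab, Finset.mem_filter, Finset.mem_univ, true_and, Finset.mem_image,
          Prod.exists, Prod.mk.injEq]
        constructor
        · intro h
          split_ifs at h with h1
          · exact ⟨u, i, rfl, rfl, h1⟩
          · omega
        · rintro ⟨a, b, rfl, rfl, rfl⟩; simp
      simp only [this]
      rw [Finset.card_image_of_injective]
      · simp [hS.live]
      · rintro ⟨a, b⟩ ⟨a', b'⟩ h
        simp only [Prod.mk.injEq] at h
        simp [h.1, h.2.1]
  · have hpos : 0 < 2 ^ k := by positivity
    constructor
    · exact le_rfl
    · simp [hS.hi]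
    · intro j h1 h2; simp only at h1; omega
    · simp [hS.cur]
    · left; simp [hS.cur]
    · simp [hS.hi]
    · intro x hx
      right
      have hxv : x.1 = x.2.2 := by
        by_contra hh; simp [hlab, hh] at hx
      refine ⟨0, (hmem x).2 hxv, ?_, ?_, ?_, ?_⟩
      · simp [hlab, hxv]
      · simp [hlab, hxv]
      · simp [lo, hS.cur]
      · simp [up, hS.dist]
    · intro a x hx
      by_cases ha : a = 0
      · subst ha
        have hxv := (hmem x).1 hx
        refine ⟨?_, fun _ => ?_⟩
        · simp [hlab, hxv]
        · simp [up, hS.dist]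
      · simp only [hS.L a ha] at hx
        simp at hx
    · simp
    · intro a h1 _; exact hS.L a (by omega)
    · intro a h1 _; exact hS.L a (by omega)

theorem sources_spec (h : Input₂ G k s) (he : Env G k s) (hm : 1 ≤ m)
    (hW : wordBound n m c k T ≤ W) :
    WP W .sources (fun s' t => ∃ S', Ready G k s' S' ∧ S'.lv = k ∧ S'.hi = 0 ∧ S'.ord = [] ∧
      s'.ivar rCnt = n * m ∧ (S'.L 0).length = n * m ∧ (∀ a ≠ 0, S'.L a = []) ∧
      (∀ x, S'.lab x = if x.1 = x.2.2 then k + 3 else 0) ∧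
      t ≤ n * (13 * m + 10) + 10) s := by
  unfold wordBound at hW
  simp only [RamProg.sources, WP.seq_iff, WP.const_iff, WP.add_iff]
  simp only [RamState.ivar_setI, h.vk]
  norm_num
  refine ⟨by omega, by omega, ?_⟩
  have hpk : k < 2 ^ k := Nat.lt_two_pow_self
  refine WP.countLoop (fun u s' => (∃ S', SearchRep G k s' S' ∧ Initial k (u * m) S') ∧
    s'.ivar rV = u ∧ s'.ivar rPX = (u * n + u) * m ∧ s'.ivar rD = u * n + u ∧
    s'.ivar rLy = k + 3 ∧ s'.ivar rPA = 0 ∧ s'.ivar rCnt = u * m ∧ s'.ivar rVm = n * m) n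
    (13 * m + 9) ?_ ?_ ?_ ?_
  · refine ⟨⟨⟨fun _ => 0, fun _ => 0, fun _ => 0, [], 0, 0, 0, 0, fun _ => 0, fun _ => []⟩, ?_,
      ?_⟩, ?_⟩
    · have hz : ∀ a, 14 ≤ a → s.iarr a = fun _ => 0 := fun a ha => h.za a (Or.inr ha)
      have hi : ∀ y, 8 ≤ y → y < 14 → s.ivar y = 0 := h.zi
      refine SearchRep.congr (s := s) ?_ ?_ (fun _ _ _ => rfl) rfl
      · constructor
        · exact he
        · exact hi _ (by norm_num) (by norm_num)
        · exact hi _ (by norm_num) (by norm_num)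
        · exact hi _ (by norm_num) (by norm_num)
        · exact hi _ (by norm_num) (by norm_num)
        · exact hi _ (by norm_num) (by norm_num)
        · intro x; rw [hz _ (by norm_num)]
        · intro x; rw [hz _ (by norm_num)]
        · intro x; rw [hz _ (by norm_num)]
        · simp
        · simp
        · exact hz _ (by norm_num)
        · intro a; simp only [List.map_nil, IsList]; rw [hz _ (by norm_num)]
      · intro y hy
        simp only [RamState.ivar_setI]
        split_ifs <;> omega
    · constructor <;> simp
    · simp [h.nm, h.zi rCnt (by norm_num) (by norm_num), add_comm]
  · rintro u s' hu ⟨⟨S', hr, -⟩, h1, -⟩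
    rw [h1, hr.env.vn]
  · rintro u s' hu ⟨⟨S', hr, hS⟩, h1, h2, h3, h4, h5, h6, h7⟩
    rw [WP.seq_iff, WP.const_iff]
    refine ⟨by omega, ?_⟩
    rw [WP.seq_iff]
    refine WP.countLoop (fun i s' => (∃ S', SearchRep G k s' S' ∧ Initial k (u * m + i) S') ∧
      s'.ivar rI = i ∧ s'.ivar rV = u ∧ s'.ivar rPX = (u * n + u) * m + i ∧
      s'.ivar rD = u * n + u ∧ s'.ivar rLy = k + 3 ∧ s'.ivar rPA = 0 ∧
      s'.ivar rCnt = u * m + i ∧ s'.ivar rVm = n * m) m 12 ?_ ?_ ?_ ?_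
    · refine ⟨⟨S', hr.setI (by norm_num), hS⟩, ?_⟩
      simp [h1, h2, h3, h4, h5, h6, h7]
    · rintro i s₁ hi ⟨⟨S₁, hr₁, -⟩, g1, -⟩
      rw [g1, hr₁.env.vmm]
    · rintro i s₁ hi ⟨⟨S₁, hr₁, hS₁⟩, g1, g2, g3, g4, g5, g6, g7, g8⟩
      refine (source_spec hu hi hr₁ hS₁ g1 g2 g3 g4 g5 g6 g7 (by omega)).mono ?_
      rintro s₂ t₂ ⟨b0, b1, b2, b3, b4, b5, b6, b7, b8, b9⟩
      exact ⟨b0, b1, b2, b3, b4, b5, b6, b7, b8, b9.trans g8⟩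
    · rintro s₁ t₁ ht ⟨⟨S₁, hr₁, hS₁⟩, g1, g2, g3, g4, g5, g6, g7, g8⟩
      simp only [WP.seq_iff, WP.add_iff]
      have e1 : (u + 1) * n = u * n + n := by ring
      have e2 : (u + 1) * m = u * m + m := by ring
      have e3 : (u * n + u) * m + m + n * m = ((u + 1) * n + (u + 1)) * m := by ring
      have e4 : (u + 1) * n ≤ n * n := Nat.mul_le_mul_right n (Nat.succ_le_of_lt hu)
      have e5 : ((u + 1) * n + (u + 1)) * m ≤ (n * n + n) * m :=
        Nat.mul_le_mul_right _ (Nat.add_le_add e4 hu)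
      have e6 : (n * n + n) * m = n * n * m + n * m := by ring
      simp [g2, g3, g4, g8, hr₁.env.vn, hr₁.env.one]
      refine ⟨by omega, by omega, by omega, by omega, by omega, ⟨S₁, ((((hr₁.setI (by norm_num)).setI
        (by norm_num)).setI (by norm_num)).setI (by norm_num)), by rwa [e2]⟩, ?_, ?_, ?_, ?_, ?_⟩
      · rw [← e3]
      · rw [e1]; omega
      · exact g5
      · exact g6
      · rw [g7, e2]
  · rintro s₁ t₁ ht ⟨⟨S₁, hr₁, hS₁⟩, g1, g2, g3, g4, g5, g6, g7⟩
    simp only [hr₁.env.vk, hr₁.env.w]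
    have e1 : n * (13 * m + 9 + 1) = n * (13 * m + 10) := rfl
    refine ⟨_, hS₁.ready hr₁, rfl, hS₁.hi, hS₁.ord, by simpa using g6, hS₁.len, hS₁.L, ?_, ?_⟩
    · intro u i v
      have := Nat.mul_le_mul_right m (Nat.succ_le_of_lt u.2)
      rw [Nat.succ_mul] at this
      have := i.2
      simp only [hS₁.lab]
      congr 1
      simp only [eq_iff_iff, and_iff_left_iff_imp]
      intro _
      omega
    · rw [e1] at ht
      omega

theorem setup_spec (hm : 1 ≤ m) {T : ℕ → ℕ}
    (hW : ∀ k, c ≤ 2 ^ k * (n * m) → (k = 0 ∨ 2 ^ (k - 1) * (n * m) < c) →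
      wordBound n m c k (T k) ≤ W) (hn : 1 ≤ n) :
    WP W .setup (fun s' t => ∃ k S', Ready G k s' S' ∧ c ≤ 2 ^ k * (n * m) ∧
      (k = 0 ∨ 2 ^ (k - 1) * (n * m) < c) ∧ S'.lv = k ∧ S'.hi = 0 ∧ S'.ord = [] ∧
      s'.ivar rCnt = n * m ∧ (S'.L 0).length = n * m ∧ (∀ a ≠ 0, S'.L a = []) ∧
      (∀ x, S'.lab x = if x.1 = x.2.2 then k + 3 else 0) ∧
      t ≤ 17 * n + 5 * k + m * (3 * (n * m) + 13) + 13 * (n * m) + 30) (inputState G) := by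
  have hnm : 1 ≤ n * m := Nat.mul_pos hn hm
  -- The hypothesis on W refers to a k that is yet to be computed. Such a k exists, and its word
  -- bound already covers the numbers that occur before k is known.
  have hW0 : 2 * c + n * m + n + m + 20 ≤ W := by
    obtain ⟨k, h1, h2⟩ : ∃ k, c ≤ 2 ^ k * (n * m) ∧ (k = 0 ∨ 2 ^ (k - 1) * (n * m) < c) := by
      have hex : ∃ k, c ≤ 2 ^ k * (n * m) :=
        ⟨c, (Nat.lt_two_pow_self).le.trans (Nat.le_mul_of_pos_right _ hnm)⟩
      classical
      refine ⟨Nat.find hex, Nat.find_spec hex, ?_⟩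
      by_cases h0 : Nat.find hex = 0
      · exact Or.inl h0
      · exact Or.inr (not_le.1 (Nat.find_min hex (by omega)))
    have := hW k h1 h2
    unfold wordBound at this
    omega
  have h₀ : Input G (((inputState G).setI rOne 1).setI rTwo 2) := by
    constructor
    · simp [inputState]
    · simp [inputState]
    · simp [inputState]
    · simp [inputState]
    · simp
    · simp
    · intro e; simp [inputState, arrayOf]
    · intro e; simp [inputState, arrayOf]
    · intro e; simp [inputState, arrayOf]
    · intro e; simp [inputState, arrayOf]
    · intro y h1 h2
      simp only [RamState.ivar_setI, inputState]
      split_ifs <;> omega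
    · intro a ha
      simp only [RamState.iarr_setI, inputState]
      rw [if_neg (by omega), if_neg (by omega), if_neg (by omega)]
  have hf₀ : (((inputState G).setI rOne 1).setI rTwo 2).iarr aFst = fun _ => 0 := by
    simp [inputState]
  simp only [RamProg.setup]
  rw [WP.seq_iff, WP.const_iff]
  refine ⟨by omega, ?_⟩
  rw [WP.seq_iff, WP.const_iff]
  refine ⟨by omega, ?_⟩
  rw [WP.seq_iff]
  refine (product_spec (W := W) h₀ (by omega)).mono ?_
  rintro s₁ t₁ ⟨h₁, hnm₁, hf₁, ht₁⟩
  rw [WP.seq_iff]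
  refine (width_spec h₁ hnm₁ hnm (by omega)).mono ?_
  rintro s₂ t₂ ⟨k, h₂, hk, hk', hf₂, ht₂⟩
  have hWk := hW k hk hk'
  rw [WP.seq_iff]
  refine (multiples_spec h₂ (by omega)).mono ?_
  rintro s₃ t₃ ⟨h₃, hvm, hf₃, ht₃⟩
  rw [WP.seq_iff]
  refine (edges_spec h₃ hvm (by simp [hf₃, hf₂, hf₁, hf₀]) hk (by omega)).mono ?_
  rintro s₄ t₄ ⟨h₄, he₄, ht₄⟩
  refine (sources_spec h₄ he₄ hm hWk).mono ?_
  rintro s₅ t₅ ⟨S', a1, a2, a3, a4, a5, a6, a7, a8, a9⟩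
  refine ⟨k, S', a1, hk, hk', a2, a3, a4, a5, a6, a7, a8, ?_⟩
  have e1 : n * (13 * m + 10) = 13 * (n * m) + 10 * n := by ring
  omega

end Specs


/-! ### The program for the output -/

namespace RamProg

/-- Write the entry of the item `rX` at the position `rT` of the list `rV`. -/
def store : RamProg :=
  .add rPA rVm rT ;; .write aOutD rPA rD ;; .fwrite 1 rPA 0 ;; .write aOutP rPA rS2 ;;
  .write aOutQ rPA rS3 ;; .add rB rT rOne ;; .write aLen rV rB ;; .write aBeg rV rVm

/-- Load the components of the item with the number `rI` in the order of the search. -/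
def loadItem : RamProg :=
  .read rX aOrd rI ;; .read rD aDist rX ;; .read rV aQ rX ;; .read rE aI rX ;;
  .sub rVm rX rE ;; .read rPX aPar rX ;; .read rT aLen rV ;;
  .ifLt rZ rPX
    (.fread 0 0 rE ;; .sub rS1 rPX rOne ;; .read rS2 aV rS1 ;; .add rS2 rS2 rOne ;;
     .read rS3 aPos rS1)
    (.ftop 0 ;; .const rS2 0 ;; .const rS3 0)

/-- Items arrive in order of distance, so a comparison with the last entry of the list suffices. A
larger flow appends at a larger distance and overwrites at the same distance; any other item is
dominated. In each case `aPos` records the last position of the list. -/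
def outputStep : RamProg :=
  loadItem ;;
  .ifLt rZ rT
    (.sub rT rT rOne ;; .add rPA rVm rT ;; .fread 1 1 rPA ;;
     .fifLt 1 0
       (.read rDD aOutD rPA ;; .ifLt rDD rD (.add rT rT rOne) .skip ;; store) .skip)
    store ;;
  .write aPos rX rT ;; .add rI rI rOne

def output : RamProg :=
  .const rI 0 ;; .whileLt rI rOc outputStep

end RamProg

/-! ### The lists that arise from the settled items -/

section Specs

open Search

variable {n m c k W : ℕ} {G : FlowGraph n m c} {s : RamState} {S : Search n m}

/-- The flow for which the item `x` is an optimal choice. -/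
noncomputable def Search.flow (S : Search n m) (G : FlowGraph n m c) (x : Item n m) : WithTop ℝ :=
  if S.par x = 0 then ⊤ else G.cap x.2.1

/-- The result of the search, in the memory. -/
structure Result (G : FlowGraph n m c) (S : Search n m) (s : RamState) : Prop where
  z : s.ivar rZ = 0
  one : s.ivar rOne = 1
  oc : s.ivar rOc = S.ord.length
  cap : ∀ e : Fin m, s.farr 0 e = G.cap e
  dist : ∀ x : Item n m, s.iarr aDist x.enc = S.dist x
  par : ∀ x : Item n m, s.iarr aPar x.enc = S.par x
  dec : ∀ x ∈ S.ord,
    s.iarr aQ x.enc = x.1 * n + x.2.2 ∧ s.iarr aI x.enc = x.2.1 ∧ s.iarr aV x.enc = x.2.2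
  ord : ∀ (t : ℕ) (h : t < S.ord.length), s.iarr aOrd t = (S.ord[t]).enc

theorem Result.congr {s' : RamState} (h : Result G S s) (hi : ∀ y < 14, s'.ivar y = s.ivar y)
    (ha : ∀ a, 14 ≤ a → a ≠ aPos → s'.iarr a = s.iarr a) (hf : s'.farr 0 = s.farr 0) :
    Result G S s' := by
  constructor
  · rw [hi _ (by norm_num)]; exact h.z
  · rw [hi _ (by norm_num)]; exact h.one
  · rw [hi _ (by norm_num)]; exact h.oc
  · rw [hf]; exact h.cap
  · rw [ha _ (by norm_num) (by norm_num)]; exact h.dist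
  · rw [ha _ (by norm_num) (by norm_num)]; exact h.par
  · rw [ha aQ (by norm_num) (by norm_num), ha aI (by norm_num) (by norm_num),
      ha aV (by norm_num) (by norm_num)]
    exact h.dec
  · rw [ha _ (by norm_num) (by norm_num)]; exact h.ord

/-- The lists written for the first `t` settled items: `O (u, v)` lists the items from which the
entries of the list of `u` and `v` stem, and `pos x` is the position of an entry at least as good
as the item `x`. -/
structure OutLists (G : FlowGraph n m c) (S : Search n m) (t : ℕ)
    (O : Fin n × Fin n → List (Item n m)) (pos : Item n m → ℕ) : Prop where
  mem : ∀ p, ∀ y ∈ O p, y ∈ S.ord.take t ∧ (y.1, y.2.2) = p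
  incr : ∀ p, (O p).Pairwise fun a b => S.dist a < S.dist b ∧ S.flow G a < S.flow G b
  -- At equal flows the index in the order of settling is compared, since edges of cost 0 would let
  -- a comparison of distances run in circles.
  pos : ∀ x ∈ S.ord.take t, ∃ y, (O (x.1, x.2.2))[pos x]? = some y ∧ S.dist y ≤ S.dist x ∧
    (S.flow G x < S.flow G y ∨ S.flow G x = S.flow G y ∧ S.ord.idxOf y ≤ S.ord.idxOf x)

/-- The memory holds the entries that stem from the items in `O`. -/
structure Written (G : FlowGraph n m c) (S : Search n m)
    (O : Fin n × Fin n → List (Item n m)) (pos : Item n m → ℕ) (t : ℕ) (s : RamState) :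
    Prop where
  len : ∀ p : Fin n × Fin n, s.iarr aLen (p.1 * n + p.2) = (O p).length
  start : ∀ p : Fin n × Fin n, O p ≠ [] → s.iarr aBeg (p.1 * n + p.2) = (p.1 * n + p.2) * m
  entry : ∀ (p : Fin n × Fin n) (j : ℕ) (y : Item n m), (O p)[j]? = some y →
    s.iarr aOutD ((p.1 * n + p.2) * m + j) = S.dist y ∧
    s.farr 1 ((p.1 * n + p.2) * m + j) = S.flow G y ∧
    (S.par y = 0 → s.iarr aOutP ((p.1 * n + p.2) * m + j) = 0) ∧
    -- The recorded position of z is final, while the entry at that position may still be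
    -- overwritten by a better one.
    ∀ z : Item n m, S.par y = z.enc + 1 →
      s.iarr aOutP ((p.1 * n + p.2) * m + j) = z.2.2 + 1 ∧
      s.iarr aOutQ ((p.1 * n + p.2) * m + j) = pos z
  pos : ∀ x ∈ S.ord.take t, s.iarr aPos x.enc = pos x

namespace OutLists

variable {t : ℕ} {O : Fin n × Fin n → List (Item n m)} {pos : Item n m → ℕ}

/-- Distinct entries of one list have the same end vertices, so they come from distinct edges i.
Hence a block of m cells for each list suffices. -/
theorem length_le (h : OutLists G S t O pos) (p : Fin n × Fin n) : (O p).length ≤ m := by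
  have hnd : ((O p).map fun y => y.2.1).Nodup := by
    rw [List.nodup_map_iff_inj_on]
    · intro a ha b hb hab
      have h1 := (h.mem p a ha).2
      have h2 := (h.mem p b hb).2
      rw [← h2] at h1
      simp only [Prod.mk.injEq] at h1
      exact Prod.ext h1.1 (Prod.ext hab h1.2)
    · exact (h.incr p).imp fun hab hh => by rw [hh] at hab; exact absurd hab.1 (lt_irrefl _)
  simpa using hnd.length_le_card

theorem take_succ' (ht : t < S.ord.length) : S.ord.take (t + 1) = S.ord.take t ++ [S.ord[t]] := by
  rw [List.take_add_one]; simp [ht]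

theorem idxOf_lt (hnd : S.ord.Nodup) {y : Item n m} (hy : y ∈ S.ord.take t) :
    S.ord.idxOf y < t := by
  rw [List.mem_take_iff_getElem] at hy
  obtain ⟨j, hj, rfl⟩ := hy
  rw [hnd.idxOf_getElem]
  omega

theorem dist_le (hD : DInv G S fun _ _ => False) (ht : t < S.ord.length) {y : Item n m}
    (hy : y ∈ S.ord.take t) : S.dist y ≤ S.dist S.ord[t] := by
  rw [List.mem_take_iff_getElem] at hy
  obtain ⟨j, hj, rfl⟩ := hy
  exact List.pairwise_iff_getElem.1 hD.ord_mono _ _ _ _ (by omega)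

theorem parent_lt (hD : DInv G S fun _ _ => False) {j : ℕ} {y z : Item n m}
    (hy : S.ord[j]? = some y) (hz : S.par y = z.enc + 1) : ∃ j' < j, S.ord[j']? = some z := by
  have hyv : y.1 ≠ y.2.2 := by
    intro hh
    have := (hD.src y.1 y.2.1).2.2
    nth_rewrite 2 [hh] at this
    simp at this
    omega
  obtain ⟨j', hj', z', h1, h2⟩ := hD.ord_parent j y hy hyv
  have : z = z' := by
    rw [← Item.enc_inj]; omega
  exact ⟨j', hj', this ▸ h1⟩

theorem mem_take_iff {y : Item n m} : y ∈ S.ord.take t ↔ ∃ j < t, S.ord[j]? = some y := by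
  rw [List.mem_iff_getElem?]
  constructor
  · rintro ⟨j, hj⟩
    rw [List.getElem?_take] at hj
    split_ifs at hj with h
    exact ⟨j, h, hj⟩
  · rintro ⟨j, hj, h⟩
    exact ⟨j, by rw [List.getElem?_take, if_pos hj, h]⟩

theorem parent_mem (hD : DInv G S fun _ _ => False) {y z : Item n m}
    (hy : y ∈ S.ord.take (t + 1)) (hz : S.par y = z.enc + 1) : z ∈ S.ord.take t := by
  rw [mem_take_iff] at hy ⊢
  obtain ⟨j, hj, h⟩ := hy
  obtain ⟨j', hj', h'⟩ := parent_lt hD h hz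
  exact ⟨j', by omega, h'⟩

theorem not_mem_take (hD : DInv G S fun _ _ => False) (ht : t < S.ord.length) :
    S.ord[t] ∉ S.ord.take t := by
  intro h
  have := idxOf_lt hD.nodup h
  rw [hD.nodup.idxOf_getElem] at this
  omega

/-- L is the list without the entry that may be overwritten. Positions that referred to that entry
stay good, because its replacement has the same distance and a larger flow. -/
theorem insert (h : OutLists G S t O pos) (hD : DInv G S fun _ _ => False)
    (ht : t < S.ord.length) {x : Item n m} (hx : S.ord[t] = x) {L : List (Item n m)}
    (hO : O (x.1, x.2.2) = L ∨
      ∃ y, O (x.1, x.2.2) = L ++ [y] ∧ S.dist y = S.dist x ∧ S.flow G y < S.flow G x)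
    (hL : ∀ a ∈ L, S.dist a < S.dist x ∧ S.flow G a < S.flow G x) :
    OutLists G S (t + 1) (Function.update O (x.1, x.2.2) (L ++ [x]))
      (Function.update pos x L.length) := by
  have hsub : L.Sublist (O (x.1, x.2.2)) := by
    rcases hO with hO | ⟨y, hO, -⟩
    · rw [hO]
    · rw [hO]; exact List.sublist_append_left _ _
  have htake := take_succ' ht
  rw [hx] at htake
  have hidx : S.ord.idxOf x = t := by rw [← hx, hD.nodup.idxOf_getElem]
  refine ⟨?_, ?_, ?_⟩
  · intro p y hy
    rw [htake]
    by_cases hp : p = (x.1, x.2.2)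
    · subst hp
      simp only [Function.update_self, List.mem_append, List.mem_singleton] at hy ⊢
      rcases hy with hy | rfl
      · have := h.mem _ y (hsub.subset hy)
        exact ⟨Or.inl this.1, this.2⟩
      · simp
    · rw [Function.update_of_ne hp] at hy
      have := h.mem p y hy
      exact ⟨List.mem_append_left _ this.1, this.2⟩
  · intro p
    by_cases hp : p = (x.1, x.2.2)
    · subst hp
      rw [Function.update_self, List.pairwise_append]
      refine ⟨(h.incr _).sublist hsub, by simp, ?_⟩
      intro a ha b hb
      rw [List.mem_singleton] at hb
      rw [hb]; exact hL a ha
    · rw [Function.update_of_ne hp]; exact h.incr p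
  · intro w hw
    rw [htake, List.mem_append, List.mem_singleton] at hw
    by_cases hwx : w = x
    · subst hwx
      exact ⟨w, by simp, le_rfl, Or.inr ⟨rfl, le_rfl⟩⟩
    have hw := hw.resolve_right hwx
    obtain ⟨y, hy1, hy2, hy3⟩ := h.pos w hw
    rw [Function.update_of_ne hwx]
    by_cases hp : (w.1, w.2.2) = (x.1, x.2.2)
    · rw [hp, Function.update_self]
      rw [hp] at hy1
      rcases hO with hO | ⟨y', hO, hO1, hO2⟩
      · rw [hO] at hy1
        exact ⟨y, by rw [List.getElem?_append_left]; exact hy1; exact (List.getElem?_eq_some_iff.1 hy1).1, hy2, hy3⟩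
      · rw [hO] at hy1
        rcases Nat.lt_or_ge (pos w) L.length with hlt | hge
        · rw [List.getElem?_append_left hlt] at hy1
          exact ⟨y, by rw [List.getElem?_append_left hlt]; exact hy1, hy2, hy3⟩
        · have hlt := (List.getElem?_eq_some_iff.1 hy1).1
          simp only [List.length_append, List.length_singleton] at hlt
          have hpw : pos w = L.length := by omega
          rw [hpw] at hy1 ⊢
          simp only [List.getElem?_concat_length, Option.some.injEq] at hy1 ⊢
          subst hy1
          refine ⟨x, rfl, by omega, Or.inl ?_⟩
          rcases hy3 with hy3 | hy3
          · exact hy3.trans hO2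
          · rw [hy3.1]; exact hO2
    · rw [Function.update_of_ne hp]
      exact ⟨y, hy1, hy2, hy3⟩

/-- The last entry y was settled before x, so its distance is no larger; with at least the flow of x
it can stand for x. -/
theorem keep (h : OutLists G S t O pos) (hD : DInv G S fun _ _ => False)
    (ht : t < S.ord.length) {x y : Item n m} (hx : S.ord[t] = x) {L : List (Item n m)}
    (hO : O (x.1, x.2.2) = L ++ [y]) (hxy : S.flow G x ≤ S.flow G y) :
    OutLists G S (t + 1) O (Function.update pos x L.length) := by
  have htake := take_succ' ht
  rw [hx] at htake
  have hidx : S.ord.idxOf x = t := by rw [← hx, hD.nodup.idxOf_getElem]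
  refine ⟨?_, h.incr, ?_⟩
  · intro p w hw
    have := h.mem p w hw
    rw [htake]
    exact ⟨List.mem_append_left _ this.1, this.2⟩
  · intro w hw
    rw [htake, List.mem_append, List.mem_singleton] at hw
    by_cases hwx : w = x
    · subst hwx
      have hy := (h.mem _ y (by rw [hO]; simp)).1
      refine ⟨y, by simp [hO], ?_, ?_⟩
      · rw [← hx]; exact dist_le hD ht hy
      · rcases hxy.lt_or_eq with h1 | h1
        · exact Or.inl h1
        · refine Or.inr ⟨h1, ?_⟩
          rw [hidx]; exact (idxOf_lt hD.nodup hy).le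
    · rw [Function.update_of_ne hwx]
      exact h.pos w (hw.resolve_right hwx)

end OutLists

theorem Item.pair_inj {p q : Fin n × Fin n} : (p.1 : ℕ) * n + p.2 = q.1 * n + q.2 ↔ p = q := by
  constructor
  · intro h
    have := (Item.enc_inj (n := n) (m := 1) (x := (p.1, 0, p.2)) (y := (q.1, 0, q.2))).1
      (by simp [Item.enc, h])
    simp only [Prod.mk.injEq, true_and] at this
    exact Prod.ext this.1 this.2
  · rintro rfl; rfl

theorem Item.cell_inj {p q : Fin n × Fin n} {i j : ℕ} (hi : i < m) (hj : j < m) :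
    ((p.1 : ℕ) * n + p.2) * m + i = (q.1 * n + q.2) * m + j ↔ p = q ∧ i = j := by
  constructor
  · intro h
    have := (Item.enc_inj (x := (p.1, ⟨i, hi⟩, p.2)) (y := (q.1, ⟨j, hj⟩, q.2))).1 h
    simp only [Prod.mk.injEq, Fin.mk.injEq] at this
    exact ⟨Prod.ext this.1 this.2.2, this.2.1⟩
  · rintro ⟨rfl, rfl⟩; rfl

namespace Written

variable {t : ℕ} {O : Fin n × Fin n → List (Item n m)} {pos : Item n m → ℕ} {s' : RamState}

/-- Entries point only to parents settled before them, hence before the item x under consideration;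
assigning a position to x therefore alters no pointer already written. -/
theorem setPos (h : Written G S O pos t s) (hl : ∀ p, ∀ y ∈ O p, y ∈ S.ord.take (t + 1))
    (hD : DInv G S fun _ _ => False) (ht : t < S.ord.length) {x : Item n m} (hx : S.ord[t] = x)
    (v : ℕ) (ha : ∀ a, a = aLen ∨ a = aBeg ∨ a = aOutD ∨ a = aOutP ∨ a = aOutQ →
      s'.iarr a = s.iarr a) (hf : s'.farr 1 = s.farr 1)
    (hp : s'.iarr aPos = Function.update (s.iarr aPos) x.enc v) :
    Written G S O (Function.update pos x v) (t + 1) s' := by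
  have htake := OutLists.take_succ' ht
  rw [hx] at htake
  refine ⟨?_, ?_, ?_, ?_⟩
  · rw [ha _ (by simp)]; exact h.len
  · rw [ha _ (by simp)]; exact h.start
  · intro p j y hy
    rw [ha _ (by simp), ha _ (by simp), ha _ (by simp), hf]
    obtain ⟨h1, h2, h3, h4⟩ := h.entry p j y hy
    refine ⟨h1, h2, h3, fun z hz => ?_⟩
    rw [Function.update_of_ne]
    · exact h4 z hz
    · rintro rfl
      have := OutLists.parent_mem hD (hl p y (List.mem_of_getElem? hy)) hz
      rw [← hx] at this
      exact OutLists.not_mem_take hD ht this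
  · intro w hw
    rw [hp]
    by_cases hwx : w = x
    · subst hwx; simp
    · rw [Function.update_of_ne hwx, Function.update_of_ne (by rwa [Ne, Item.enc_inj])]
      rw [htake, List.mem_append, List.mem_singleton] at hw
      exact h.pos w (hw.resolve_right hwx)

theorem insert (h : Written G S O pos t s) (hl : OutLists G S t O pos) {x : Item n m}
    {L : List (Item n m)} (hL : L.length < m)
    (hO : O (x.1, x.2.2) = L ∨ ∃ y, O (x.1, x.2.2) = L ++ [y])
    (hlen : s'.iarr aLen = Function.update (s.iarr aLen) (x.1 * n + x.2.2) (L.length + 1))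
    (hbeg : s'.iarr aBeg =
      Function.update (s.iarr aBeg) (x.1 * n + x.2.2) ((x.1 * n + x.2.2) * m))
    (hd : s'.iarr aOutD =
      Function.update (s.iarr aOutD) ((x.1 * n + x.2.2) * m + L.length) (S.dist x))
    (hf : s'.farr 1 =
      Function.update (s.farr 1) ((x.1 * n + x.2.2) * m + L.length) (S.flow G x)) {a b : ℕ}
    (hp : s'.iarr aOutP = Function.update (s.iarr aOutP) ((x.1 * n + x.2.2) * m + L.length) a)
    (hq : s'.iarr aOutQ = Function.update (s.iarr aOutQ) ((x.1 * n + x.2.2) * m + L.length) b)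
    (ha : S.par x = 0 → a = 0)
    (hb : ∀ z : Item n m, S.par x = z.enc + 1 → a = z.2.2 + 1 ∧ b = pos z)
    (hpos : s'.iarr aPos = s.iarr aPos) :
    Written G S (Function.update O (x.1, x.2.2) (L ++ [x])) pos t s' := by
  refine ⟨?_, ?_, ?_, ?_⟩
  · intro p
    rw [hlen]
    by_cases hpx : p = (x.1, x.2.2)
    · subst hpx; simp
    · rw [Function.update_of_ne hpx, Function.update_of_ne]
      · exact h.len p
      · exact fun hh => hpx (Item.pair_inj.1 hh)
  · intro p
    rw [hbeg]
    by_cases hpx : p = (x.1, x.2.2)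
    · subst hpx; simp
    · rw [Function.update_of_ne hpx, Function.update_of_ne]
      · exact h.start p
      · exact fun hh => hpx (Item.pair_inj.1 hh)
  · intro p j y hy
    have key : ∀ p' : Fin n × Fin n, (p' ≠ (x.1, x.2.2) ∨ j ≠ L.length) → j < m →
        ((p'.1 : ℕ) * n + p'.2) * m + j ≠ (x.1 * n + x.2.2) * m + L.length := by
      intro p' h1 h2 h3
      have := (Item.cell_inj (p := p') (q := (x.1, x.2.2)) h2 hL).1 h3
      tauto
    by_cases hpx : p = (x.1, x.2.2)
    · subst hpx
      rw [Function.update_self] at hy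
      rcases Nat.lt_or_ge j L.length with hj | hj
      · have hk := key (x.1, x.2.2) (Or.inr (by omega)) (by omega)
        rw [List.getElem?_append_left hj] at hy
        have hy' : (O (x.1, x.2.2))[j]? = some y := by
          rcases hO with hO | ⟨y', hO⟩
          · rw [hO]; exact hy
          · rw [hO, List.getElem?_append_left hj]; exact hy
        have := h.entry _ j y hy'
        rw [hd, hf, hp, hq]
        simp only [Function.update_of_ne hk]
        exact this
      · have hlt := (List.getElem?_eq_some_iff.1 hy).1
        simp only [List.length_append, List.length_singleton] at hlt
        have hpw : j = L.length := by omega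
        subst hpw
        simp only [List.getElem?_concat_length, Option.some.injEq] at hy
        subst hy
        rw [hd, hf, hp, hq]
        simp only [Function.update_self, true_and]
        exact ⟨ha, hb⟩
    · rw [Function.update_of_ne hpx] at hy
      have hj := (List.getElem?_eq_some_iff.1 hy).1
      have hk := key p (Or.inl hpx) (hj.trans_le (hl.length_le p))
      rw [hd, hf, hp, hq]
      simp only [Function.update_of_ne hk]
      exact h.entry p j y hy
  · rw [hpos]; exact h.pos

end Written

end Specs


/-! ### Specifications of the output program -/

section Specs

open Search

variable {n m c k W t : ℕ} {G : FlowGraph n m c} {s : RamState} {S : Search n m}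
  {O : Fin n × Fin n → List (Item n m)} {pos : Item n m → ℕ}

/-- The variables that hold the item `x` in the output phase. -/
structure ItemVars (G : FlowGraph n m c) (S : Search n m) (O : Fin n × Fin n → List (Item n m))
    (pos : Item n m → ℕ) (t : ℕ) (x : Item n m) (s : RamState) : Prop where
  result : Result G S s
  vi : s.ivar rI = t
  vx : s.ivar rX = x.enc
  vd : s.ivar rD = S.dist x
  vv : s.ivar rV = x.1 * n + x.2.2
  vvm : s.ivar rVm = (x.1 * n + x.2.2) * m
  vf : s.fvar 0 = S.flow G x
  pred : S.par x = 0 → s.ivar rS2 = 0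
  succ : ∀ z : Item n m, S.par x = z.enc + 1 → s.ivar rS2 = z.2.2 + 1 ∧ s.ivar rS3 = pos z

theorem ItemVars.setI {x : Item n m} {r v : ℕ} (h : ItemVars G S O pos t x s)
    (hr : r ∈ [rPA, rDD, rB, rT]) : ItemVars G S O pos t x (s.setI r v) := by
  have key : ∀ r' ∈ [rI, rX, rD, rV, rVm, rS2, rS3], (s.setI r v).ivar r' = s.ivar r' := by
    intro r' hr'
    rw [RamState.ivar_setI, if_neg]
    rintro rfl
    simp at hr hr'
    omega
  refine ⟨h.result.congr (fun y hy => ?_) (fun _ _ _ => rfl) rfl, ?_, ?_, ?_, ?_, ?_, h.vf, ?_, ?_⟩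
  · rw [RamState.ivar_setI, if_neg]
    rintro rfl
    simp at hr
    omega
  · rw [key _ (by simp)]; exact h.vi
  · rw [key _ (by simp)]; exact h.vx
  · rw [key _ (by simp)]; exact h.vd
  · rw [key _ (by simp)]; exact h.vv
  · rw [key _ (by simp)]; exact h.vvm
  · rw [key _ (by simp)]; exact h.pred
  · rw [key rS2 (by simp), key rS3 (by simp)]; exact h.succ

theorem ItemVars.setF {x : Item n m} {v : WithTop ℝ} (h : ItemVars G S O pos t x s) :
    ItemVars G S O pos t x (s.setF 1 v) :=
  ⟨h.result.congr (fun _ _ => rfl) (fun _ _ _ => rfl) rfl, h.vi, h.vx, h.vd, h.vv, h.vvm,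
    by simpa using h.vf, h.pred, h.succ⟩

theorem loadItem_spec (hr : Result G S s) (hD : DInv G S fun _ _ => False)
    (ht : t < S.ord.length) {x : Item n m} (hx : S.ord[t] = x) (hI : s.ivar rI = t)
    (hw : Written G S O pos t s) (hW : n ≤ W) :
    WP W .loadItem (fun s' t' => t' ≤ 13 ∧ ItemVars G S O pos t x s' ∧ s'.iarr = s.iarr ∧
      s'.farr = s.farr ∧ s'.ivar rT = (O (x.1, x.2.2)).length) s := by
  have hord := hr.ord t ht
  rw [hx] at hord
  have hdec := hr.dec x (by rw [← hx]; exact List.getElem_mem ht)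
  have hlen := hw.len (x.1, x.2.2)
  simp only at hlen
  -- Removing the edge from the code leaves the first cell of the block of the list, without a
  -- multiplication.
  have hsub : x.enc - x.2.1 = (x.1 * n + x.2.2) * m := by unfold Item.enc; omega
  simp only [RamProg.loadItem, WP.seq_iff, WP.read_iff, WP.sub_iff, WP.ifLt_iff, WP.fread_iff,
    WP.add_iff, WP.ftop_iff, WP.const_iff]
  simp [hI, hord, hdec.1, hdec.2.1, hr.dist, hr.par, hsub, hlen, hr.z, hr.one]
  constructor
  · intro hp
    have hxv : x.1 ≠ x.2.2 := by
      intro hh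
      have := (hD.src x.1 x.2.1).2.2
      nth_rewrite 2 [hh] at this
      simp at this
      omega
    obtain ⟨j, hj, z, hz, hpz⟩ := hD.ord_parent t x (by rw [List.getElem?_eq_getElem ht, hx]) hxv
    have hzm : z ∈ S.ord.take t := OutLists.mem_take_iff.2 ⟨j, hj, hz⟩
    have hzd := hr.dec z (List.mem_of_mem_take hzm)
    have hzp := hw.pos z hzm
    rw [hpz]
    simp only [Nat.add_sub_cancel, hzd.2.2, hzp, hr.cap]
    refine ⟨by omega, ?_, by simp [hI], by simp, by simp, by simp, by simp, ?_, ?_, ?_⟩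
    · refine hr.congr (fun y hy => ?_) (fun _ _ _ => rfl) rfl
      simp only [RamState.ivar_setI, RamState.ivar_setF]
      repeat rw [if_neg (by omega)]
    · simp [Search.flow, hp.ne']
    · intro h0; omega
    · intro w hw'
      have : w = z := by rw [← Item.enc_inj]; omega
      subst this
      simp
  · intro hp
    refine ⟨?_, by simp [hI], by simp, by simp, by simp, by simp, ?_, ?_, ?_⟩
    · refine hr.congr (fun y hy => ?_) (fun _ _ _ => rfl) rfl
      simp only [RamState.ivar_setI, RamState.ivar_setF]
      repeat rw [if_neg (by omega)]
    · simp [Search.flow, hp]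
    · simp
    · intro w hw'; omega

theorem store_spec {x : Item n m} (hv : ItemVars G S O pos t x s) {s₀ : RamState}
    (hsi : s.iarr = s₀.iarr) (hsf : s.farr = s₀.farr) (hw : Written G S O pos t s₀)
    (hl : OutLists G S t O pos) (hD : DInv G S fun _ _ => False)
    (ht : t < S.ord.length) (hx : S.ord[t] = x) {L : List (Item n m)}
    (hO : O (x.1, x.2.2) = L ∨
      ∃ y, O (x.1, x.2.2) = L ++ [y] ∧ S.dist y = S.dist x ∧ S.flow G y < S.flow G x)
    (hL : ∀ a ∈ L, S.dist a < S.dist x ∧ S.flow G a < S.flow G x)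
    (hT : s.ivar rT = L.length) (hW : n * n * m + m ≤ W) :
    WP W .store (fun s' t' => t' ≤ 8 ∧ ∃ O', Result G S s' ∧
      OutLists G S (t + 1) O' (Function.update pos x L.length) ∧ Written G S O' pos t s' ∧
      s'.ivar rT = L.length ∧ s'.ivar rX = x.enc ∧ s'.ivar rI = t) s := by
  have hl' := hl.insert hD ht hx hO hL
  have hLm : L.length < m := by
    have := hl'.length_le (x.1, x.2.2)
    simp only [Function.update_self, List.length_append, List.length_singleton] at this
    omega
  have hq := x.quot_lt
  have hqm : (x.1 * n + x.2.2) * m + m ≤ n * n * m := by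
    have := Nat.mul_le_mul_right m (Nat.succ_le_of_lt hq)
    rw [Nat.succ_mul] at this
    exact this
  simp only [RamProg.store, WP.seq_iff, WP.add_iff, WP.write_iff, WP.fwrite_iff]
  simp [hv.vvm, hT, hv.vd, hv.vv, hv.result.one]
  refine ⟨by omega, by omega, ?_, _, hl', ?_, ?_, ?_⟩
  · refine hv.result.congr (fun y hy => ?_) (fun a h1 h2 => ?_) ?_
    · simp only [RamState.ivar_setI, RamState.ivar_setIA, RamState.ivar_setFA]
      rw [if_neg (by omega), if_neg (by omega)]
    · simp only [RamState.iarr_setI, RamState.iarr_setIA, RamState.iarr_setFA]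
      repeat rw [if_neg (by omega)]
    · simp
  · refine hw.insert (a := s.ivar rS2) (b := s.ivar rS3) hl hLm ?_ ?_ ?_ ?_ ?_ ?_ ?_ hv.pred hv.succ ?_
    · rcases hO with hO | ⟨y, hO, -⟩
      · exact Or.inl hO
      · exact Or.inr ⟨y, hO⟩
    · simp [hsi]
    · simp [hsi]
    · simp [hsi]
    · simp [hsf, hv.vf]
    · simp [hsi]
    · simp [hsi]
    · simp [hsi]
  · simpa using hv.vx
  · simpa using hv.vi

theorem outputStep_spec (hr : Result G S s) (hD : DInv G S fun _ _ => False)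
    (ht : t < S.ord.length) (hI : s.ivar rI = t) (hl : OutLists G S t O pos)
    (hw : Written G S O pos t s) (hW : n * n * m + m + n + S.ord.length ≤ W) :
    WP W .outputStep (fun s' t' => t' ≤ 40 ∧ ∃ O' pos', Result G S s' ∧
      OutLists G S (t + 1) O' pos' ∧ Written G S O' pos' (t + 1) s' ∧ s'.ivar rI = t + 1) s := by
  obtain ⟨x, hx⟩ : ∃ x, S.ord[t] = x := ⟨_, rfl⟩
  unfold RamProg.outputStep
  rw [WP.seq_iff]
  refine (loadItem_spec hr hD ht hx hI hw (by omega)).mono ?_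
  rintro s₁ t₁ ⟨ht₁, hv, hsi, hsf, hT⟩
  rw [WP.seq_iff]
  have hqm : (x.1 * n + x.2.2) * m + m ≤ n * n * m := by
    have := Nat.mul_le_mul_right m (Nat.succ_le_of_lt x.quot_lt)
    rw [Nat.succ_mul] at this
    exact this
  have key : WP W (.ifLt rZ rT
     (.sub rT rT rOne ;; .add rPA rVm rT ;; .fread 1 1 rPA ;;
     .fifLt 1 0
       (.read rDD aOutD rPA ;; .ifLt rDD rD (.add rT rT rOne) .skip ;; .store) .skip)
    .store) (fun s' t' => t' ≤ 20 ∧ ∃ O' j, Result G S s' ∧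
      OutLists G S (t + 1) O' (Function.update pos x j) ∧ Written G S O' pos t s' ∧
      s'.ivar rT = j ∧ s'.ivar rX = x.enc ∧ s'.ivar rI = t) s₁ := by
    rw [WP.ifLt_iff, hv.result.z, hT]
    constructor
    · intro hlt
      obtain ⟨L, y, hLy⟩ : ∃ L y, O (x.1, x.2.2) = L ++ [y] :=
        ⟨_, _, (List.dropLast_append_getLast (List.ne_nil_of_length_pos hlt)).symm⟩
      have hlen : (O (x.1, x.2.2)).length = L.length + 1 := by simp [hLy]
      have hlm := hl.length_le (x.1, x.2.2)
      have hent := hw.entry (x.1, x.2.2) L.length y (by simp [hLy])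
      simp only at hent
      have hinc := hl.incr (x.1, x.2.2)
      rw [hLy, List.pairwise_append] at hinc
      have hyx : S.dist y ≤ S.dist x := by
        rw [← hx]
        exact OutLists.dist_le hD ht (hl.mem (x.1, x.2.2) y (by rw [hLy]; simp)).1
      have hv₂ : ItemVars G S O pos t x (((s₁.setI rT L.length).setI rPA
          ((x.1 * n + x.2.2) * m + L.length)).setF 1 (S.flow G y)) :=
        ((hv.setI (by simp)).setI (by simp)).setF
      rw [WP.seq_iff, WP.sub_iff, hT, hv.result.one, hlen, Nat.add_sub_cancel, WP.seq_iff,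
        WP.add_iff]
      simp only [RamState.ivar_setI, if_true, show (19 : ℕ) ≠ 22 by norm_num, if_false, hv.vvm]
      refine ⟨by omega, ?_⟩
      rw [WP.seq_iff, WP.fread_iff]
      simp only [RamState.ivar_setI, if_true, RamState.farr_setI, hsf, hent.2.1]
      set s₂ := (((s₁.setI rT L.length).setI rPA
          ((x.1 * n + x.2.2) * m + L.length)).setF 1 (S.flow G y)) with hs₂
      have hT₂ : s₂.ivar rT = L.length := by simp [hs₂]
      have hPA₂ : s₂.ivar rPA = (x.1 * n + x.2.2) * m + L.length := by simp [hs₂]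
      have hf₂ : s₂.fvar 1 = S.flow G y := by simp [hs₂]
      have hsi₂ : s₂.iarr = s.iarr := hsi
      have hsf₂ : s₂.farr = s.farr := hsf
      clear_value s₂
      rw [WP.fifLt_iff, hv₂.vf, hf₂]
      constructor
      · intro hflow
        rw [WP.seq_iff, WP.read_iff, hPA₂, hsi₂, hent.1, WP.seq_iff, WP.ifLt_iff]
        have hv₃ : ItemVars G S O pos t x (s₂.setI rDD (S.dist y)) := hv₂.setI (by simp)
        have hd₃ : (s₂.setI rDD (S.dist y)).ivar rDD = S.dist y := by simp
        have hT₃ : (s₂.setI rDD (S.dist y)).ivar rT = L.length := by simp [hT₂]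
        rw [hv₃.vd, hd₃]
        constructor
        · intro hdist
          rw [WP.add_iff, hT₃, hv₃.result.one]
          refine ⟨by omega, ?_⟩
          refine (store_spec (L := L ++ [y]) (hv₃.setI (by simp)) hsi₂ hsf₂ hw hl hD ht hx
            (Or.inl hLy) ?_ (by simp) (by omega)).mono ?_
          · intro a ha
            rw [List.mem_append, List.mem_singleton] at ha
            rcases ha with ha | rfl
            · have := hinc.2.2 a ha y (by simp)
              exact ⟨this.1.trans hdist, this.2.trans hflow⟩
            · exact ⟨hdist, hflow⟩
          · rintro s₄ t₄ ⟨h1, O', h2⟩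
            exact ⟨by omega, O', _, h2⟩
        · intro hdist
          rw [WP.skip_iff]
          refine (store_spec (L := L) hv₃ hsi₂ hsf₂ hw hl hD ht hx
            (Or.inr ⟨y, hLy, by omega, hflow⟩) ?_ hT₃ (by omega)).mono ?_
          · intro a ha
            have := hinc.2.2 a ha y (by simp)
            exact ⟨by omega, this.2.trans hflow⟩
          · rintro s₄ t₄ ⟨h1, O', h2⟩
            exact ⟨by omega, O', _, h2⟩
      · intro hflow
        rw [WP.skip_iff]
        refine ⟨by omega, O, L.length, hv₂.result, hl.keep hD ht hx hLy (not_lt.1 hflow), ?_, hT₂,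
          hv₂.vx, hv₂.vi⟩
        exact ⟨by rw [hsi₂]; exact hw.len, by rw [hsi₂]; exact hw.start,
          by rw [hsi₂, hsf₂]; exact hw.entry, by rw [hsi₂]; exact hw.pos⟩
    · intro hlt
      have hnil : O (x.1, x.2.2) = [] := List.eq_nil_of_length_eq_zero (by omega)
      refine (store_spec (L := []) hv hsi hsf hw hl hD ht hx
        (Or.inl hnil) (by simp) (by rw [hT, hnil]) (by omega)).mono ?_
      rintro s₄ t₄ ⟨h1, O', h2⟩
      exact ⟨by omega, O', _, h2⟩
  refine key.mono ?_
  rintro s₂ t₂ ⟨ht₂, O', j, hr₂, hl₂, hw₂, hT₂, hX₂, hI₂⟩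
  simp only [WP.seq_iff, WP.write_iff, WP.add_iff, RamState.ivar_setIA, hT₂, hX₂, hI₂, hr₂.one]
  refine ⟨by omega, by omega, O', _, ?_, hl₂, ?_, by simp⟩
  · refine hr₂.congr (fun y hy => ?_) (fun a h1 h2 => ?_) rfl
    · simp only [RamState.ivar_setI, RamState.ivar_setIA]
      rw [if_neg (by omega)]
    · simp only [RamState.iarr_setI, RamState.iarr_setIA]
      rw [if_neg (by omega)]
  · refine hw₂.setPos (fun p y hy => (hl₂.mem p y hy).1) hD ht hx j ?_ rfl ?_
    · rintro a (rfl | rfl | rfl | rfl | rfl) <;> simp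
    · simp

theorem output_spec (hr : SearchRep G k s S) (hD : DInv G S fun _ _ => False)
    (hW : n * n * m + m + n + S.ord.length ≤ W) :
    WP W .output (fun s' t' => t' ≤ 41 * S.ord.length + 3 ∧ ∃ O pos,
      OutLists G S S.ord.length O pos ∧ Written G S O pos S.ord.length s') s := by
  have hr₀ : Result G S s := ⟨hr.env.z, hr.env.one, hr.oc, hr.env.cap, hr.dist, hr.par,
    fun x hx => hr.dec x (by rw [(hD.mem_ord x).1 hx]; norm_num), hr.ord⟩
  unfold RamProg.output
  rw [WP.seq_iff, WP.const_iff]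
  refine ⟨by omega, ?_⟩
  refine WP.countLoop (fun t s' => ∃ O pos, Result G S s' ∧ OutLists G S t O pos ∧
    Written G S O pos t s' ∧ s'.ivar rI = t) S.ord.length 40 ?_ ?_ ?_ ?_
  · refine ⟨fun _ => [], fun _ => 0, hr₀.congr (fun y hy => ?_) (fun _ _ _ => rfl) rfl,
      ⟨by simp, by simp, by simp⟩, ⟨?_, by simp, by simp, by simp⟩, by simp⟩
    · simp only [RamState.ivar_setI]
      rw [if_neg (by omega)]
    · intro p; simp [hr.env.len]
  · rintro t s' - ⟨O, pos, h1, -, -, h2⟩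
    rw [h2, h1.oc]
  · rintro t s' ht ⟨O, pos, h1, h2, h3, h4⟩
    exact outputStep_spec h1 hD ht h4 h2 h3 hW
  · rintro s' t ht ⟨O, pos, -, h2, h3, -⟩
    exact ⟨by omega, O, pos, h2, h3⟩

end Specs


/-! ### Correctness of the output -/

namespace FlowGraph

variable {n m c : ℕ} (G : FlowGraph n m c)

theorem IsPath.concat {G : FlowGraph n m c} {π : List (Fin m)} {u : Fin n} {e : Fin m}
    (h : G.IsPath u π (G.src e)) : G.IsPath u (π ++ [e]) (G.dst e) := by
  induction π generalizing u with
  | nil => exact ⟨h.symm, rfl⟩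
  | cons e' π ih => exact ⟨h.1, ih h.2⟩

theorem pathCost_concat (π : List (Fin m)) (e : Fin m) :
    G.pathCost (π ++ [e]) = G.pathCost π + G.cost e := by
  simp [pathCost]

theorem bottleneck_concat (π : List (Fin m)) (e : Fin m) :
    G.bottleneck (π ++ [e]) = min (G.bottleneck π) (G.cap e) := by
  induction π with
  | nil => simp [bottleneck]
  | cons e' π ih =>
    simp only [bottleneck, List.cons_append, List.foldr_cons] at ih ⊢
    rw [ih, min_assoc]

theorem bottleneck_eq_cap {π : List (Fin m)} (h : π ≠ []) :
    ∃ e, G.bottleneck π = G.cap e := by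
  induction π with
  | nil => exact absurd rfl h
  | cons e π ih =>
    have hb : G.bottleneck (e :: π) = min (G.cap e : WithTop ℝ) (G.bottleneck π) := rfl
    rw [hb]
    rcases min_choice (G.cap e : WithTop ℝ) (G.bottleneck π) with h1 | h1
    · exact ⟨e, h1⟩
    · rw [h1]
      by_cases hπ : π = []
      · subst hπ
        exact ⟨e, by rw [← h1]; simp [bottleneck]⟩
      · exact ih hπ

end FlowGraph

namespace Search

variable {n m c : ℕ} {G : FlowGraph n m c} {S : Search n m}

theorem DInv.lab_eq_one (hD : DInv G S fun _ _ => False) (h0 : S.live = 0) {x : Item n m}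
    (hx : S.lab x ≠ 0) : S.lab x = 1 := by
  by_contra h1
  have := hD.live_card
  rw [h0] at this
  have hx : x ∈ Finset.univ.filter fun x => 2 ≤ S.lab x := by simp; omega
  rw [Finset.card_eq_zero.1 this.symm] at hx
  simp at hx

/-- With no live item, every seen item is settled and all its edges in the layer are relaxed; the
inequalities add up along the path. -/
theorem DInv.path_le (hD : DInv G S fun _ _ => False) (h0 : S.live = 0) {u v : Fin n} {i : Fin m}
    {π : List (Fin m)} : ∀ {w : Fin n}, S.lab (u, i, w) ≠ 0 → G.IsPath w π v →
      (G.cap i : WithTop ℝ) ≤ G.bottleneck π →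
      S.lab (u, i, v) ≠ 0 ∧ S.dist (u, i, v) ≤ S.dist (u, i, w) + G.pathCost π := by
  induction π with
  | nil =>
    rintro w hw rfl -
    exact ⟨hw, by simp [FlowGraph.pathCost]⟩
  | cons e π ih =>
    rintro w hw ⟨rfl, hp⟩ hb
    have hb' : (G.cap i : WithTop ℝ) ≤ min (G.cap e : WithTop ℝ) (G.bottleneck π) := hb
    rw [le_min_iff, WithTop.coe_le_coe] at hb'
    obtain ⟨h1, h2⟩ := hD.closed u i e (hD.lab_eq_one h0 hw) hb'.1 id
    obtain ⟨h3, h4⟩ := ih h1 hp hb'.2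
    refine ⟨h3, h4.trans ?_⟩
    simp only [FlowGraph.pathCost, List.map_cons, List.sum_cons]
    omega

theorem DInv.par_eq_zero (hD : DInv G S fun _ _ => False) {x : Item n m} (hx : S.lab x ≠ 0) :
    S.par x = 0 ↔ x.1 = x.2.2 := by
  constructor
  · intro h
    by_contra hne
    obtain ⟨e, -, -, -, h4, -⟩ := hD.parent x.1 x.2.1 x.2.2 hne hx
    change S.par x = _ at h4
    omega
  · intro h
    have := (hD.src x.1 x.2.1).2.2
    nth_rewrite 2 [h] at this
    exact this

theorem cap_le_flow (x : Item n m) : (G.cap x.2.1 : WithTop ℝ) ≤ S.flow G x := by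
  unfold flow; split_ifs <;> simp

/-- Parents stay in the layer and are settled earlier, which allows induction on the index in `ord`.
The flow ∞ occurs only at sources, with the empty path. -/
theorem DInv.exists_path (hD : DInv G S fun _ _ => False) (j : ℕ) :
    ∀ y, S.ord[j]? = some y → ∃ π, G.IsPath y.1 π y.2.2 ∧ G.pathCost π = S.dist y ∧
      S.flow G y ≤ G.bottleneck π := by
  induction j using Nat.strong_induction_on with
  | _ j ih =>
    intro y hy
    have hy1 : S.lab y = 1 := (hD.mem_ord y).1 (List.mem_of_getElem? hy)
    by_cases hyv : y.1 = y.2.2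
    · have := (hD.src y.1 y.2.1).2.1
      nth_rewrite 2 [hyv] at this
      exact ⟨[], hyv, this.symm, by simp [FlowGraph.bottleneck]⟩
    · obtain ⟨e, h1, h2, h3, h4, h5⟩ := hD.parent y.1 y.2.1 y.2.2 hyv (by
        show S.lab y ≠ 0; omega)
      change S.par y = _ at h4
      change S.dist y = _ at h5
      obtain ⟨j', hj', hz⟩ := OutLists.parent_lt hD hy h4
      obtain ⟨π, p1, p2, p3⟩ := ih j' hj' _ hz
      refine ⟨π ++ [e], ?_, ?_, ?_⟩
      · rw [← h1]; exact p1.concat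
      · rw [G.pathCost_concat, p2, h5]
      · rw [G.bottleneck_concat, flow, if_neg (by omega)]
        exact le_min ((cap_le_flow (S := S) (G := G) (y.1, y.2.1, G.src e)).trans p3)
          (WithTop.coe_le_coe.2 h2)

/-- Every path is dominated by an item. -/
theorem DInv.exists_item (hD : DInv G S fun _ _ => False) (h0 : S.live = 0) (hm : 1 ≤ m)
    {u v : Fin n} {π : List (Fin m)} (hp : G.IsPath u π v) :
    ∃ i, S.lab (u, i, v) = 1 ∧ S.dist (u, i, v) ≤ G.pathCost π ∧
      G.bottleneck π ≤ S.flow G (u, i, v) := by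
  by_cases hπ : π = []
  · subst hπ
    obtain rfl : u = v := hp
    -- The empty path occurs in any layer; that one exists is where m ≥ 1 enters.
    obtain ⟨h1, h2, h3⟩ := hD.src u ⟨0, hm⟩
    exact ⟨⟨0, hm⟩, hD.lab_eq_one h0 h1, by omega, by simp [flow, h3]⟩
  · obtain ⟨e, he⟩ := G.bottleneck_eq_cap hπ
    obtain ⟨h1, h2, h3⟩ := hD.src u e
    obtain ⟨h4, h5⟩ := hD.path_le h0 h1 hp he.ge
    refine ⟨e, hD.lab_eq_one h0 h4, by omega, ?_⟩
    rw [he]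
    exact cap_le_flow (S := S) (G := G) (u, e, v)

end Search

/-! ### The lists consist of the useful pairs, and paths can be retrieved -/

section Specs

open Search

variable {n m c : ℕ} {G : FlowGraph n m c} {s : RamState} {S : Search n m}
  {O : Fin n × Fin n → List (Item n m)} {pos : Item n m → ℕ}

theorem OutLists.dominates (h : OutLists G S S.ord.length O pos)
    (hD : DInv G S fun _ _ => False) (h0 : S.live = 0) (hm : 1 ≤ m) {u v : Fin n}
    {π : List (Fin m)} (hp : G.IsPath u π v) :
    ∃ y ∈ O (u, v), S.dist y ≤ G.pathCost π ∧ G.bottleneck π ≤ S.flow G y := by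
  obtain ⟨i, h1, h2, h3⟩ := hD.exists_item h0 hm hp
  obtain ⟨y, g1, g2, g3⟩ := h.pos (u, i, v) (by rw [List.take_length, hD.mem_ord]; exact h1)
  refine ⟨y, List.mem_of_getElem? g1, g2.trans h2, h3.trans ?_⟩
  rcases g3 with g3 | g3
  · exact g3.le
  · exact g3.1.le

theorem OutLists.exists_path (h : OutLists G S S.ord.length O pos)
    (hD : DInv G S fun _ _ => False) {u v : Fin n} {y : Item n m} (hy : y ∈ O (u, v)) :
    ∃ π, G.IsPath u π v ∧ G.pathCost π = S.dist y ∧ S.flow G y ≤ G.bottleneck π := by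
  obtain ⟨h1, h2⟩ := h.mem _ y hy
  simp only [Prod.mk.injEq] at h2
  rw [List.take_length, List.mem_iff_getElem?] at h1
  obtain ⟨j, hj⟩ := h1
  obtain ⟨π, hπ⟩ := hD.exists_path j y hj
  rw [h2.1, h2.2] at hπ
  exact ⟨π, hπ⟩

theorem OutLists.dist_le_of_flow_le {t : ℕ} (h : OutLists G S t O pos) {p : Fin n × Fin n}
    {x y : Item n m} (hx : x ∈ O p) (hy : y ∈ O p) (hxy : S.flow G x ≤ S.flow G y) :
    S.dist x ≤ S.dist y := by
  refine List.Pairwise.forall_of_forall_of_flip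
    (R := fun a b => S.flow G a ≤ S.flow G b → S.dist a ≤ S.dist b) (fun _ _ _ => le_rfl)
    ((h.incr p).imp ?_) ((h.incr p).imp ?_) hx hy hxy
  · exact fun hab _ => hab.1.le
  · exact fun hab hba => absurd hab.2 (not_lt.2 hba)

theorem OutLists.flow_le_of_dist_le {t : ℕ} (h : OutLists G S t O pos) {p : Fin n × Fin n}
    {x y : Item n m} (hx : x ∈ O p) (hy : y ∈ O p) (hxy : S.dist x ≤ S.dist y) :
    S.flow G x ≤ S.flow G y := by
  refine List.Pairwise.forall_of_forall_of_flip
    (R := fun a b => S.dist a ≤ S.dist b → S.flow G a ≤ S.flow G b) (fun _ _ _ => le_rfl)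
    ((h.incr p).imp ?_) ((h.incr p).imp ?_) hx hy hxy
  · exact fun hab _ => hab.2.le
  · exact fun hab hba => absurd hab.1 (not_lt.2 hba)

/-- A competing path is dominated by some entry z. Along a list distance and flow increase together,
so comparing z with y in one coordinate settles the other. -/
theorem OutLists.isUseful (h : OutLists G S S.ord.length O pos)
    (hD : DInv G S fun _ _ => False) (h0 : S.live = 0) (hm : 1 ≤ m) {u v : Fin n}
    {y : Item n m} (hy : y ∈ O (u, v)) : G.IsUseful u v (S.dist y) (S.flow G y) := by
  obtain ⟨π, p1, p2, p3⟩ := h.exists_path hD hy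
  have hub : ∀ π', G.IsPath u π' v → G.pathCost π' ≤ S.dist y → G.bottleneck π' ≤ S.flow G y := by
    intro π' q1 q2
    obtain ⟨z, hz, z1, z2⟩ := h.dominates hD h0 hm q1
    exact z2.trans (h.flow_le_of_dist_le hz hy (z1.trans q2))
  refine ⟨⟨⟨π, p1, p3, p2⟩, ?_⟩, ⟨π, p1, p2.le, le_antisymm (hub π p1 p2.le) p3⟩, ?_⟩
  · rintro d ⟨π', q1, q2, rfl⟩
    obtain ⟨z, hz, z1, z2⟩ := h.dominates hD h0 hm q1
    exact (h.dist_le_of_flow_le hy hz (q2.trans z2)).trans z1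
  · rintro f ⟨π', q1, q2, rfl⟩
    exact hub π' q1 q2

theorem OutLists.exists_of_isUseful (h : OutLists G S S.ord.length O pos)
    (hD : DInv G S fun _ _ => False) (h0 : S.live = 0) (hm : 1 ≤ m) {u v : Fin n} {d : ℕ}
    {f : WithTop ℝ} (hu : G.IsUseful u v d f) :
    ∃ y ∈ O (u, v), S.dist y = d ∧ S.flow G y = f := by
  obtain ⟨⟨-, hd⟩, ⟨⟨π, p1, p2, p3⟩, hf⟩⟩ := hu
  obtain ⟨y, hy, y1, y2⟩ := h.dominates hD h0 hm p1
  obtain ⟨π', q1, q2, q3⟩ := h.exists_path hD hy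
  rw [p3] at y2
  have h1 : S.dist y = d := le_antisymm (y1.trans p2) (hd ⟨π', q1, y2.trans q3, q2⟩)
  exact ⟨y, hy, h1, le_antisymm (q3.trans (hf ⟨π', q1, by omega, rfl⟩)) y2⟩

theorem Written.exists_getElem {t : ℕ} (h : Written G S O pos t s) {u v : Fin n} {j : ℕ} {y : Item n m}
    (hy : (O (u, v))[j]? = some y) : ∃ r, (outputLists s u v)[j]? = some r ∧
      r.dist = S.dist y ∧ r.flow = S.flow G y ∧ (S.par y = 0 → r.pred = 0) ∧
      ∀ z : Item n m, S.par y = z.enc + 1 → r.pred = z.2.2 + 1 ∧ r.predPos = pos z := by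
  have hlen := h.len (u, v)
  have hj := (List.getElem?_eq_some_iff.1 hy).1
  have hbeg := h.start (u, v) (List.ne_nil_of_length_pos (by omega))
  obtain ⟨e1, e2, e3, e4⟩ := h.entry (u, v) j y hy
  simp only at hlen hbeg e1 e2 e3 e4
  refine ⟨
    { dist := s.iarr 5 (s.iarr 4 (u * n + v) + j)
      flow := s.farr 1 (s.iarr 4 (u * n + v) + j)
      pred := s.iarr 6 (s.iarr 4 (u * n + v) + j)
      predPos := s.iarr 7 (s.iarr 4 (u * n + v) + j) }, ?_, ?_⟩
  · unfold outputLists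
    rw [List.getElem?_map, List.getElem?_range (by omega)]
    rfl
  · simp only [hbeg]
    exact ⟨e1, e2, e3, e4⟩

theorem Written.length_eq {t : ℕ} (h : Written G S O pos t s) (u v : Fin n) :
    (outputLists s u v).length = (O (u, v)).length := by
  simp only [outputLists, List.length_map, List.length_range]
  exact h.len (u, v)

theorem Written.exists_of_mem {t : ℕ} (h : Written G S O pos t s) {u v : Fin n} {r : FlowEntry}
    (hr : r ∈ outputLists s u v) : ∃ (j : ℕ) (y : Item n m), (O (u, v))[j]? = some y ∧
      (outputLists s u v)[j]? = some r := by
  obtain ⟨j, hj⟩ := List.mem_iff_getElem?.1 hr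
  have hlt := (List.getElem?_eq_some_iff.1 hj).1
  rw [h.length_eq] at hlt
  exact ⟨j, _, List.getElem?_eq_getElem hlt, hj⟩

theorem Written.map_dist {t : ℕ} (h : Written G S O pos t s) (u v : Fin n) :
    (outputLists s u v).map FlowEntry.dist = (O (u, v)).map S.dist := by
  refine List.ext_getElem? fun j => ?_
  rw [List.getElem?_map, List.getElem?_map]
  rcases Nat.lt_or_ge j (O (u, v)).length with hj | hj
  · obtain ⟨r, h1, h2, -⟩ := h.exists_getElem (List.getElem?_eq_getElem hj)
    rw [h1, List.getElem?_eq_getElem hj]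
    simp [h2]
  · rw [List.getElem?_eq_none hj, List.getElem?_eq_none (by rw [h.length_eq]; exact hj)]
    rfl

/-- The outer induction is on the number of items with larger flow than y, the inner one on the
index of y. The pointer leads to an entry w at least as good as the parent z of y. If the flow has
grown, the outer measure drops. Otherwise w is settled no later than z, hence before y. Only
inequalities for cost and bottleneck are carried along, since w may lie in another layer than z. -/
theorem Written.retrieves (h : Written G S O pos S.ord.length s)
    (hl : OutLists G S S.ord.length O pos) (hD : DInv G S fun _ _ => False) (a : ℕ) :
    ∀ (b : ℕ) (u v : Fin n) (j : ℕ) (y : Item n m) (r : FlowEntry),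
      (Finset.univ.filter fun w => S.flow G y < S.flow G w).card = a → S.ord.idxOf y = b →
      (O (u, v))[j]? = some y → (outputLists s u v)[j]? = some r →
      ∃ π, Retrieves G (outputLists s) u v r π ∧ G.IsPath u π v ∧
        G.pathCost π ≤ S.dist y ∧ S.flow G y ≤ G.bottleneck π := by
  induction a using Nat.strong_induction_on with
  | _ a iha =>
    intro b
    induction b using Nat.strong_induction_on with
    | _ b ihb =>
      intro u v j y r ha hb hy hr
      obtain ⟨r', hr', r1, r2, r3, r4⟩ := h.exists_getElem hy
      obtain rfl : r = r' := by rw [hr] at hr'; exact Option.some.inj hr'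
      obtain ⟨hy1, hy2⟩ := hl.mem _ y (List.mem_of_getElem? hy)
      rw [List.take_length] at hy1
      have hy0 : S.lab y = 1 := (hD.mem_ord y).1 hy1
      simp only [Prod.mk.injEq] at hy2
      obtain ⟨rfl, rfl⟩ := hy2
      by_cases hp : S.par y = 0
      · have hyv := (hD.par_eq_zero (by omega)).1 hp
        refine ⟨[], ?_, hyv, by simp [FlowGraph.pathCost], by simp [FlowGraph.bottleneck]⟩
        rw [← hyv]
        exact .start r (r3 hp)
      · have hyv : y.1 ≠ y.2.2 := fun hh => hp ((hD.par_eq_zero (by omega)).2 hh)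
        obtain ⟨e, e1, e2, e3, e4, e5⟩ := hD.parent y.1 y.2.1 y.2.2 hyv (by
          show S.lab y ≠ 0; omega)
        change S.par y = _ at e4
        change S.dist y = _ at e5
        obtain ⟨r5, r6⟩ := r4 _ e4
        set z : Item n m := (y.1, y.2.1, G.src e) with hz
        obtain ⟨w, w1, w2, w3⟩ := hl.pos z (by rw [List.take_length, hD.mem_ord]; exact e3)
        obtain ⟨q, hq, -⟩ := h.exists_getElem w1
        have hfy : S.flow G y = G.cap y.2.1 := by rw [flow, if_neg hp]
        have hfz : S.flow G y ≤ S.flow G z := by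
          rw [hfy]; exact cap_le_flow (S := S) (G := G) z
        have hidx : S.ord.idxOf z < S.ord.idxOf y := by
          obtain ⟨t, ht⟩ := List.mem_iff_getElem?.1 hy1
          obtain ⟨t', ht', hz'⟩ := OutLists.parent_lt hD ht e4
          obtain ⟨g1, rfl⟩ := List.getElem?_eq_some_iff.1 ht
          obtain ⟨g2, hz''⟩ := List.getElem?_eq_some_iff.1 hz'
          rw [← hz'', hD.nodup.idxOf_getElem, hD.nodup.idxOf_getElem]
          exact ht'
        have hrec : ∃ π, Retrieves G (outputLists s) z.1 z.2.2 q π ∧ G.IsPath z.1 π z.2.2 ∧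
            G.pathCost π ≤ S.dist w ∧ S.flow G w ≤ G.bottleneck π := by
          by_cases hlt : S.flow G y < S.flow G w
          · refine iha _ ?_ _ _ _ _ w q rfl rfl w1 hq
            rw [← ha]
            refine Finset.card_lt_card ⟨fun x hx => ?_, fun hsub => ?_⟩
            · simp only [Finset.mem_filter, Finset.mem_univ, true_and] at hx ⊢
              exact hlt.trans hx
            · have := hsub (show w ∈ _ by simpa using hlt)
              simp at this
          · have hle := not_lt.1 hlt
            rcases w3 with w3 | ⟨w3, w4⟩
            · exact absurd (hfz.trans_lt w3) hlt
            · have heq : S.flow G w = S.flow G y := le_antisymm hle (w3 ▸ hfz)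
              exact ihb _ (by omega) _ _ _ w q (by rw [heq]; exact ha) rfl w1 hq
        obtain ⟨π, p1, p2, p3, p4⟩ := hrec
        refine ⟨π ++ [e], ?_, ?_, ?_, ?_⟩
        · rw [← e1]
          exact .step e r q π r5 (by rw [r6]; exact hq) p1
        · rw [← e1]; exact FlowGraph.IsPath.concat p2
        · rw [G.pathCost_concat, e5]
          exact Nat.add_le_add_right (p3.trans w2) _
        · rw [G.bottleneck_concat]
          refine le_min (hfz.trans (le_trans ?_ p4)) ?_
          · rcases w3 with w3 | w3
            · exact w3.le
            · exact w3.1.le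
          · rw [hfy]; exact WithTop.coe_le_coe.2 e2

theorem Written.solves (h : Written G S O pos S.ord.length s)
    (hl : OutLists G S S.ord.length O pos) (hD : DInv G S fun _ _ => False) (h0 : S.live = 0)
    (hm : 1 ≤ m) : SolvesAPSPAF G (outputLists s) := by
  intro u v
  refine ⟨?_, ?_, ?_⟩
  · rw [h.map_dist, List.pairwise_map]
    exact (hl.incr _).imp fun hab => hab.1
  · intro d f
    constructor
    · rintro ⟨r, hr, rfl, rfl⟩
      obtain ⟨j, y, hy, hj⟩ := h.exists_of_mem hr
      obtain ⟨r', hr', r1, r2, -⟩ := h.exists_getElem hy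
      obtain rfl : r = r' := by rw [hj] at hr'; exact Option.some.inj hr'
      rw [r1, r2]
      exact hl.isUseful hD h0 hm (List.mem_of_getElem? hy)
    · intro hu
      obtain ⟨y, hy, rfl, rfl⟩ := hl.exists_of_isUseful hD h0 hm hu
      obtain ⟨j, hj⟩ := List.mem_iff_getElem?.1 hy
      obtain ⟨r, hr, r1, r2, -⟩ := h.exists_getElem hj
      exact ⟨r, List.mem_of_getElem? hr, r1, r2⟩
  · intro r hr
    obtain ⟨j, y, hy, hj⟩ := h.exists_of_mem hr
    obtain ⟨r', hr', r1, r2, -⟩ := h.exists_getElem hy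
    obtain rfl : r = r' := by rw [hj] at hr'; exact Option.some.inj hr'
    obtain ⟨π, p1, p2, p3, p4⟩ := h.retrieves hl hD _ _ u v j y r rfl rfl hy hj
    -- The pair is optimal and the retrieved path is no worse in either coordinate, so both
    -- inequalities are equalities.
    obtain ⟨⟨-, hd⟩, -, hf⟩ := hl.isUseful hD h0 hm (List.mem_of_getElem? hy)
    refine ⟨π, p1, p2, ?_, ?_⟩
    · rw [r1]; exact le_antisymm p3 (hd ⟨π, p2, p4, rfl⟩)
    · rw [r2]; exact le_antisymm (hf ⟨π, p2, p3, rfl⟩) p4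

end Specs


/-! ### Counting items, and adding up the running time -/

namespace FlowGraph

variable {n m c : ℕ} (G : FlowGraph n m c)

/-- There are no parallel edges. This is why words of O(log (n + c)) bits can also hold numbers
polynomial in m. -/
theorem card_edges_le (G : FlowGraph n m c) : m ≤ n * n := by
  have := Fintype.card_le_of_injective (fun e : Fin m => (G.src e, G.dst e)) fun e e' h =>
    G.edge_inj e e' (congrArg Prod.fst h) (congrArg Prod.snd h)
  simpa using this

theorem card_items_le : G.items.card ≤ n * m * min n (m + 1) := by
  let T : Fin n → Finset (Fin n) := fun u => insert u (Finset.univ.image G.dst)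
  have hT : ∀ u, (T u).card ≤ min n (m + 1) := fun u => by
    refine le_min (by simpa using Finset.card_le_univ (T u)) ?_
    refine (Finset.card_insert_le _ _).trans (Nat.succ_le_succ ?_)
    simpa using Finset.card_image_le (s := (Finset.univ : Finset (Fin m))) (f := G.dst)
  have hsub : G.items ⊆ (Finset.univ : Finset (Fin n)).biUnion fun u =>
      (Finset.univ : Finset (Fin m)).biUnion fun i => (T u).image fun v => (u, i, v) := by
    rintro ⟨u, i, v⟩ hx
    simp only [items, Finset.mem_filter, Finset.mem_univ, true_and] at hx
    simp only [Finset.mem_biUnion, Finset.mem_univ, true_and, Finset.mem_image, T]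
    refine ⟨u, i, v, ?_, rfl⟩
    rcases hx with rfl | ⟨e, rfl⟩ <;> simp
  refine (Finset.card_le_card hsub).trans (Finset.card_biUnion_le.trans ?_)
  refine (Finset.sum_le_card_nsmul _ _ (m * min n (m + 1)) fun u _ => ?_).trans (by simp [mul_assoc])
  refine Finset.card_biUnion_le.trans ?_
  refine (Finset.sum_le_card_nsmul _ _ (min n (m + 1)) fun i _ => ?_).trans (by simp)
  exact Finset.card_image_le.trans (hT u)

theorem sum_length_out : ∑ v, (G.out v).length = m := by
  have h : ∀ v, (G.out v).length = (Finset.univ.filter fun e => G.src e = v).card := fun v => by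
    rw [← List.toFinset_card_of_nodup]
    · congr 1
      ext e
      simp
    · exact List.nodup_reverse.2 ((List.nodup_finRange m).filter _)
  simp only [h]
  rw [← Finset.card_eq_sum_card_fiberwise fun _ _ => Finset.mem_coe.2 (Finset.mem_univ _)]
  simp

end FlowGraph

namespace Search

variable {n m c k : ℕ} {G : FlowGraph n m c}

/-- The outdegrees sum to m in each of the nm layers; this is the term nm². Everything else is
charged to the reachable items. -/
theorem itemsPot_le (lab : Item n m → ℕ) :
    itemsPot G k lab ≤ n * m * min n (m + 1) * (200 * k + 800) + 600 * (n * m * m) := by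
  have h1 : ∀ x, itemPot G k lab x ≤ (200 * k + 800) + 600 * (G.out x.2.2).length := fun x => by
    unfold itemPot levels
    split_ifs <;> omega
  refine (Finset.sum_le_sum fun x _ => h1 x).trans ?_
  rw [Finset.sum_add_distrib, Finset.sum_const, smul_eq_mul, ← Finset.mul_sum]
  refine Nat.add_le_add (Nat.mul_le_mul_right _ G.card_items_le) (Nat.mul_le_mul_left _ ?_)
  refine (Finset.sum_le_sum_of_subset (Finset.subset_univ _)).trans ?_
  simp only [Fintype.sum_prod_type, G.sum_length_out]
  simp [mul_assoc]

end Search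

/-- A bound on the time of the search. -/
def searchBound (n m k : ℕ) : ℕ :=
  n * m * min n (m + 1) * (200 * k + 820) + 600 * (n * m * m) + 201 * (n * m)

/-- The program for all pairs shortest paths for all flows. -/
def RamProg.apspaf : RamProg := .seq .setup (.seq .search .output)

section Specs

open Search

variable {n m c W : ℕ}

theorem apspaf_spec (G : FlowGraph n m c) (hn : 1 ≤ n) (hm : 1 ≤ m)
    (hW : ∀ k, c ≤ 2 ^ k * (n * m) → (k = 0 ∨ 2 ^ (k - 1) * (n * m) < c) →
      wordBound n m c k (searchBound n m k) ≤ W) :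
    WP W .apspaf (fun s t => SolvesAPSPAF G (outputLists s) ∧
      ∃ k, (k = 0 ∨ 2 ^ (k - 1) * (n * m) < c) ∧
        t ≤ 405 * (k * (n * m * min n (m + 1))) + 4962 * (n * m * m)) (inputState G) := by
  have hq : 1 ≤ min n (m + 1) := le_min hn (by omega)
  unfold RamProg.apspaf
  rw [WP.seq_iff]
  refine (setup_spec hm hW hn).mono ?_
  rintro s₁ t₁ ⟨k, S₁, h₁, hk, hk', hlv, hhi, hord, hcnt, hl0, hl, -, ht₁⟩
  have hWk := hW k hk hk'
  -- By the choice of k the number of buckets is of the order of the bound for the number of items,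
  -- so passing over them costs no more than the items do.
  have hH : c * min n (m + 1) / 2 ^ k ≤ n * m * min n (m + 1) := by
    refine Nat.div_le_of_le_mul ?_
    calc c * min n (m + 1) ≤ 2 ^ k * (n * m) * min n (m + 1) := Nat.mul_le_mul_right _ hk
      _ = _ := by ring
  have hent : ∀ A, entries A S₁.L ≤ n * m := fun A => by
    rw [← hl0]
    unfold entries
    rcases A with _ | A
    · simp
    · rw [Finset.sum_range_succ', Finset.sum_eq_zero fun a _ => by rw [hl _ (by omega)]; rfl]
      omega
  have hpot : s₁.ivar rCnt + pot G k (k + 2 + n * m * min n (m + 1)) (n * m * min n (m + 1)) S₁ ≤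
      searchBound n m k := by
    have e1 := itemsPot_le (G := G) (k := k) S₁.lab
    have e2 := hent (k + 2 + n * m * min n (m + 1))
    have e3 : S₁.levelPot k = 0 := by simp [levelPot, hlv]
    unfold pot searchBound
    rw [e3, hcnt, hhi, hord, List.length_nil]
    have e4 : n * m * min n (m + 1) * (200 * k + 820) =
      n * m * min n (m + 1) * (200 * k + 800) + 20 * (n * m * min n (m + 1)) := by ring
    omega
  rw [WP.seq_iff]
  refine (search_spec h₁ hm hWk hH hpot).mono ?_
  rintro s₂ t₂ ⟨ht₂, S₂, h₂, hlive, hlen⟩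
  have hWo : n * n * m + m + n + S₂.ord.length ≤ W := by
    unfold wordBound at hWk
    omega
  refine (output_spec h₂.rep h₂.dinv hWo).mono ?_
  rintro s₃ t₃ ⟨ht₃, O, pos, hO, hw⟩
  refine ⟨hw.solves hO h₂.dinv hlive hm, k, hk', ?_⟩
  unfold searchBound at ht₂ hlen
  generalize hN : n * m * min n (m + 1) = N at *
  have b1 : 1 ≤ N := by
    rw [← hN]
    exact Nat.mul_pos (Nat.mul_pos hn hm) hq
  have b2 : N ≤ 2 * (n * m * m) := by
    have : min n (m + 1) ≤ 2 * m := (min_le_right _ _).trans (by omega)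
    calc N ≤ n * m * (2 * m) := hN ▸ Nat.mul_le_mul_left _ this
      _ = _ := by ring
  have b3 : n * m ≤ n * m * m := Nat.le_mul_of_pos_right _ hm
  have b4 : n ≤ n * m := Nat.le_mul_of_pos_right _ hm
  have b5 : m ≤ n * m := Nat.le_mul_of_pos_left _ hn
  have b6 : k ≤ k * N := Nat.le_mul_of_pos_right _ b1
  have b7 : N * (200 * k + 820) = 200 * (k * N) + 820 * N := by ring
  have b8 : m * (3 * (n * m) + 13) = 3 * (n * m * m) + 13 * m := by ring
  omega

theorem wordBound_searchBound_le {k : ℕ} (hn : 1 ≤ n) (hmn : m ≤ n * n) (hm : 1 ≤ m)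
    (hk : k = 0 ∨ 2 ^ (k - 1) * (n * m) < c) :
    wordBound n m c k (searchBound n m k) ≤ (n + c + 2) ^ 13 := by
  obtain ⟨B, hB⟩ : ∃ B, n + c + 2 = B := ⟨_, rfl⟩
  have h2k : 2 ^ k ≤ 2 * B := by
    rcases hk with rfl | hk
    · rw [pow_zero]; omega
    · rcases k with _ | k
      · rw [pow_zero]; omega
      · have : 2 ^ k ≤ 2 ^ k * (n * m) := Nat.le_mul_of_pos_right _ (Nat.mul_pos hn hm)
        rw [Nat.add_sub_cancel] at hk
        rw [pow_succ]
        omega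
  have hkB : k ≤ 2 * B := Nat.lt_two_pow_self.le.trans h2k
  have hnB : n ≤ B := by omega
  have hcB : c ≤ B := by omega
  have hmB : m ≤ B * B := hmn.trans (Nat.mul_le_mul hnB hnB)
  have hB1 : 3 ≤ B := by omega
  have hq : min n (m + 1) ≤ B := (min_le_left _ _).trans hnB
  rw [hB]
  unfold wordBound searchBound
  have p : ∀ i ≤ 5, B ^ i ≤ B ^ 5 := fun i hi => Nat.pow_le_pow_right (by omega) hi
  have a0 : 1 ≤ B ^ 5 := by simpa using p 0 (by omega)
  have a1 : B ≤ B ^ 5 := by simpa using p 1 (by omega)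
  have a2 : n * n * m ≤ B ^ 5 := (Nat.mul_le_mul (Nat.mul_le_mul hnB hnB) hmB).trans
    (le_of_eq_of_le (by ring) (p 4 (by omega)))
  have a3 : n * m ≤ B ^ 5 := (Nat.mul_le_mul hnB hmB).trans
    (le_of_eq_of_le (by ring) (p 3 (by omega)))
  have a4 : n * n ≤ B ^ 5 := (Nat.mul_le_mul hnB hnB).trans
    (le_of_eq_of_le (by ring) (p 2 (by omega)))
  have a5 : c * n ≤ B ^ 5 := (Nat.mul_le_mul hcB hnB).trans
    (le_of_eq_of_le (by ring) (p 2 (by omega)))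
  have a6 : n * m * m ≤ B ^ 5 := (Nat.mul_le_mul (Nat.mul_le_mul hnB hmB) hmB).trans
    (le_of_eq_of_le (by ring) le_rfl)
  have a7 : n * m * min n (m + 1) ≤ B ^ 4 := (Nat.mul_le_mul (Nat.mul_le_mul hnB hmB) hq).trans
    (le_of_eq_of_le (by ring) le_rfl)
  have a8 : n * m * min n (m + 1) * (200 * k + 820) ≤ 1220 * B ^ 5 :=
    (Nat.mul_le_mul a7 (show 200 * k + 820 ≤ 1220 * B by omega)).trans (le_of_eq (by ring))
  -- Here 2187 = 3 ^ 7 exceeds the sum of all coefficients, and B ≥ 3.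
  have a9 : 2187 * B ^ 5 ≤ B ^ 13 :=
    calc 2187 * B ^ 5 ≤ B ^ 7 * B ^ 5 := Nat.mul_le_mul_right _
          (le_of_eq_of_le (by norm_num) (Nat.pow_le_pow_left hB1 7))
      _ = B ^ 12 := by ring
      _ ≤ B ^ 13 := Nat.pow_le_pow_right (by omega) (by omega)
  omega

end Specs

/-- Minimality of k gives 2 ^ (k - 1) < c / (mn) for positive k; the factor 2 comes from log 2 >
1/2. -/
theorem width_le_log {k n m c : ℕ} (hn : 1 ≤ n) (hm : 1 ≤ m)
    (hk : k = 0 ∨ 2 ^ (k - 1) * (n * m) < c) :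
    (k : ℝ) ≤ 1 + 2 * max 0 (Real.log ((c : ℝ) / (m * n))) := by
  have h0 := le_max_left 0 (Real.log ((c : ℝ) / (m * n)))
  rcases k with _ | k
  · simp only [Nat.cast_zero]
    linarith
  · have hk' : 2 ^ k * (n * m) < c := by simpa using hk
    have hpos : (0 : ℝ) < m * n := by
      have : (0 : ℝ) < m := by exact_mod_cast hm
      have : (0 : ℝ) < n := by exact_mod_cast hn
      positivity
    have h1 : (2 : ℝ) ^ k ≤ (c : ℝ) / (m * n) := by
      rw [le_div_iff₀ hpos]
      have : ((2 ^ k * (n * m) : ℕ) : ℝ) ≤ c := by exact_mod_cast hk'.le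
      push_cast at this
      linarith
    have h2 := Real.log_le_log (by positivity) h1
    rw [Real.log_pow] at h2
    have h3 := Real.log_two_gt_d9
    have h4 := le_max_right 0 (Real.log ((c : ℝ) / (m * n)))
    have h5 : (k : ℝ) * (1 / 2) ≤ k * Real.log 2 :=
      mul_le_mul_of_nonneg_left (by linarith) (Nat.cast_nonneg k)
    push_cast
    linarith

theorem apspaf_solves : SolvesAPSPAFInTime .apspaf
    (fun n m c : ℕ => (m : ℝ) ^ 2 * n + m * (n : ℝ) ^ 2 *
      max 0 (Real.log ((c : ℝ) / (m * n)))) := by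
  refine ⟨6000, 13, fun n m c hm G => ?_⟩
  have hn : 1 ≤ n := by have := (G.src ⟨0, hm⟩).2; omega
  obtain ⟨s, t, he, hs, k, hk, ht⟩ := apspaf_spec G hn hm fun k _ hk =>
    wordBound_searchBound_le hn G.card_edges_le hm hk
  refine ⟨s, t, he, hs, ?_⟩
  have hl := width_le_log hn hm hk
  have h0 := le_max_left 0 (Real.log ((c : ℝ) / (m * n)))
  set l := max 0 (Real.log ((c : ℝ) / (m * n)))
  have hm1 : (1 : ℝ) ≤ m := by exact_mod_cast hm
  have hn1 : (1 : ℝ) ≤ n := by exact_mod_cast hn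
  -- N is bounded in two ways: k N ≤ N + 2 l N, where N ≤ 2m²n serves the first summand and N ≤ mn²
  -- the second. The constant 6000 exceeds 2 · 405 + 4962.
  have hN1 : ((n * m * min n (m + 1) : ℕ) : ℝ) ≤ 2 * ((m : ℝ) ^ 2 * n) := by
    have : min n (m + 1) ≤ 2 * m := (min_le_right _ _).trans (by omega)
    have := Nat.mul_le_mul_left (n * m) this
    calc ((n * m * min n (m + 1) : ℕ) : ℝ) ≤ ((n * m * (2 * m) : ℕ) : ℝ) := by exact_mod_cast this
      _ = _ := by push_cast; ring
  have hN2 : ((n * m * min n (m + 1) : ℕ) : ℝ) ≤ m * (n : ℝ) ^ 2 := by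
    have := Nat.mul_le_mul_left (n * m) (min_le_left n (m + 1))
    calc ((n * m * min n (m + 1) : ℕ) : ℝ) ≤ ((n * m * n : ℕ) : ℝ) := by exact_mod_cast this
      _ = _ := by push_cast; ring
  have ht' : (t : ℝ) ≤ 405 * (k * ((n * m * min n (m + 1) : ℕ) : ℝ)) +
      4962 * ((m : ℝ) ^ 2 * n) := by
    have h : (t : ℝ) ≤ _ := Nat.cast_le.2 ht
    refine h.trans (le_of_eq ?_)
    push_cast
    ring
  have hN0 : (0 : ℝ) ≤ ((n * m * min n (m + 1) : ℕ) : ℝ) := Nat.cast_nonneg _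
  generalize ((n * m * min n (m + 1) : ℕ) : ℝ) = N at *
  have hA : 0 ≤ (m : ℝ) ^ 2 * n := by positivity
  have hB : 0 ≤ (m : ℝ) * (n : ℝ) ^ 2 * l := by positivity
  have h1 : (k : ℝ) * N ≤ (1 + 2 * l) * N := mul_le_mul_of_nonneg_right hl hN0
  have h2 : N * l ≤ m * (n : ℝ) ^ 2 * l := mul_le_mul_of_nonneg_right hN2 h0
  push_cast
  linarith

theorem SolvesAPSPAFInTime.mono {P : RamProg} {T T' : ℕ → ℕ → ℕ → ℝ}
    (h : SolvesAPSPAFInTime P T) (hT : ∀ n m c, T n m c ≤ T' n m c) : SolvesAPSPAFInTime P T' := by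
  obtain ⟨C, K, h⟩ := h
  refine ⟨C, K, fun n m c hm G => ?_⟩
  obtain ⟨s, t, h1, h2, h3⟩ := h n m c hm G
  exact ⟨s, t, h1, h2, h3.trans (mul_le_mul_of_nonneg_left (hT n m c) (Nat.cast_nonneg C))⟩

theorem mainTheorem3 :
    (∃ P : RamProg, SolvesAPSPAFInTime P
      (fun n m c : ℕ => (m : ℝ) ^ 2 * n + n * c)) ∧
    (∃ P : RamProg, SolvesAPSPAFInTime P
      (fun n m c : ℕ => (m : ℝ) ^ 2 * n + m * (n : ℝ) ^ 2 *
        max 0 (Real.log ((c : ℝ) / (m * n))))) := by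
  refine ⟨⟨_, apspaf_solves.mono fun n m c => ?_⟩, _, apspaf_solves⟩
  rcases Nat.eq_zero_or_pos n with rfl | hn
  · simp
  rcases Nat.eq_zero_or_pos m with rfl | hm
  · simp
    positivity
  have hm1 : (0 : ℝ) < m := by exact_mod_cast hm
  have hn1 : (0 : ℝ) < n := by exact_mod_cast hn
  have hx : (0 : ℝ) ≤ (c : ℝ) / (m * n) := by positivity
  -- With log⁺ x ≤ x the logarithmic term becomes mn² · c/(mn) = nc.
  have hl : max 0 (Real.log ((c : ℝ) / (m * n))) ≤ (c : ℝ) / (m * n) :=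
    max_le hx (Real.log_le_self hx)
  refine add_le_add le_rfl ((mul_le_mul_of_nonneg_left hl (by positivity)).trans (le_of_eq ?_))
  field_simp
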